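/- Let $d,n\ge 1$ and $m\ge 0$ be integers, and let $s_1,\dots,s_n\in(0,\infty)$. For $\sigma$-finite measure spaces $(\mathscr W_1,\mu_1),\dots,(\mathscr W_m,\mu_m)$ with product $\mathscr W$, and tuples of exponents $P=(p^1,\dots,p^d)$, $R=(r^1,\dots,r^m)$ in $(0,\infty]$, write $$\|f\|_{L^P_{\mathbb R^d}L^R_{\mathscr W}}:=\Big\|\dots\big\|\,\|\dots\|f\|_{L^{r^m}_{w_m}}\dots\|_{L^{r^1}_{w_1}}\big\|_{L^{p^d}_{x_d}}\dots\Big\|_{L^{p^1}_{x_1}} .$$ For functions $f_1,\dots,f_n$ on $\mathbb R^d\times\mathscr W$ let $$M_{s_1,\dots,s_n}(f_1,\dots,f_n)(x,w):=\sup_{Q\ni x}\ \prod_{j=1}^n\Big(\frac1{|Q|}\int_{\mathbb R^d}|f_j(y,w)|^{s_j}\,\chi_Q(y)\,dy\Big)^{1/s_j},$$ the supremum being over all cubes $Q$ in $\mathbb R^d$ (with sides parallel to the axes) containing $x$. Here either $\chi_Q=\mathbf 1_Q$ for all $Q$, or $\chi_Q(y)=\big(1+\operatorname{dist}(y,Q)/\ell(Q)\big)^{-M}$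 for all $Q$, where $\ell(Q)$ is the side length of $Q$ and $M$ is a sufficiently large number depending only on $d$, $n$, $m$, the $s_j$ and the exponents below. A Hölder tuple is a tuple $(p_1,\dots,p_n,p_{n+1})$ with $\frac1{p_1}+\dots+\frac1{p_n}+\frac1{p_{n+1}}=1$, $1<p_1,\dots,p_n\le\infty$ and $\frac1n<p_{n+1}'<\infty$, where $\frac1{p_{n+1}}+\frac1{p_{n+1}'}=1$ (so $p_{n+1}$ may be negative or infinite). A tuple $(q_1,\dots,q_n)$ is $(\frac1{s_1},\dots,\frac1{s_n})$-local if $\frac1{q_j}<\frac1{s_j}$ for all $j$. Let $P_j=(p_j^1,\dots,p_j^d)$ and $R_j=(r_j^1,\dots,r_j^m)$, $1\le j\le n+1$. Assume that for every $1\le i\le d$ the tuple $(p_1^i,\dots,p_{n+1}^i)$ is a Hölder tuple with $(p_1^i,\dots,p_n^i)$ being $(\frac1{s_1},\dots,\frac1{s_n})$-local, and that for every $1\le i\le m$ the tuple $(r_1^i,\dots,r_{n+1}^i)$ is a Hölder tuple with $(r_1^i,\dots,r_n^i)$ being $(\frac1{s_1},\dots,\frac1{s_n})$-local. (Exponents $p_j^i,r_j^i$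 equal to $\infty$ are allowed for $j\le n$.) Write $P_{n+1}'$ and $R_{n+1}'$ for the componentwise Hölder conjugates of $P_{n+1}$ and $R_{n+1}$. Then $M_{s_1,\dots,s_n}$ maps $\prod_{j=1}^nL^{P_j}_{\mathbb R^d}L^{R_j}_{\mathscr W}$ boundedly to $L^{P_{n+1}'}_{\mathbb R^d}L^{R_{n+1}'}_{\mathscr W}$: for all measurable $f_1,\dots,f_n$ the function $M_{s_1,\dots,s_n}(f_1,\dots,f_n)$ is measurable and $$\big\|M_{s_1,\dots,s_n}(f_1,\dots,f_n)\big\|_{L^{P_{n+1}'}_{\mathbb R^d}L^{R_{n+1}'}_{\mathscr W}}\le C\prod_{j=1}^n\big\|f_j\big\|_{L^{P_j}_{\mathbb R^d}L^{R_j}_{\mathscr W}},$$ with a constant $C<\infty$ that depends only on $d$, $n$, $m$, the $s_j$ and the exponents (and on $M$, in the case of the bump weight), and not on the functions or the measure spaces. -/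

import Mathlib

open MeasureTheory
open scoped ENNReal NNReal

universe u

/-- The iterated mixed norm `‖ … ‖F‖_{L^{p_k}(a_k)} … ‖_{L^{p_1}(a_1)}` of a nonnegative function on
a finite product of measure spaces: the last variable is integrated first (innermost), the first
variable last (outermost). For exponents `0 < p < ∞`, `eLpNorm` is `(∫ F ^ p) ^ (1 / p)`, and
for `p = ∞` it is the essential supremum. For `k = 0` it is the value at the only point. -/
noncomputable def mixedNorm : {k : ℕ} → {α : Fin k → Type u} → [∀ i, MeasurableSpace (α i)] →
    (Fin k → ℝ≥0∞) → (∀ i, Measure (α i)) → ((∀ i, α i) → ℝ≥0∞) → ℝ≥0∞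
  | 0, _, _, _, _, F => F (fun i => i.elim0)
  | _ + 1, _, _, p, μ, F =>
      eLpNorm (fun a => mixedNorm (fun i => p i.succ) (fun i => μ i.succ)
        (fun b => F (Fin.cons a b))) (p 0) (μ 0)

/-- The mixed norm `‖F‖_{L^P_{ℝ^d} L^R_𝒲}`, with `L^P_{ℝ^d}` outside and `L^R_𝒲` inside. -/
noncomputable def vvMixedNorm {d m : ℕ} {W : Fin m → Type u} [∀ i, MeasurableSpace (W i)]
    (P : Fin d → ℝ≥0∞) (R : Fin m → ℝ≥0∞) (μ : ∀ i, Measure (W i))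
    (F : (Fin d → ℝ) → (∀ i, W i) → ℝ≥0∞) : ℝ≥0∞ :=
  mixedNorm P (fun _ => (volume : Measure ℝ)) (fun x => mixedNorm R μ (fun w => F x w))

/-- `(p_1, …, p_n, p_{n+1})` is a Hölder tuple. The last exponent, which may be negative or infinite,
is given through its Hölder conjugate `p' = p'_{n+1}`, `1 / p_{n+1} = 1 - 1 / p'`, so that
`1 / p_1 + ⋯ + 1 / p_{n+1} = 1` reads `1 / p_1 + ⋯ + 1 / p_n = 1 / p'`. -/
structure IsHolderTuple {n : ℕ} (p : Fin n → ℝ≥0∞) (p' : ℝ≥0∞) : Prop where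
  one_lt : ∀ j, 1 < p j
  inv_lt : (n : ℝ≥0∞)⁻¹ < p'
  lt_top : p' < ∞
  sum_inv : ∑ j, (p j)⁻¹ = p'⁻¹

/-- The tuple `(q_1, …, q_n)` is `(a_1, …, a_n)`-local: `1 / q_j < a_j` for all `j`. -/
def IsLocalTuple {n : ℕ} (a : Fin n → ℝ) (q : Fin n → ℝ≥0∞) : Prop :=
  ∀ j, (q j)⁻¹ < ENNReal.ofReal (a j)

/-- The (axis-parallel, open) cube in `ℝ^d` with lower corner `a` and side length `l`. -/
def cube {d : ℕ} (a : Fin d → ℝ) (l : ℝ) : Set (Fin d → ℝ) :=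
  Set.univ.pi fun i => Set.Ioo (a i) (a i + l)

/-- The characteristic function of the cube with lower corner `a` and side length `l`. -/
noncomputable def sharpWeight {d : ℕ} (a : Fin d → ℝ) (l : ℝ) (y : Fin d → ℝ) : ℝ≥0∞ :=
  (cube a l).indicator 1 y

/-- The bump function `(1 + dist (y, Q) / ℓ(Q)) ^ (-M)` adapted to the cube `Q` with lower corner `a`
and side length `l`. The distance is that of the sup norm, which is at most the Euclidean one, so
this weight is the larger of the two (and they are comparable). -/
noncomputable def bumpWeight {d : ℕ} (M : ℝ) (a : Fin d → ℝ) (l : ℝ) (y : Fin d → ℝ) : ℝ≥0∞ :=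
  ENNReal.ofReal ((1 + Metric.infDist y (cube a l) / l) ^ (-M))

/-- The multi-sublinear maximal operator
`sup_{Q ∋ x} ∏_j ( 1 / |Q| * ∫ |g_j(y)| ^ s_j * χ_Q(y) dy ) ^ (1 / s_j)`,
the supremum over all cubes `Q` containing `x`, for a choice of weights `χ_Q`. -/
noncomputable def multiMaximal {d n : ℕ}
    (χ : (Fin d → ℝ) → ℝ → (Fin d → ℝ) → ℝ≥0∞) (s : Fin n → ℝ)
    (g : Fin n → (Fin d → ℝ) → ℂ) (x : Fin d → ℝ) : ℝ≥0∞ :=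
  ⨆ (a : Fin d → ℝ) (l : ℝ) (_ : 0 < l) (_ : x ∈ cube a l),
    ∏ j, ((volume (cube a l))⁻¹ * ∫⁻ y, ‖g j y‖ₑ ^ s j * χ a l y) ^ (1 / s j)

/-- The vector-valued extension: the maximal operator acts on `f_j(·, w)` for each fixed `w`. -/
noncomputable def vvMultiMaximal {d n : ℕ} {Ω : Type u}
    (χ : (Fin d → ℝ) → ℝ → (Fin d → ℝ) → ℝ≥0∞) (s : Fin n → ℝ)
    (f : Fin n → (Fin d → ℝ) × Ω → ℂ) (x : Fin d → ℝ) (w : Ω) : ℝ≥0∞ :=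
  multiMaximal χ s (fun j y => f j (y, w)) x

/-- The operator `M_{s_1, …, s_n}` built with the weights `χ` is bounded, with constant `C`, from
`∏_j L^{P_j}_{ℝ^d} L^{R_j}_𝒲` to `L^{P'}_{ℝ^d} L^{R'}_𝒲`, where `𝒲` is the product of
the measure spaces `(W i, μ i)`: the image of measurable functions is measurable and the norm
inequality holds. -/
def MaximalBoundedOn {d n m : ℕ}
    (χ : (Fin d → ℝ) → ℝ → (Fin d → ℝ) → ℝ≥0∞) (s : Fin n → ℝ)
    (P : Fin n → Fin d → ℝ≥0∞) (P' : Fin d → ℝ≥0∞)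
    (R : Fin n → Fin m → ℝ≥0∞) (R' : Fin m → ℝ≥0∞) (C : ℝ≥0)
    (W : Fin m → Type u) [∀ i, MeasurableSpace (W i)] (μ : ∀ i, Measure (W i)) : Prop :=
  ∀ f : Fin n → (Fin d → ℝ) × (∀ i, W i) → ℂ,
    (∀ j, AEMeasurable (f j) ((volume : Measure (Fin d → ℝ)).prod (Measure.pi μ))) →
      AEMeasurable (fun z : (Fin d → ℝ) × (∀ i, W i) => vvMultiMaximal χ s f z.1 z.2)
        ((volume : Measure (Fin d → ℝ)).prod (Measure.pi μ)) ∧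
      vvMixedNorm P' R' μ (vvMultiMaximal χ s f) ≤
        C * ∏ j, vvMixedNorm (P j) (R j) μ (fun x w => ‖f j (x, w)‖ₑ)

universe v


/-! Put `g_j = |f_j| ^ s_j` and `θ_j = 1 / s_j`. The power rule turns the `L^p` norm of `f_j` into
the `θ_j`-th power of the `L^(p / s_j)` norm of `g_j`, and locality says exactly that `p / s_j > 1`.
What remains is to bound the supremum over cubes of `∏ (average of g_j) ^ θ_j` for input exponents
in `(1, ∞]` and output exponents in `(0, ∞)` related by a weighted Hölder identity (`Admissible`).
Bump averages are dominated by decaying multiples of averages over dilated cubes, so a large `M`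
reduces them to sharp ones. A sharp cube lies in a cell of comparable size of one of `2 ^ d` dyadic
grids shifted by thirds. Hence a dyadic maximal operator has to be bounded, uniformly in the grid
and in the number of generations.

The dyadic operator is studied over an abstract nested sequence of partitions of a space `E`
(`Grid`), acting on functions whose values are functions of the remaining variables. The engine is
`exists_extrapolation`: for fixed norms `ρ_j`, `ρ'` in the remaining variables, a bound from `∏
L^{p_j}(E; ρ_j)` to `L^{p'}(E; ρ')` for one admissible tuple implies the bound for every admissible
tuple. The proof is a good-`λ` argument against the product of the scalar maximal functions of `ρ_j
(f_j)`, which Doob and Hölder control. On a cell, each `f_j` is stopped when the average of `ρ_j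
(f_j)` grows by a factor `Λ`. The stopped functions are bounded in `ρ_j`, so the known bound and
Chebyshev apply to them, and they have the same averages as `f_j` off a set of small relative
measure. The inputs need Minkowski's inequality; the output needs only a quasi-norm, so output
exponents below `1` cause no trouble.

Extrapolation leaves the exponents on `E` free, which permits induction on the number of variables.
For an inner variable, choose on `E` the exponents of that variable: equal exponents commute, the
variable moves outside, and Hölder's inequality integrates the bound for fixed values of it
(`exists_maxBound_inner`). For a Euclidean variable, choose again its exponents on `E`: then `E` and
the line merge into a product grid with one fewer variable left over (`exists_maxBound`). The
induction is finally applied with `E` a single point. -/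

namespace VVMaximal

/-! ### `L^p` norms of `ℝ≥0∞`-valued functions: Tonelli, Hölder, Minkowski -/

section Lp

variable {α β : Type*} [MeasurableSpace α] [MeasurableSpace β] {μ : Measure α} {ν : Measure β}

theorem eLpNorm_eq {p : ℝ≥0∞} (h0 : p ≠ 0) (ht : p ≠ ∞) (f : α → ℝ≥0∞) :
    eLpNorm f p μ = (∫⁻ x, f x ^ p.toReal ∂μ) ^ (1 / p.toReal) := by
  simp [eLpNorm_eq_lintegral_rpow_enorm_toReal h0 ht]

theorem eLpNorm_rpow_toReal {p : ℝ≥0∞} (h0 : p ≠ 0) (ht : p ≠ ∞) (f : α → ℝ≥0∞) :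
    eLpNorm f p μ ^ p.toReal = ∫⁻ x, f x ^ p.toReal ∂μ := by
  rw [eLpNorm_eq h0 ht, ← ENNReal.rpow_mul, one_div_mul_cancel (ENNReal.toReal_pos h0 ht).ne',
    ENNReal.rpow_one]

theorem eLpNorm_top_eq (f : α → ℝ≥0∞) : eLpNorm f ∞ μ = essSup f μ := by
  simp [eLpNorm_exponent_top, eLpNormEssSup]

theorem eLpNorm_mono_ae' {p : ℝ≥0∞} {f g : α → ℝ≥0∞} (h : ∀ᵐ x ∂μ, f x ≤ g x) :
    eLpNorm f p μ ≤ eLpNorm g p μ :=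
  eLpNorm_mono_enorm_ae (by simpa using h)

/-- Finiteness of `c` replaces any measurability assumption on `f`. -/
theorem eLpNorm_const_mul' {p : ℝ≥0∞} {c : ℝ≥0∞} (hc : c ≠ ∞) (f : α → ℝ≥0∞) :
    eLpNorm (fun x => c * f x) p μ = c * eLpNorm f p μ := by
  rcases eq_or_ne p 0 with rfl | h0
  · simp
  rcases eq_or_ne p ∞ with rfl | ht
  · rw [eLpNorm_top_eq, eLpNorm_top_eq, ENNReal.essSup_const_mul]
  have hp := ENNReal.toReal_pos h0 ht
  rw [eLpNorm_eq h0 ht, eLpNorm_eq h0 ht]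
  simp_rw [ENNReal.mul_rpow_of_nonneg _ _ hp.le]
  rw [lintegral_const_mul' _ _ (ENNReal.rpow_ne_top_of_nonneg hp.le hc),
    ENNReal.mul_rpow_of_nonneg _ _ (by positivity), ← ENNReal.rpow_mul,
    mul_one_div_cancel hp.ne', ENNReal.rpow_one]

/-- The power rule for `L^p` norms. -/
theorem eLpNorm_rpow_ofReal {p : ℝ≥0∞} (h0 : p ≠ 0) {s : ℝ} (hs : 0 < s) (f : α → ℝ≥0∞) :
    eLpNorm (fun x => f x ^ s) (p / ENNReal.ofReal s) μ = eLpNorm f p μ ^ s := by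
  have hs' : ENNReal.ofReal s ≠ 0 := by simpa using hs
  rcases eq_or_ne p ∞ with rfl | ht
  · rw [ENNReal.top_div_of_ne_top ENNReal.ofReal_ne_top, eLpNorm_top_eq, eLpNorm_top_eq]
    exact ((ENNReal.orderIsoRpow s hs).essSup_apply f μ).symm
  have hq0 : p / ENNReal.ofReal s ≠ 0 := by
    simp [ENNReal.div_eq_zero_iff, h0]
  have hqt : p / ENNReal.ofReal s ≠ ∞ := ENNReal.div_ne_top ht hs'
  have hp := ENNReal.toReal_pos h0 ht
  rw [eLpNorm_eq hq0 hqt, eLpNorm_eq h0 ht]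
  simp_rw [← ENNReal.rpow_mul]
  rw [ENNReal.toReal_div, ENNReal.toReal_ofReal hs.le]
  congr 2
  · funext x
    congr 1
    field_simp
  · field_simp

/-- Monotone convergence for `L^p` norms with `0 < p < ∞`. -/
theorem eLpNorm_iSup {p : ℝ≥0∞} (h0 : p ≠ 0) (ht : p ≠ ∞) {f : ℕ → α → ℝ≥0∞}
    (hf : ∀ n, Measurable (f n)) (hm : Monotone f) :
    eLpNorm (fun x => ⨆ n, f n x) p μ = ⨆ n, eLpNorm (f n) p μ := by
  have hp := ENNReal.toReal_pos h0 ht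
  have key : ∀ {r : ℝ} (hr : 0 < r) (u : ℕ → ℝ≥0∞), (⨆ n, u n) ^ r = ⨆ n, u n ^ r :=
    fun hr u => (ENNReal.orderIsoRpow _ hr).map_iSup u
  simp_rw [eLpNorm_eq h0 ht, key hp]
  rw [lintegral_iSup (fun n => (hf n).pow_const _), key (by positivity)]
  exact fun i j hij x => ENNReal.rpow_le_rpow (hm hij x) hp.le

/-- The `p`-th power of a maximum is at most the sum of the `p`-th powers. This needs no `1 ≤ p`, so
it serves as the quasi-triangle inequality for output exponents below `1`. -/
theorem eLpNorm_max_le {p : ℝ≥0∞} (h0 : p ≠ 0) (ht : p ≠ ∞) {f g : α → ℝ≥0∞}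
    (hf : Measurable f) :
    eLpNorm (fun x => max (f x) (g x)) p μ ≤
      2 ^ (1 / p.toReal) * max (eLpNorm f p μ) (eLpNorm g p μ) := by
  have hp := ENNReal.toReal_pos h0 ht
  have hp' : 0 ≤ 1 / p.toReal := by positivity
  rw [eLpNorm_eq h0 ht, eLpNorm_eq h0 ht, eLpNorm_eq h0 ht,
    ← (ENNReal.monotone_rpow_of_nonneg hp').map_max, ← ENNReal.mul_rpow_of_nonneg _ _ hp']
  refine ENNReal.rpow_le_rpow ?_ hp'
  calc ∫⁻ x, max (f x) (g x) ^ p.toReal ∂μ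
      ≤ ∫⁻ x, (f x ^ p.toReal + g x ^ p.toReal) ∂μ := by
        refine lintegral_mono fun x => ?_
        rw [(ENNReal.monotone_rpow_of_nonneg hp.le).map_max]
        exact max_le le_self_add le_add_self
    _ = ∫⁻ x, f x ^ p.toReal ∂μ + ∫⁻ x, g x ^ p.toReal ∂μ :=
        lintegral_add_left (hf.pow_const _) _
    _ ≤ _ := by
        rw [two_mul]
        exact add_le_add (le_max_left _ _) (le_max_right _ _)

theorem measurable_eLpNorm_right [SFinite ν] {f : α → β → ℝ≥0∞}
    (hf : Measurable (Function.uncurry f)) (p : ℝ≥0∞) : Measurable fun x => eLpNorm (f x) p ν := by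
  rcases eq_or_ne p 0 with rfl | h0
  · simp
  rcases eq_or_ne p ∞ with rfl | ht
  · simp_rw [eLpNorm_top_eq]
    refine measurable_of_Ioi fun a => ?_
    -- The essential supremum of a section exceeds `a` exactly when the section of the superlevel
    -- set has positive measure, and that measure depends measurably on `x`.
    have hset : (fun x => essSup (f x) ν) ⁻¹' Set.Ioi a
        = (fun x => ∫⁻ y, (Function.uncurry f ⁻¹' Set.Ioi a).indicator 1 (x, y) ∂ν) ⁻¹' {0}ᶜ := by
      ext x
      have hx : Measurable (f x) := hf.comp measurable_prodMk_left
      have h1 : ∫⁻ y, (Function.uncurry f ⁻¹' Set.Ioi a).indicator (1 : α × β → ℝ≥0∞) (x, y) ∂ν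
          = ν {y | a < f x y} := by
        rw [← lintegral_indicator_one (measurableSet_lt measurable_const hx)]
        rfl
      simp only [Set.mem_preimage, Set.mem_Ioi, Set.mem_compl_iff, Set.mem_singleton_iff, h1]
      rw [← not_le, not_iff_not]
      constructor
      · intro h
        have h2 : ∀ᵐ y ∂ν, f x y ≤ a := by
          filter_upwards [ENNReal.ae_le_essSup (f x)] with y hy using hy.trans h
        simpa [ae_iff] using h2
      · intro h
        refine essSup_le_of_ae_le _ ?_
        change ∀ᵐ y ∂ν, f x y ≤ a
        simpa [ae_iff] using h
    rw [hset]
    have hm : MeasurableSet (Function.uncurry f ⁻¹' Set.Ioi a) := hf measurableSet_Ioi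
    exact (Measurable.lintegral_prod_right' (measurable_one.indicator hm))
      (measurableSet_singleton 0).compl
  simp_rw [eLpNorm_eq h0 ht]
  exact (Measurable.lintegral_prod_right' (hf.pow_const _)).pow_const _

/-- Tonelli's theorem for `L^p` norms. -/
theorem eLpNorm_eLpNorm [SFinite μ] [SFinite ν] {f : α → β → ℝ≥0∞}
    (hf : Measurable (Function.uncurry f)) (p : ℝ≥0∞) :
    eLpNorm (fun x => eLpNorm (f x) p ν) p μ = eLpNorm (Function.uncurry f) p (μ.prod ν) := by
  rcases eq_or_ne p 0 with rfl | h0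
  · simp
  rcases eq_or_ne p ∞ with rfl | ht
  · simp_rw [eLpNorm_top_eq]
    refine le_antisymm (essSup_le_of_ae_le _ ?_) (essSup_le_of_ae_le _ ?_)
    · filter_upwards [Measure.ae_ae_of_ae_prod (ENNReal.ae_le_essSup (μ := μ.prod ν)
        (Function.uncurry f))] with x hx
      exact essSup_le_of_ae_le _ hx
    · have h1 : ∀ᵐ x ∂μ, ∀ᵐ y ∂ν, f x y ≤ essSup (fun x => essSup (f x) ν) μ := by
        filter_upwards [ENNReal.ae_le_essSup (fun x => essSup (f x) ν)] with x hx
        filter_upwards [ENNReal.ae_le_essSup (f x)] with y hy using hy.trans hx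
      exact (Measure.ae_prod_iff_ae_ae (measurableSet_le hf measurable_const)).2 h1
  rw [eLpNorm_eq h0 ht, eLpNorm_eq h0 ht]
  simp_rw [eLpNorm_rpow_toReal h0 ht]
  rw [lintegral_prod _ (hf.pow_const _).aemeasurable]
  rfl

/-- Both sides are the norm on the product space. Equality of the two exponents is essential;
extrapolation is what makes it available in the induction over the inner variables. -/
theorem eLpNorm_eLpNorm_swap [SFinite μ] [SFinite ν] {f : α → β → ℝ≥0∞}
    (hf : Measurable (Function.uncurry f)) (p : ℝ≥0∞) :
    eLpNorm (fun x => eLpNorm (f x) p ν) p μ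
      = eLpNorm (fun y => eLpNorm (fun x => f x y) p μ) p ν := by
  rw [eLpNorm_eLpNorm hf, eLpNorm_eLpNorm (f := fun y x => f x y) (hf.comp measurable_swap)]
  have := (Measure.measurePreserving_swap (μ := ν) (ν := μ))
  rw [← eLpNorm_comp_measurePreserving hf.aestronglyMeasurable this]
  rfl

/-- Hölder's inequality for finitely many functions and powers. -/
theorem eLpNorm_prod_rpow_le {ι : Type*} [Fintype ι] {θ : ι → ℝ} (hθ : ∀ j, 0 < θ j)
    {p : ι → ℝ≥0∞} {p' : ℝ≥0∞} (hp : ∀ j, p j ≠ 0) (h0 : p' ≠ 0) (ht : p' ≠ ∞)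
    (hsum : ∑ j, ENNReal.ofReal (θ j) * (p j)⁻¹ = p'⁻¹) {f : ι → α → ℝ≥0∞}
    (hf : ∀ j, Measurable (f j)) :
    eLpNorm (fun x => ∏ j, f j x ^ θ j) p' μ ≤ ∏ j, eLpNorm (f j) (p j) μ ^ θ j := by
  have hp' := ENNReal.toReal_pos h0 ht
  set r := p'.toReal with hr
  -- These are the Hölder weights, with sum `1` by `hsum`. An index with `p j = ∞` gets weight `0`
  -- because `toReal ∞ = 0`; its factor leaves the integral as the constant `c j`.
  set w : ι → ℝ := fun j => θ j * (p j).toReal⁻¹ * r with hw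
  set v : ι → α → ℝ≥0∞ := fun j x => if p j = ∞ then 1 else f j x ^ (p j).toReal with hv
  set c : ι → ℝ≥0∞ := fun j => if p j = ∞ then essSup (f j) μ else 1 with hc
  have hw1 : ∑ j, w j = 1 := by
    have h1 : (∑ j, ENNReal.ofReal (θ j) * (p j)⁻¹).toReal = r⁻¹ := by
      rw [hsum, ENNReal.toReal_inv]
    rw [ENNReal.toReal_sum (fun j _ => ENNReal.mul_ne_top ENNReal.ofReal_ne_top
      (ENNReal.inv_ne_top.2 (hp j)))] at h1
    simp only [ENNReal.toReal_mul, ENNReal.toReal_inv, ENNReal.toReal_ofReal (hθ _).le] at h1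
    rw [hw, ← Finset.sum_mul, h1, inv_mul_cancel₀ hp'.ne']
  have hw0 : ∀ j, 0 ≤ w j := fun j => by
    have := hθ j
    positivity
  have hvm : ∀ j, Measurable (v j) := fun j => by
    by_cases h : p j = ∞
    · simp [hv, h]
    · simpa [hv, h] using (hf j).pow_const _
  have hpt : ∀ᵐ x ∂μ, ∀ j, (f j x ^ θ j) ^ r ≤ (c j ^ θ j) ^ r * v j x ^ w j := by
    rw [ae_all_iff]
    intro j
    by_cases h : p j = ∞
    · filter_upwards [ENNReal.ae_le_essSup (f j)] with x hx
      simp only [hc, hv, h, if_true, ENNReal.one_rpow, mul_one]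
      exact ENNReal.rpow_le_rpow (ENNReal.rpow_le_rpow hx (hθ j).le) hp'.le
    · refine Filter.Eventually.of_forall fun x => ?_
      have hpj := ENNReal.toReal_pos (hp j) h
      simp only [hc, hv, h, if_false, ENNReal.one_rpow, one_mul, hw]
      rw [← ENNReal.rpow_mul, ← ENNReal.rpow_mul]
      refine le_of_eq ?_
      congr 1
      field_simp
  rw [eLpNorm_eq h0 ht]
  calc (∫⁻ x, (∏ j, f j x ^ θ j) ^ r ∂μ) ^ (1 / r)
      ≤ (∫⁻ x, (∏ j, (c j ^ θ j) ^ r) * ∏ j, v j x ^ w j ∂μ) ^ (1 / r) := by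
        refine ENNReal.rpow_le_rpow (lintegral_mono_ae ?_) (by positivity)
        filter_upwards [hpt] with x hx
        rw [← ENNReal.prod_rpow_of_nonneg hp'.le, ← Finset.prod_mul_distrib]
        exact Finset.prod_le_prod' fun j _ => hx j
    _ = ((∏ j, (c j ^ θ j) ^ r) * ∫⁻ x, ∏ j, v j x ^ w j ∂μ) ^ (1 / r) := by
        rw [lintegral_const_mul]
        exact Finset.measurable_prod _ fun j _ => (hvm j).pow_const _
    _ ≤ ((∏ j, (c j ^ θ j) ^ r) * ∏ j, (∫⁻ x, v j x ∂μ) ^ w j) ^ (1 / r) := by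
        refine ENNReal.rpow_le_rpow (mul_le_mul_right ?_ _) (by positivity)
        exact ENNReal.lintegral_prod_norm_pow_le _ (fun j _ => (hvm j).aemeasurable) hw1
          (fun j _ => hw0 j)
    _ = ∏ j, eLpNorm (f j) (p j) μ ^ θ j := by
        rw [← Finset.prod_mul_distrib, ← ENNReal.prod_rpow_of_nonneg (by positivity)]
        refine Finset.prod_congr rfl fun j _ => ?_
        rw [ENNReal.mul_rpow_of_nonneg _ _ (by positivity)]
        by_cases h : p j = ∞
        · have : w j = 0 := by simp [hw, h]
          simp only [hc, h, if_true, this, ENNReal.rpow_zero, ENNReal.one_rpow, mul_one,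
            eLpNorm_top_eq]
          rw [← ENNReal.rpow_mul, mul_one_div_cancel hp'.ne', ENNReal.rpow_one]
        · have hpj := ENNReal.toReal_pos (hp j) h
          simp only [hc, hv, h, if_false, ENNReal.one_rpow, one_mul]
          rw [eLpNorm_eq (hp j) h, ← ENNReal.rpow_mul, ← ENNReal.rpow_mul]
          congr 1
          simp only [hw]
          field_simp

/-- Absorption: a bound `∫ h ^ p ≤ (∫ h ^ p) ^ (1 - 1 / p) * X` for finite truncations `h` of `H`
gives `‖H‖_p ≤ X`. -/
theorem lintegral_rpow_le_of_absorb {p : ℝ} (hp : 0 < p) {h : ℕ → α → ℝ≥0∞} {H : α → ℝ≥0∞}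
    (hm : ∀ n, Measurable (h n)) (hmono : Monotone h) (hH : ∀ x, H x = ⨆ n, h n x) {X : ℝ≥0∞}
    (hfin : ∀ n, ∫⁻ x, h n x ^ p ∂μ ≠ ∞)
    (hle : ∀ n, ∫⁻ x, h n x ^ p ∂μ ≤ (∫⁻ x, h n x ^ p ∂μ) ^ (1 - 1 / p) * X) :
    (∫⁻ x, H x ^ p ∂μ) ^ (1 / p) ≤ X := by
  have key : ∀ {r : ℝ} (hr : 0 < r) (u : ℕ → ℝ≥0∞), (⨆ n, u n) ^ r = ⨆ n, u n ^ r :=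
    fun hr u => (ENNReal.orderIsoRpow _ hr).map_iSup u
  simp_rw [hH, key hp]
  rw [lintegral_iSup (fun n => (hm n).pow_const _)
    (fun i j hij x => ENNReal.rpow_le_rpow (hmono hij x) hp.le), key (by positivity)]
  refine iSup_le fun n => ?_
  set A := ∫⁻ x, h n x ^ p ∂μ with hA
  rcases eq_or_ne A 0 with h0 | h0
  · rw [h0, ENNReal.zero_rpow_of_pos (by positivity)]
    exact zero_le
  have hAt : A ≠ ∞ := hfin n
  have h1 : A ^ (1 - 1 / p) ≠ 0 := by simp [h0, hAt]
  have h2 : A ^ (1 - 1 / p) ≠ ∞ := by simp [h0, hAt]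
  have h3 : A = A ^ (1 - 1 / p) * A ^ (1 / p) := by
    rw [← ENNReal.rpow_add _ _ h0 (hfin n)]
    simp
  have h4 := hle n
  rw [← hA] at h4
  nth_rw 1 [h3] at h4
  exact (ENNReal.mul_le_mul_iff_right h1 h2).1 h4

/-- Minkowski's integral inequality. -/
theorem eLpNorm_lintegral_le [SigmaFinite μ] [SFinite ν] {p : ℝ≥0∞} (hp : 1 ≤ p) {f : α → β → ℝ≥0∞}
    (hf : Measurable (Function.uncurry f)) :
    eLpNorm (fun x => ∫⁻ y, f x y ∂ν) p μ ≤ ∫⁻ y, eLpNorm (fun x => f x y) p μ ∂ν := by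
  have h0 : p ≠ 0 := (zero_lt_one.trans_le hp).ne'
  rcases eq_or_ne p ∞ with rfl | ht
  · simp_rw [eLpNorm_top_eq]
    have h1 : ∀ᵐ y ∂ν, ∀ᵐ x ∂μ, f x y ≤ essSup (fun x => f x y) μ :=
      Filter.Eventually.of_forall fun y => ENNReal.ae_le_essSup _
    have hm : Measurable fun y => essSup (fun x => f x y) μ := by
      have := measurable_eLpNorm_right (ν := μ) (f := fun y x => f x y)
        (hf.comp measurable_swap) ∞
      simpa only [eLpNorm_top_eq] using this
    have h2 : MeasurableSet {z : β × α | f z.2 z.1 ≤ essSup (fun x => f x z.1) μ} :=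
      measurableSet_le (hf.comp measurable_swap) (hm.comp measurable_fst)
    have h3 := (Measure.ae_prod_iff_ae_ae (μ := ν) (ν := μ) h2).2 h1
    have h4 : ∀ᵐ x ∂μ, ∀ᵐ y ∂ν, f x y ≤ essSup (fun x => f x y) μ := by
      have := (Measure.measurePreserving_swap (μ := μ) (ν := ν)).quasiMeasurePreserving.ae h3
      exact Measure.ae_ae_of_ae_prod this
    refine essSup_le_of_ae_le _ ?_
    filter_upwards [h4] with x hx
    exact lintegral_mono_ae hx
  set r := p.toReal with hr
  have hr1 : 1 ≤ r := by
    rw [hr, ← ENNReal.toReal_one]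
    exact ENNReal.toReal_mono ht hp
  rcases hr1.eq_or_lt with h1 | h1
  · simp_rw [eLpNorm_eq h0 ht, ← hr, ← h1]
    simp only [ENNReal.rpow_one, div_one]
    rw [lintegral_lintegral_swap hf.aemeasurable]
  have hr0 : 0 < r := by linarith
  set H : α → ℝ≥0∞ := fun x => ∫⁻ y, f x y ∂ν with hHdef
  have hHm : Measurable H := hf.lintegral_prod_right'
  rw [eLpNorm_eq h0 ht]
  set S := spanningSets μ with hS
  -- The truncations cut the height at `n` and the domain at a set of finite measure, so their
  -- `r`-th powers have finite integral and can be absorbed.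
  refine lintegral_rpow_le_of_absorb hr0
    (h := fun n x => (S n).indicator (fun x => min (H x) n) x) (fun n => ?_) ?_ ?_ ?_ ?_
  · exact (hHm.min measurable_const).indicator (measurableSet_spanningSets μ n)
  · intro i j hij x
    by_cases hx : x ∈ S i
    · have hx' : x ∈ S j := monotone_spanningSets μ hij hx
      simp only [Set.indicator_of_mem hx, Set.indicator_of_mem hx']
      exact min_le_min le_rfl (by exact_mod_cast hij)
    · simp only [Set.indicator_of_notMem hx]
      exact zero_le
  · intro x
    refine le_antisymm ?_ (iSup_le fun n => ?_)
    · refine le_of_forall_lt fun c hc => ?_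
      obtain ⟨n₁, hn₁⟩ := ENNReal.exists_nat_gt (ne_top_of_lt hc)
      have hx : x ∈ ⋃ n, S n := by simp [hS, iUnion_spanningSets]
      obtain ⟨n₂, hn₂⟩ := Set.mem_iUnion.1 hx
      refine lt_iSup_iff.2 ⟨max n₁ n₂, ?_⟩
      rw [Set.indicator_of_mem (monotone_spanningSets μ (le_max_right n₁ n₂) hn₂)]
      refine lt_min hc (hn₁.trans_le ?_)
      exact_mod_cast le_max_left n₁ n₂
    · refine (Set.indicator_le_self' (fun _ _ => zero_le) x).trans (min_le_left _ _)
  · intro n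
    have : ∫⁻ x, (S n).indicator (fun x => min (H x) n) x ^ r ∂μ
        ≤ ∫⁻ x, (S n).indicator (fun _ => (n : ℝ≥0∞) ^ r) x ∂μ := by
      refine lintegral_mono fun x => ?_
      by_cases hx : x ∈ S n
      · simp only [Set.indicator_of_mem hx]
        exact ENNReal.rpow_le_rpow (min_le_right _ _) hr0.le
      · simp [Set.indicator_of_notMem hx, hr0]
    refine (this.trans_lt ?_).ne
    rw [lintegral_indicator_const (measurableSet_spanningSets μ n)]
    exact ENNReal.mul_lt_top (ENNReal.rpow_lt_top_of_nonneg hr0.le (ENNReal.natCast_ne_top n))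
      (measure_spanningSets_lt_top μ n)
  · intro n
    set h : α → ℝ≥0∞ := fun x => (S n).indicator (fun x => min (H x) n) x with hh
    have hhm : Measurable h :=
      (hHm.min measurable_const).indicator (measurableSet_spanningSets μ n)
    have hhH : ∀ x, h x ≤ H x := fun x =>
      (Set.indicator_le_self' (fun _ _ => zero_le) x).trans (min_le_left _ _)
    have hconj : r.HolderConjugate (r / (r - 1)) := Real.HolderConjugate.conjExponent h1
    -- Duality by hand: `h ^ r ≤ H * h ^ (r - 1)`, then Tonelli, then Hölder in `x` with exponents
    -- `r` and `r / (r - 1)`.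
    calc ∫⁻ x, h x ^ r ∂μ ≤ ∫⁻ x, ∫⁻ y, f x y * h x ^ (r - 1) ∂ν ∂μ := by
          refine lintegral_mono fun x => ?_
          rw [lintegral_mul_const _ (f := fun y => f x y) (hf.comp measurable_prodMk_left)]
          calc h x ^ r = h x ^ ((1 : ℝ) + (r - 1)) := by ring_nf
            _ = h x ^ (1 : ℝ) * h x ^ (r - 1) :=
                ENNReal.rpow_add_of_nonneg _ _ zero_le_one (by linarith)
            _ ≤ H x * h x ^ (r - 1) := by
                rw [ENNReal.rpow_one]
                exact mul_le_mul_left (hhH x) _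
      _ = ∫⁻ y, ∫⁻ x, f x y * h x ^ (r - 1) ∂μ ∂ν := by
          refine lintegral_lintegral_swap (Measurable.aemeasurable ?_)
          exact hf.mul ((hhm.comp measurable_fst).pow_const _)
      _ ≤ ∫⁻ y, (∫⁻ x, h x ^ r ∂μ) ^ (1 - 1 / r) * eLpNorm (fun x => f x y) p μ ∂ν := by
          refine lintegral_mono fun y => ?_
          have := ENNReal.lintegral_mul_le_Lp_mul_Lq μ hconj (f := fun x => f x y)
            (g := fun x => h x ^ (r - 1)) (hf.comp measurable_prodMk_right).aemeasurable
            (hhm.pow_const _).aemeasurable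
          refine this.trans (le_of_eq ?_)
          rw [eLpNorm_eq h0 ht, mul_comm]
          simp_rw [← ENNReal.rpow_mul]
          have e1 : (r - 1) * (r / (r - 1)) = r := by
            have : r - 1 ≠ 0 := by linarith
            field_simp
          have e2 : 1 / (r / (r - 1)) = 1 - 1 / r := by
            field_simp
          rw [e1, e2]
      _ = _ := by
          rw [lintegral_const_mul]
          have := measurable_eLpNorm_right (ν := μ) (f := fun y x => f x y)
            (hf.comp measurable_swap) p
          exact this

end Lp

/-! ### Distribution functions and the good-`λ` method -/

section LayerCake

variable {α : Type*} [MeasurableSpace α] {μ : Measure α}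

/-- The layer cake formula for `ℝ≥0∞`-valued functions. -/
theorem lintegral_rpow_eq_layercake {f : α → ℝ≥0∞} (hf : Measurable f) {p : ℝ} (hp : 0 < p) :
    ∫⁻ x, f x ^ p ∂μ = ENNReal.ofReal p *
      ∫⁻ t in Set.Ioi (0 : ℝ), μ {x | ENNReal.ofReal t < f x} * ENNReal.ofReal (t ^ (p - 1)) := by
  have key : ∀ (u : ℕ → ℝ≥0∞), (⨆ n, u n) ^ p = ⨆ n, u n ^ p :=
    fun u => (ENNReal.orderIsoRpow _ hp).map_iSup u
  -- Truncations are finite-valued, so the real layer cake formula applies to them; monotone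
  -- convergence on both sides removes the truncation.
  set g : ℕ → α → ℝ≥0∞ := fun n x => min (f x) n with hg
  have hgm : ∀ n, Measurable (g n) := fun n => hf.min measurable_const
  have hmono : Monotone g := fun i j hij x => min_le_min le_rfl (by exact_mod_cast hij)
  have hsup : ∀ x, f x = ⨆ n, g n x := fun x => by
    refine le_antisymm (le_of_forall_lt fun c hc => ?_) (iSup_le fun n => min_le_left _ _)
    obtain ⟨n, hn⟩ := ENNReal.exists_nat_gt (ne_top_of_lt hc)
    exact lt_iSup_iff.2 ⟨n, lt_min hc hn⟩
  have htop : ∀ n x, g n x ≠ ∞ := fun n x =>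
    ne_top_of_le_ne_top (ENNReal.natCast_ne_top n) (min_le_right _ _)
  have hn : ∀ n, ∫⁻ x, g n x ^ p ∂μ = ENNReal.ofReal p * ∫⁻ t in Set.Ioi (0 : ℝ),
      μ {x | ENNReal.ofReal t < g n x} * ENNReal.ofReal (t ^ (p - 1)) := by
    intro n
    have := lintegral_rpow_eq_lintegral_meas_lt_mul μ (f := fun x => (g n x).toReal)
      (Filter.Eventually.of_forall fun x => ENNReal.toReal_nonneg)
      (hgm n).ennreal_toReal.aemeasurable hp
    rw [show ∫⁻ x, g n x ^ p ∂μ = ∫⁻ x, ENNReal.ofReal ((g n x).toReal ^ p) ∂μ from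
      lintegral_congr fun x => by
        rw [← ENNReal.ofReal_rpow_of_nonneg ENNReal.toReal_nonneg hp.le,
          ENNReal.ofReal_toReal (htop n x)], this]
    congr 1
    refine setLIntegral_congr_fun measurableSet_Ioi fun t ht => ?_
    congr 2
    ext x
    simp only [Set.mem_ofPred_eq]
    rw [ENNReal.ofReal_lt_iff_lt_toReal (le_of_lt ht) (htop n x)]
  have hanti : ∀ n, Antitone fun t : ℝ => μ {x | ENNReal.ofReal t < g n x} := fun n s t hst =>
    measure_mono fun x hx => lt_of_le_of_lt (ENNReal.ofReal_le_ofReal hst) hx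
  simp_rw [hsup, key]
  rw [lintegral_iSup (fun n => (hgm n).pow_const _)
    (fun i j hij x => ENNReal.rpow_le_rpow (hmono hij x) hp.le)]
  simp_rw [hn]
  rw [← ENNReal.mul_iSup, ← lintegral_iSup]
  · congr 1
    refine setLIntegral_congr_fun measurableSet_Ioi fun t ht => ?_
    rw [← ENNReal.iSup_mul]
    congr 1
    have hU : {x | ENNReal.ofReal t < ⨆ n, g n x} = ⋃ n, {x | ENNReal.ofReal t < g n x} := by
      ext x
      simp [lt_iSup_iff]
    rw [hU, Monotone.measure_iUnion]
    exact fun i j hij x hx => lt_of_lt_of_le hx (hmono hij x)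
  · intro n
    exact (hanti n).measurable.mul (by fun_prop)
  · intro i j hij t
    exact mul_le_mul_left (measure_mono fun x hx => lt_of_lt_of_le hx (hmono hij x)) _

/-- The good-`λ` method. -/
theorem lintegral_rpow_le_of_good_lambda [IsFiniteMeasure μ] {q : ℝ} (hq : 0 < q) {K : ℝ}
    (hK : 1 ≤ K) {ε : ℝ≥0∞} (hε : ENNReal.ofReal (K ^ q) * ε ≤ 2⁻¹) {u v : α → ℝ≥0∞}
    (hu : Measurable u) (hv : Measurable v)
    (h : ∀ t : ℝ, 0 < t → μ {x | ENNReal.ofReal (K * t) < u x} ≤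
      μ {x | ENNReal.ofReal t < v x} + ε * μ {x | ENNReal.ofReal t < u x}) :
    ∫⁻ x, u x ^ q ∂μ ≤ 2 * ENNReal.ofReal (K ^ q) * ∫⁻ x, v x ^ q ∂μ := by
  have hK0 : 0 < K := by linarith
  have hKq : ENNReal.ofReal (K ^ q) ≠ 0 := by
    simp only [ne_eq, ENNReal.ofReal_eq_zero, not_le]
    positivity
  have key : ∀ (u : ℕ → ℝ≥0∞), (⨆ n, u n) ^ q = ⨆ n, u n ^ q :=
    fun u => (ENNReal.orderIsoRpow _ hq).map_iSup u
  -- On a finite measure space the bounded truncation has finite `q`-th moment, so half of that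
  -- moment can be subtracted at the end.
  set g : ℕ → α → ℝ≥0∞ := fun n x => min (u x) n with hg
  have hgm : ∀ n, Measurable (g n) := fun n => hu.min measurable_const
  have hmono : Monotone g := fun i j hij x => min_le_min le_rfl (by exact_mod_cast hij)
  have hsup : ∀ x, u x = ⨆ n, g n x := fun x => by
    refine le_antisymm (le_of_forall_lt fun c hc => ?_) (iSup_le fun n => min_le_left _ _)
    obtain ⟨n, hn⟩ := ENNReal.exists_nat_gt (ne_top_of_lt hc)
    exact lt_iSup_iff.2 ⟨n, lt_min hc hn⟩
  simp_rw [hsup, key]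
  rw [lintegral_iSup (fun n => (hgm n).pow_const _)
    (fun i j hij x => ENNReal.rpow_le_rpow (hmono hij x) hq.le)]
  refine iSup_le fun n => ?_
  set c : ℝ≥0∞ := ENNReal.ofReal K with hc
  have hc0 : c ≠ 0 := by simpa [hc] using hK0
  have hct : c ≠ ∞ := ENNReal.ofReal_ne_top
  have hlevel : ∀ t : ℝ, 0 < t → μ {x | ENNReal.ofReal t < c⁻¹ * g n x} ≤
      μ {x | ENNReal.ofReal t < v x} + ε * μ {x | ENNReal.ofReal t < g n x} := by
    intro t ht
    have h1 : ∀ x, ENNReal.ofReal t < c⁻¹ * g n x ↔ ENNReal.ofReal (K * t) < g n x := by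
      intro x
      rw [mul_comm, ← div_eq_mul_inv, ENNReal.lt_div_iff_mul_lt (Or.inl hc0) (Or.inl hct),
        ENNReal.ofReal_mul hK0.le, mul_comm]
    simp_rw [h1]
    -- Truncation keeps the hypothesis: below height `n` the level sets are unchanged, and above it
    -- the left-hand set is empty.
    by_cases hn : ENNReal.ofReal (K * t) < n
    · have h2 : ENNReal.ofReal t < n := lt_of_le_of_lt
        (ENNReal.ofReal_le_ofReal (by nlinarith)) hn
      have e1 : {x | ENNReal.ofReal (K * t) < g n x} = {x | ENNReal.ofReal (K * t) < u x} := by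
        ext x
        simp [hg, hn]
      have e2 : {x | ENNReal.ofReal t < g n x} = {x | ENNReal.ofReal t < u x} := by
        ext x
        simp [hg, h2]
      rw [e1, e2]
      exact h t ht
    · have e1 : {x | ENNReal.ofReal (K * t) < g n x} = ∅ := by
        ext x
        simp [hg, hn]
      rw [e1, measure_empty]
      exact zero_le
  have hA : ∫⁻ x, g n x ^ q ∂μ ≠ ∞ := by
    have : ∫⁻ x, g n x ^ q ∂μ ≤ ∫⁻ _, (n : ℝ≥0∞) ^ q ∂μ :=
      lintegral_mono fun x => ENNReal.rpow_le_rpow (min_le_right _ _) hq.le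
    refine (this.trans_lt ?_).ne
    rw [lintegral_const]
    exact ENNReal.mul_lt_top (ENNReal.rpow_lt_top_of_nonneg hq.le (ENNReal.natCast_ne_top n))
      (measure_lt_top μ _)
  have hanti : ∀ w : α → ℝ≥0∞, Antitone fun t : ℝ => μ {x | ENNReal.ofReal t < w x} :=
    fun w s t hst => measure_mono fun x hx => lt_of_le_of_lt (ENNReal.ofReal_le_ofReal hst) hx
  have hmain : ∫⁻ x, (c⁻¹ * g n x) ^ q ∂μ ≤ ∫⁻ x, v x ^ q ∂μ + ε * ∫⁻ x, g n x ^ q ∂μ := by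
    rw [lintegral_rpow_eq_layercake ((hgm n).const_mul _) hq, lintegral_rpow_eq_layercake hv hq,
      lintegral_rpow_eq_layercake (hgm n) hq, mul_left_comm, ← mul_add]
    refine mul_le_mul_right ?_ _
    have hmeas : ∀ w : α → ℝ≥0∞, Measurable fun t : ℝ =>
        μ {x | ENNReal.ofReal t < w x} * ENNReal.ofReal (t ^ (q - 1)) :=
      fun w => (hanti w).measurable.mul (by fun_prop)
    rw [← lintegral_const_mul _ (hmeas _), ← lintegral_add_left (hmeas _)]
    refine setLIntegral_mono' measurableSet_Ioi fun t ht => ?_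
    rw [← mul_assoc, ← add_mul]
    exact mul_le_mul_left (hlevel t ht) _
  set A := ∫⁻ x, g n x ^ q ∂μ with hAdef
  set V := ∫⁻ x, v x ^ q ∂μ with hVdef
  have h5 : ∫⁻ x, (c⁻¹ * g n x) ^ q ∂μ = (ENNReal.ofReal (K ^ q))⁻¹ * A := by
    simp_rw [ENNReal.mul_rpow_of_nonneg _ _ hq.le]
    rw [lintegral_const_mul _ ((hgm n).pow_const _), ENNReal.inv_rpow, hc,
      ENNReal.ofReal_rpow_of_pos hK0]
  rw [h5] at hmain
  have h6 : A ≤ ENNReal.ofReal (K ^ q) * V + 2⁻¹ * A := by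
    calc A = ENNReal.ofReal (K ^ q) * ((ENNReal.ofReal (K ^ q))⁻¹ * A) := by
          rw [← mul_assoc, ENNReal.mul_inv_cancel hKq ENNReal.ofReal_ne_top, one_mul]
      _ ≤ ENNReal.ofReal (K ^ q) * (V + ε * A) := mul_le_mul_right hmain _
      _ = ENNReal.ofReal (K ^ q) * V + (ENNReal.ofReal (K ^ q) * ε) * A := by ring
      _ ≤ _ := add_le_add le_rfl (mul_le_mul_left hε _)
  have h7 : 2⁻¹ * A + 2⁻¹ * A = A := by
    rw [← add_mul, ENNReal.inv_two_add_inv_two, one_mul]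
  have h8 : 2⁻¹ * A ≤ ENNReal.ofReal (K ^ q) * V := by
    have : 2⁻¹ * A + 2⁻¹ * A ≤ ENNReal.ofReal (K ^ q) * V + 2⁻¹ * A := by rw [h7]; exact h6
    exact (ENNReal.add_le_add_iff_right (ENNReal.mul_ne_top (by simp) hA)).1 this
  calc A = 2 * (2⁻¹ * A) := by
        rw [← mul_assoc, ENNReal.mul_inv_cancel (by simp) (by simp), one_mul]
    _ ≤ 2 * (ENNReal.ofReal (K ^ q) * V) := mul_le_mul_right h8 _
    _ = _ := by ring

end LayerCake

end VVMaximal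


/-! ### Iterated mixed norms -/

namespace VVMaximal

section MixedNorm

theorem measurable_finCons {k : ℕ} {α : Fin (k + 1) → Type*} [∀ i, MeasurableSpace (α i)] :
    Measurable fun z : α 0 × (∀ i : Fin k, α i.succ) => (Fin.cons z.1 z.2 : ∀ i, α i) := by
  refine measurable_pi_iff.2 fun i => ?_
  refine Fin.cases ?_ (fun j => ?_) i
  · simpa using measurable_fst
  · simpa [Function.comp_def] using (measurable_pi_apply j).comp measurable_snd

theorem measurePreserving_finCons {k : ℕ} {α : Fin (k + 1) → Type*} [∀ i, MeasurableSpace (α i)]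
    (μ : ∀ i, Measure (α i)) [∀ i, SigmaFinite (μ i)] :
    MeasurePreserving (fun z : α 0 × (∀ i : Fin k, α i.succ) => (Fin.cons z.1 z.2 : ∀ i, α i))
      ((μ 0).prod (Measure.pi fun i : Fin k => μ i.succ)) (Measure.pi μ) := by
  have h := (measurePreserving_piFinSuccAbove μ 0).symm
  have e : ⇑(MeasurableEquiv.piFinSuccAbove α 0).symm =
      fun z : α 0 × (∀ i : Fin k, α i.succ) => (Fin.cons z.1 z.2 : ∀ i, α i) := by
    funext z
    exact (MeasurableEquiv.piFinSuccAbove α 0).toEquiv.symm_apply_eq.2 rfl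
  rw [e] at h
  exact h

theorem mixedNorm_succ {k : ℕ} {α : Fin (k + 1) → Type u} [∀ i, MeasurableSpace (α i)]
    (p : Fin (k + 1) → ℝ≥0∞) (μ : ∀ i, Measure (α i)) (F : (∀ i, α i) → ℝ≥0∞) :
    mixedNorm p μ F = eLpNorm (fun a => mixedNorm (fun i => p i.succ) (fun i => μ i.succ)
        (fun b => F (Fin.cons a b))) (p 0) (μ 0) := rfl

theorem mixedNorm_mono {k : ℕ} {α : Fin k → Type u} [∀ i, MeasurableSpace (α i)]
    (p : Fin k → ℝ≥0∞) (μ : ∀ i, Measure (α i)) {F G : (∀ i, α i) → ℝ≥0∞}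
    (h : ∀ w, F w ≤ G w) : mixedNorm p μ F ≤ mixedNorm p μ G := by
  induction k with
  | zero => exact h _
  | succ k ih => exact eLpNorm_mono_ae' (.of_forall fun a => ih _ _ fun b => h _)

/-- The induction replaces the parameter space `X` by `X × α 0`, so the universe of `X` has to
absorb that of `α`. The version for an arbitrary universe follows by lifting `X`. -/
theorem measurable_mixedNorm_max {k : ℕ} {α : Fin k → Type u} [∀ i, MeasurableSpace (α i)]
    (p : Fin k → ℝ≥0∞) (μ : ∀ i, Measure (α i)) [∀ i, SFinite (μ i)]
    {X : Type max u v} [MeasurableSpace X] {F : X → (∀ i, α i) → ℝ≥0∞}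
    (hF : Measurable (Function.uncurry F)) : Measurable fun x => mixedNorm p μ (F x) := by
  induction k generalizing X with
  | zero => exact hF.comp (measurable_id.prodMk measurable_const)
  | succ k ih =>
    refine measurable_eLpNorm_right (f := fun x a => mixedNorm (fun i => p i.succ)
      (fun i => μ i.succ) (fun b => F x (Fin.cons a b))) ?_ _
    refine ih (X := X × α 0) (F := fun z b => F z.1 (Fin.cons z.2 b)) _ _ ?_
    exact hF.comp ((measurable_fst.comp measurable_fst).prodMk
      (measurable_finCons.comp ((measurable_snd.comp measurable_fst).prodMk measurable_snd)))

theorem measurable_mixedNorm {k : ℕ} {α : Fin k → Type u} [∀ i, MeasurableSpace (α i)]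
    (p : Fin k → ℝ≥0∞) (μ : ∀ i, Measure (α i)) [∀ i, SFinite (μ i)]
    {X : Type v} [MeasurableSpace X] {F : X → (∀ i, α i) → ℝ≥0∞}
    (hF : Measurable (Function.uncurry F)) : Measurable fun x => mixedNorm p μ (F x) := by
  have := measurable_mixedNorm_max.{u, v} p μ (X := ULift.{u} X) (F := fun x => F x.down)
    (hF.comp ((measurable_down.comp measurable_fst).prodMk measurable_snd))
  exact this.comp measurable_up

theorem measurable_cons_left {k : ℕ} {α : Fin (k + 1) → Type*} [∀ i, MeasurableSpace (α i)]
    {F : (∀ i, α i) → ℝ≥0∞} (hF : Measurable F) :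
    Measurable (Function.uncurry fun (a : α 0) (b : ∀ i : Fin k, α i.succ) =>
      F (Fin.cons a b)) :=
  hF.comp measurable_finCons

theorem measurable_mixedNorm_tail {k : ℕ} {α : Fin (k + 1) → Type u} [∀ i, MeasurableSpace (α i)]
    (p : Fin (k + 1) → ℝ≥0∞) (μ : ∀ i, Measure (α i)) [∀ i, SFinite (μ i)]
    {F : (∀ i, α i) → ℝ≥0∞} (hF : Measurable F) :
    Measurable fun a => mixedNorm (fun i => p i.succ) (fun i => μ i.succ)
      (fun b => F (Fin.cons a b)) :=
  measurable_mixedNorm _ _ (measurable_cons_left hF)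

theorem mixedNorm_const_mul {k : ℕ} {α : Fin k → Type u} [∀ i, MeasurableSpace (α i)]
    (p : Fin k → ℝ≥0∞) (μ : ∀ i, Measure (α i)) {c : ℝ≥0∞} (hc : c ≠ ∞)
    (F : (∀ i, α i) → ℝ≥0∞) : mixedNorm p μ (fun w => c * F w) = c * mixedNorm p μ F := by
  induction k with
  | zero => rfl
  | succ k ih =>
    simp_rw [mixedNorm_succ, ih]
    exact eLpNorm_const_mul' hc _

theorem mixedNorm_zero {k : ℕ} {α : Fin k → Type u} [∀ i, MeasurableSpace (α i)]
    (p : Fin k → ℝ≥0∞) (μ : ∀ i, Measure (α i)) :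
    mixedNorm p μ (fun _ => 0) = 0 := by
  simpa using mixedNorm_const_mul p μ (c := 0) (by simp) (fun _ => 0)

/-- This removes the powers `s_j`: a norm of `F` with exponents `p` becomes a norm of `F ^ s` with
exponents `p / s`. -/
theorem mixedNorm_rpow {k : ℕ} {α : Fin k → Type u} [∀ i, MeasurableSpace (α i)]
    {p : Fin k → ℝ≥0∞} (hp : ∀ i, p i ≠ 0) (μ : ∀ i, Measure (α i)) {s : ℝ} (hs : 0 < s)
    (F : (∀ i, α i) → ℝ≥0∞) :
    mixedNorm (fun i => p i / ENNReal.ofReal s) μ (fun w => F w ^ s) = mixedNorm p μ F ^ s := by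
  induction k with
  | zero => rfl
  | succ k ih =>
    simp_rw [mixedNorm_succ, ih (p := fun i => p i.succ) (fun i => hp _)]
    exact eLpNorm_rpow_ofReal (hp 0) hs _

/-- Monotone convergence in each variable in turn. It reduces the supremum over all cubes to suprema
over finitely many. -/
theorem mixedNorm_iSup {k : ℕ} {α : Fin k → Type u} [∀ i, MeasurableSpace (α i)]
    {p : Fin k → ℝ≥0∞} (h0 : ∀ i, p i ≠ 0) (ht : ∀ i, p i ≠ ∞) (μ : ∀ i, Measure (α i))
    [∀ i, SFinite (μ i)] {F : ℕ → (∀ i, α i) → ℝ≥0∞} (hF : ∀ n, Measurable (F n))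
    (hm : Monotone F) :
    mixedNorm p μ (fun w => ⨆ n, F n w) = ⨆ n, mixedNorm p μ (F n) := by
  induction k with
  | zero => rfl
  | succ k ih =>
    simp_rw [mixedNorm_succ]
    have h1 : ∀ a, mixedNorm (fun i => p i.succ) (fun i => μ i.succ)
        (fun b => ⨆ n, F n (Fin.cons a b)) = ⨆ n, mixedNorm (fun i => p i.succ)
          (fun i => μ i.succ) (fun b => F n (Fin.cons a b)) := fun a =>
      ih (p := fun i => p i.succ) (fun i => h0 _) (fun i => ht _) (fun i => μ i.succ)
        (F := fun n b => F n (Fin.cons a b))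
        (fun n => (measurable_cons_left (hF n)).comp measurable_prodMk_left)
        (fun i j hij b => hm hij _)
    simp_rw [h1]
    exact eLpNorm_iSup (h0 0) (ht 0) (fun n => measurable_mixedNorm_tail p μ (hF n))
      (fun i j hij a => mixedNorm_mono _ _ fun b => hm hij _)

/-- The constant in the quasi-triangle inequality of a mixed norm. -/
noncomputable def quasiConst {k : ℕ} (p : Fin k → ℝ≥0∞) : ℝ≥0 := ∏ i, 2 ^ (1 / (p i).toReal)

theorem one_le_quasiConst {k : ℕ} (p : Fin k → ℝ≥0∞) : 1 ≤ quasiConst p := by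
  refine Finset.one_le_prod' fun i _ => ?_
  exact NNReal.one_le_rpow one_le_two (by positivity)

theorem mixedNorm_max_le {k : ℕ} {α : Fin k → Type u} [∀ i, MeasurableSpace (α i)]
    {p : Fin k → ℝ≥0∞} (h0 : ∀ i, p i ≠ 0) (ht : ∀ i, p i ≠ ∞) (μ : ∀ i, Measure (α i))
    [∀ i, SFinite (μ i)] {F G : (∀ i, α i) → ℝ≥0∞} (hF : Measurable F) :
    mixedNorm p μ (fun w => max (F w) (G w)) ≤
      quasiConst p * max (mixedNorm p μ F) (mixedNorm p μ G) := by
  induction k with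
  | zero => simp [quasiConst, mixedNorm]
  | succ k ih =>
    simp_rw [mixedNorm_succ]
    set p' : Fin k → ℝ≥0∞ := fun i => p i.succ with hp'
    have h1 : ∀ a, mixedNorm p' (fun i => μ i.succ)
        (fun b => max (F (Fin.cons a b)) (G (Fin.cons a b))) ≤ quasiConst p' *
          max (mixedNorm p' (fun i => μ i.succ) (fun b => F (Fin.cons a b)))
            (mixedNorm p' (fun i => μ i.succ) (fun b => G (Fin.cons a b))) := fun a =>
      ih (p := p') (fun i => h0 _) (fun i => ht _) (fun i => μ i.succ)
        ((measurable_cons_left hF).comp measurable_prodMk_left)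
    refine (eLpNorm_mono_ae' (.of_forall h1)).trans ?_
    rw [eLpNorm_const_mul' ENNReal.coe_ne_top]
    refine (mul_le_mul_right (eLpNorm_max_le (h0 0) (ht 0)
      (measurable_mixedNorm_tail p μ hF)) _).trans (le_of_eq ?_)
    rw [← mul_assoc]
    congr 1
    rw [quasiConst, quasiConst, Fin.prod_univ_succ, ENNReal.coe_mul, mul_comm,
      ENNReal.coe_rpow_of_nonneg _ (by positivity)]
    simp [hp']

/-- Minkowski's integral inequality for mixed norms. -/
theorem mixedNorm_lintegral_le {k : ℕ} {α : Fin k → Type u} [∀ i, MeasurableSpace (α i)]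
    {p : Fin k → ℝ≥0∞} (hp : ∀ i, 1 ≤ p i) (μ : ∀ i, Measure (α i)) [∀ i, SigmaFinite (μ i)]
    {Y : Type*} [MeasurableSpace Y] {ν : Measure Y} [SFinite ν] {F : Y → (∀ i, α i) → ℝ≥0∞}
    (hF : Measurable (Function.uncurry F)) :
    mixedNorm p μ (fun w => ∫⁻ y, F y w ∂ν) ≤ ∫⁻ y, mixedNorm p μ (F y) ∂ν := by
  induction k with
  | zero => rfl
  | succ k ih =>
    simp_rw [mixedNorm_succ]
    have hm : Measurable fun z : (Y × α 0) × (∀ i : Fin k, α i.succ) =>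
        F z.1.1 (Fin.cons z.1.2 z.2) :=
      hF.comp ((measurable_fst.comp measurable_fst).prodMk
        (measurable_finCons.comp ((measurable_snd.comp measurable_fst).prodMk measurable_snd)))
    refine (eLpNorm_mono_ae' (.of_forall fun a => ih (fun i => hp i.succ) (fun i => μ i.succ)
      (F := fun y b => F y (Fin.cons a b)) ?_)).trans ?_
    · exact hm.comp ((measurable_fst.prodMk measurable_const).prodMk measurable_snd)
    · refine eLpNorm_lintegral_le (hp 0) (f := fun a y => mixedNorm (fun i => p i.succ)
        (fun i => μ i.succ) (fun b => F y (Fin.cons a b))) ?_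
      exact (measurable_mixedNorm _ _ (X := Y × α 0)
        (F := fun z b => F z.1 (Fin.cons z.2 b)) hm).comp measurable_swap

/-- Almost every section of a null set is null, variable by variable. This is what permits inputs
that are only a.e. measurable. -/
theorem mixedNorm_congr_ae {k : ℕ} {α : Fin k → Type u} [∀ i, MeasurableSpace (α i)]
    (p : Fin k → ℝ≥0∞) (μ : ∀ i, Measure (α i)) [∀ i, SigmaFinite (μ i)]
    {F G : (∀ i, α i) → ℝ≥0∞} (h : ∀ᵐ w ∂Measure.pi μ, F w = G w) :
    mixedNorm p μ F = mixedNorm p μ G := by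
  induction k with
  | zero =>
    rw [Measure.pi_of_empty μ (fun i => i.elim0), ae_dirac_eq] at h
    exact h
  | succ k ih =>
    rw [mixedNorm_succ, mixedNorm_succ]
    have h2 := Measure.ae_ae_of_ae_prod ((measurePreserving_finCons μ).quasiMeasurePreserving.ae h)
    refine eLpNorm_congr_ae ?_
    filter_upwards [h2] with a ha
    exact ih _ (fun i => μ i.succ) ha

end MixedNorm

end VVMaximal


/-! ### Nested partitions, averages over cells, Doob's inequality -/

namespace VVMaximal

/-- A decreasing sequence of countable measurable partitions of `E` (into the level sets of the maps
`idx i`) by sets of positive finite measure, with doubling constant `D`. -/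
structure Grid (E : Type) [MeasurableSpace E] (μ : Measure E) (ι : Type) (D : ℝ≥0) where
  idx : ℕ → E → ι
  measurableSet_idx : ∀ i c, MeasurableSet {x | idx i x = c}
  nested : ∀ i x y, idx (i + 1) x = idx (i + 1) y → idx i x = idx i y
  ne_zero : ∀ i x, μ {y | idx i y = idx i x} ≠ 0
  ne_top : ∀ i x, μ {y | idx i y = idx i x} ≠ ∞
  doubling : ∀ i x, μ {y | idx i y = idx i x} ≤ D * μ {y | idx (i + 1) y = idx (i + 1) x}

namespace Grid

variable {E : Type} [MeasurableSpace E] {μ : Measure E} {ι : Type} {D : ℝ≥0} (𝒟 : Grid E μ ι D)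

/-- The cell of generation `i` containing `x`. -/
def cell (i : ℕ) (x : E) : Set E := {y | 𝒟.idx i y = 𝒟.idx i x}

/-- Unions of cells of generation `i`. -/
def Saturated (i : ℕ) (V : Set E) : Prop := ∀ ⦃x y⦄, 𝒟.idx i x = 𝒟.idx i y → x ∈ V → y ∈ V

/-- The average of `f` over the cell of generation `i` containing `x`. -/
noncomputable def avg (i : ℕ) (f : E → ℝ≥0∞) (x : E) : ℝ≥0∞ :=
  (μ (𝒟.cell i x))⁻¹ * ∫⁻ y in 𝒟.cell i x, f y ∂μ

theorem idx_eq_of_le {i j : ℕ} (hij : i ≤ j) {x y : E} (h : 𝒟.idx j x = 𝒟.idx j y) :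
    𝒟.idx i x = 𝒟.idx i y := by
  induction hij with
  | refl => exact h
  | step _ ih => exact ih (𝒟.nested _ _ _ h)

theorem cell_congr {i : ℕ} {x y : E} (h : 𝒟.idx i x = 𝒟.idx i y) : 𝒟.cell i x = 𝒟.cell i y := by
  simp [cell, h]

theorem cell_subset {i j : ℕ} (hij : i ≤ j) (x : E) : 𝒟.cell j x ⊆ 𝒟.cell i x :=
  fun _ hy => 𝒟.idx_eq_of_le hij hy

theorem measure_cell_ne_zero (i : ℕ) (x : E) : μ (𝒟.cell i x) ≠ 0 := 𝒟.ne_zero i x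

theorem measure_cell_ne_top (i : ℕ) (x : E) : μ (𝒟.cell i x) ≠ ∞ := 𝒟.ne_top i x

theorem measurableSet_cell (i : ℕ) (x : E) : MeasurableSet (𝒟.cell i x) :=
  𝒟.measurableSet_idx i _

theorem saturated_cell {i j : ℕ} (hij : i ≤ j) (x : E) : 𝒟.Saturated j (𝒟.cell i x) :=
  fun _ _ h hy => (𝒟.idx_eq_of_le hij h).symm.trans hy

theorem Saturated.mono {i j : ℕ} (hij : i ≤ j) {V : Set E} (hV : 𝒟.Saturated i V) :
    𝒟.Saturated j V := fun _ _ h => hV (𝒟.idx_eq_of_le hij h)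

theorem Saturated.compl {i : ℕ} {V : Set E} (hV : 𝒟.Saturated i V) : 𝒟.Saturated i Vᶜ :=
  fun _ _ h hx hy => hx (hV h.symm hy)

theorem Saturated.inter {i : ℕ} {V W : Set E} (hV : 𝒟.Saturated i V) (hW : 𝒟.Saturated i W) :
    𝒟.Saturated i (V ∩ W) := fun _ _ h hx => ⟨hV h hx.1, hW h hx.2⟩

theorem Saturated.cell_subset {i : ℕ} {V : Set E} (hV : 𝒟.Saturated i V) {x : E} (hx : x ∈ V) :
    𝒟.cell i x ⊆ V := fun y (hy : 𝒟.idx i y = 𝒟.idx i x) => hV hy.symm hx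

theorem avg_congr {i : ℕ} {x y : E} (h : 𝒟.idx i x = 𝒟.idx i y) (f : E → ℝ≥0∞) :
    𝒟.avg i f x = 𝒟.avg i f y := by
  rw [avg, avg, 𝒟.cell_congr h]

theorem avg_eq_of_const_on {i : ℕ} {x : E} {f : E → ℝ≥0∞} {c : ℝ≥0∞}
    (h : ∀ y ∈ 𝒟.cell i x, f y = c) : 𝒟.avg i f x = c := by
  rw [avg, setLIntegral_congr_fun (𝒟.measurableSet_cell i x) h, setLIntegral_const, mul_comm c,
    ← mul_assoc, ENNReal.inv_mul_cancel (𝒟.measure_cell_ne_zero i x) (𝒟.measure_cell_ne_top i x),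
    one_mul]

theorem setLIntegral_cell (i : ℕ) (f : E → ℝ≥0∞) (x : E) :
    ∫⁻ y in 𝒟.cell i x, f y ∂μ = 𝒟.avg i f x * μ (𝒟.cell i x) := by
  rw [avg, mul_comm, ← mul_assoc, ENNReal.mul_inv_cancel (𝒟.measure_cell_ne_zero i x)
    (𝒟.measure_cell_ne_top i x), one_mul]

/-- A cell lies in its parent, whose measure is at most `D` times larger. Hence averages grow by at
most the factor `D` per generation, which controls the overshoot at a stopping time. -/
theorem avg_le_doubling {i : ℕ} (f : E → ℝ≥0∞) (x : E) :
    𝒟.avg (i + 1) f x ≤ D * 𝒟.avg i f x := by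
  rw [avg, avg, ← mul_assoc]
  refine mul_le_mul' ?_ (lintegral_mono_set (𝒟.cell_subset (Nat.le_succ i) x))
  have h : μ (𝒟.cell i x) ≤ D * μ (𝒟.cell (i + 1) x) := 𝒟.doubling i x
  rw [← div_eq_mul_inv, ENNReal.le_div_iff_mul_le (Or.inl (𝒟.measure_cell_ne_zero i x))
    (Or.inl (𝒟.measure_cell_ne_top i x)), mul_comm,
    ← div_eq_mul_inv]
  exact ENNReal.div_le_of_le_mul h

theorem Saturated.inter_idx_eq {i : ℕ} {V : Set E} (hV : 𝒟.Saturated i V) (c : ι) :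
    V ∩ {x | 𝒟.idx i x = c} = ∅ ∨ ∃ x ∈ V, V ∩ {x | 𝒟.idx i x = c} = 𝒟.cell i x := by
  rcases Set.eq_empty_or_nonempty (V ∩ {x | 𝒟.idx i x = c}) with h | ⟨x, hx, rfl⟩
  · exact Or.inl h
  · refine Or.inr ⟨x, hx, Set.inter_eq_right.2 (hV.cell_subset 𝒟 hx)⟩

theorem Saturated.inter_level {l : ℕ} {C : Set E} (hC : 𝒟.Saturated l C) (F : E → ℝ≥0∞)
    (t : ℝ≥0∞) {I : ℕ} (hI : l ≤ I) :
    𝒟.Saturated I (C ∩ {x | ∃ i, l ≤ i ∧ i < I ∧ t < 𝒟.avg i F x}) := by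
  refine (hC.mono 𝒟 hI).inter 𝒟 ?_
  rintro x y hxy ⟨i, h1, h2, h3⟩
  refine ⟨i, h1, h2, ?_⟩
  rwa [𝒟.avg_congr (𝒟.idx_eq_of_le h2.le hxy.symm)]

section Countable

variable [Countable ι]

/-- With countably many cells, every preimage is a countable union of cells, whatever the function.
-/
theorem measurable_of_factor {β : Type*} [MeasurableSpace β] (i : ℕ) {h : E → β}
    (hh : ∀ x y, 𝒟.idx i x = 𝒟.idx i y → h x = h y) : Measurable h := by
  intro s _
  have : h ⁻¹' s = ⋃ c ∈ (𝒟.idx i '' (h ⁻¹' s)), {x | 𝒟.idx i x = c} := by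
    ext x
    simp only [Set.mem_iUnion, exists_prop]
    constructor
    · intro hx
      exact ⟨_, ⟨x, hx, rfl⟩, rfl⟩
    · rintro ⟨_, ⟨y, hy, rfl⟩, hxy⟩
      have : h x = h y := hh _ _ hxy
      simpa [this] using hy
  rw [this]
  exact MeasurableSet.biUnion (Set.to_countable _) fun c _ => 𝒟.measurableSet_idx i c

theorem Saturated.measurableSet {i : ℕ} {V : Set E} (hV : 𝒟.Saturated i V) : MeasurableSet V := by
  have : Measurable fun x => x ∈ V :=
    𝒟.measurable_of_factor i fun x y h => propext ⟨fun hx => hV h hx, fun hy => hV h.symm hy⟩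
  exact measurableSet_setOfPred.2 this

theorem measurable_avg (i : ℕ) (f : E → ℝ≥0∞) : Measurable (𝒟.avg i f) :=
  𝒟.measurable_of_factor i fun _ _ h => 𝒟.avg_congr h f

theorem measurable_avg_prod [SFinite μ] {Ω : Type*} [MeasurableSpace Ω] (i : ℕ) {f : E → Ω → ℝ≥0∞}
    (hf : Measurable (Function.uncurry f)) :
    Measurable (Function.uncurry fun x ω => 𝒟.avg i (fun y => f y ω) x) := by
  have h1 : Measurable fun x => (μ (𝒟.cell i x))⁻¹ :=
    𝒟.measurable_of_factor i fun x y h => by rw [𝒟.cell_congr h]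
  refine (h1.comp measurable_fst).mul ?_
  have hS : MeasurableSet {z : (E × Ω) × E | 𝒟.idx i z.2 = 𝒟.idx i z.1.1} := by
    have : {z : (E × Ω) × E | 𝒟.idx i z.2 = 𝒟.idx i z.1.1} =
        ⋃ c, {z | 𝒟.idx i z.2 = c} ∩ {z | 𝒟.idx i z.1.1 = c} := by
      ext z
      simp [eq_comm]
    rw [this]
    exact MeasurableSet.iUnion fun c => (measurable_snd (𝒟.measurableSet_idx i c)).inter
      ((measurable_fst.comp measurable_fst) (𝒟.measurableSet_idx i c))
  have h2 : (fun z : E × Ω => ∫⁻ y in 𝒟.cell i z.1, f y z.2 ∂μ) = fun z =>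
      ∫⁻ y, {z : (E × Ω) × E | 𝒟.idx i z.2 = 𝒟.idx i z.1.1}.indicator
        (fun z => f z.2 z.1.2) (z, y) ∂μ := by
    funext z
    rw [← lintegral_indicator (𝒟.measurableSet_cell i z.1)]
    rfl
  rw [h2]
  refine Measurable.lintegral_prod_right' (Measurable.indicator ?_ hS)
  exact hf.comp (measurable_snd.prodMk (measurable_snd.comp measurable_fst))

theorem setLIntegral_eq_tsum (i : ℕ) {V : Set E} (hV : MeasurableSet V) (f : E → ℝ≥0∞) :
    ∫⁻ x in V, f x ∂μ = ∑' c, ∫⁻ x in V ∩ {x | 𝒟.idx i x = c}, f x ∂μ := by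
  rw [← lintegral_iUnion (fun c => hV.inter (𝒟.measurableSet_idx i c))]
  · congr 2
    ext x
    simp
  · intro c d hcd
    refine Set.disjoint_left.2 fun x hx hx' => hcd ?_
    exact hx.2.symm.trans hx'.2

/-- `avg i f` is the conditional expectation of `f` given generation `i`. Here this is checked cell
by cell, without any integrability. -/
theorem setLIntegral_avg {i : ℕ} {V : Set E} (hV : 𝒟.Saturated i V) (f : E → ℝ≥0∞) :
    ∫⁻ x in V, 𝒟.avg i f x ∂μ = ∫⁻ x in V, f x ∂μ := by
  rw [𝒟.setLIntegral_eq_tsum i (hV.measurableSet 𝒟), 𝒟.setLIntegral_eq_tsum i (hV.measurableSet 𝒟)]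
  refine tsum_congr fun c => ?_
  rcases hV.inter_idx_eq 𝒟 c with h | ⟨x, _, h⟩
  · simp [h]
  · rw [h, setLIntegral_congr_fun (𝒟.measurableSet_cell i x)
      (fun y (hy : 𝒟.idx i y = 𝒟.idx i x) => 𝒟.avg_congr hy f), setLIntegral_const,
      𝒟.setLIntegral_cell]

/-- Summation over the disjoint cells that make up `V`: a relative bound on each cell gives the same
relative bound on `V`. -/
theorem measure_inter_le_of_cells {i : ℕ} {V : Set E} (hV : 𝒟.Saturated i V) {S : Set E}
    (hS : MeasurableSet S) {ε : ℝ≥0∞}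
    (h : ∀ x ∈ V, μ (𝒟.cell i x ∩ S) ≤ ε * μ (𝒟.cell i x)) : μ (V ∩ S) ≤ ε * μ V := by
  have hVm := hV.measurableSet 𝒟
  have h1 := 𝒟.setLIntegral_eq_tsum i hVm (S.indicator 1)
  have h2 := 𝒟.setLIntegral_eq_tsum i hVm 1
  simp only [Pi.one_apply, lintegral_one, Measure.restrict_apply_univ] at h2
  simp only [lintegral_indicator_one hS, Measure.restrict_apply hS] at h1
  rw [Set.inter_comm, h1, h2, ← ENNReal.tsum_mul_left]
  refine ENNReal.tsum_le_tsum fun c => ?_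
  rcases hV.inter_idx_eq 𝒟 c with h' | ⟨x, hx, h'⟩
  · simp [h']
  · rw [h', Set.inter_comm]
    exact h x hx

/-- The weak type bound for the maximal function of a grid. -/
theorem mul_measure_le_setLIntegral {l : ℕ} {C : Set E} (hC : 𝒟.Saturated l C) (F : E → ℝ≥0∞)
    (t : ℝ≥0∞) (I : ℕ) :
    t * μ (C ∩ {x | ∃ i, l ≤ i ∧ i < I ∧ t < 𝒟.avg i F x}) ≤
      ∫⁻ x in C ∩ {x | ∃ i, l ≤ i ∧ i < I ∧ t < 𝒟.avg i F x}, F x ∂μ := by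
  induction I with
  | zero => simp
  | succ I ih =>
    by_cases hI : l ≤ I
    · set U := C ∩ {x | ∃ i, l ≤ i ∧ i < I ∧ t < 𝒟.avg i F x} with hU
      -- `V` collects the points where generation `I` is the first one to exceed `t`. It is a union
      -- of cells of generation `I`, so on it `F` and its average over that generation have the same
      -- integral.
      set V := (C ∩ {x | t < 𝒟.avg I F x}) ∩ Uᶜ with hVdef
      have hUs : 𝒟.Saturated I U := hC.inter_level 𝒟 F t hI
      have hVs : 𝒟.Saturated I V := by
        refine ((hC.mono 𝒟 hI).inter 𝒟 ?_).inter 𝒟 (hUs.compl 𝒟)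
        intro x y hxy hx
        change t < 𝒟.avg I F y
        rwa [𝒟.avg_congr hxy.symm]
      have hUV : C ∩ {x | ∃ i, l ≤ i ∧ i < I + 1 ∧ t < 𝒟.avg i F x} = U ∪ V := by
        ext x
        constructor
        · rintro ⟨hx, i, h1, h2, h3⟩
          by_cases hxU : x ∈ U
          · exact Or.inl hxU
          · rcases (Nat.lt_succ_iff.1 h2).eq_or_lt with rfl | h4
            · exact Or.inr ⟨⟨hx, h3⟩, hxU⟩
            · exact absurd ⟨hx, i, h1, h4, h3⟩ hxU
        · rintro (⟨hx, i, h1, h2, h3⟩ | ⟨⟨hx, h3⟩, _⟩)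
          · exact ⟨hx, i, h1, h2.trans (Nat.lt_succ_self I), h3⟩
          · exact ⟨hx, I, hI, Nat.lt_succ_self I, h3⟩
      have hdisj : Disjoint U V := Set.disjoint_left.2 fun x hx hx' => hx'.2 hx
      have hVm := hVs.measurableSet 𝒟
      rw [hUV, measure_union hdisj hVm, lintegral_union hVm hdisj, mul_add]
      refine add_le_add ih ?_
      rw [← 𝒟.setLIntegral_avg hVs, ← setLIntegral_const]
      exact setLIntegral_mono' hVm fun x hx => hx.1.2.le
    · have : {x | ∃ i, l ≤ i ∧ i < I + 1 ∧ t < 𝒟.avg i F x} = ∅ := by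
        ext x
        simp only [Set.mem_ofPred_eq, Set.mem_empty_iff_false, iff_false, not_exists]
        rintro i ⟨h1, h2, _⟩
        omega
      rw [this]
      simp

/-- An exhaustion by unions of cells of the initial generation. -/
theorem exists_exhaustion : ∃ B : ℕ → Set E, Monotone B ∧ (∀ n, 𝒟.Saturated 0 (B n)) ∧
    (∀ n, μ (B n) < ∞) ∧ ⋃ n, B n = Set.univ := by
  obtain ⟨e, he⟩ := exists_injective_nat ι
  refine ⟨fun n => {x | e (𝒟.idx 0 x) < n}, ?_, ?_, ?_, ?_⟩
  · intro n m hnm x hx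
    exact lt_of_lt_of_le hx hnm
  · intro n x y hxy hx
    change e (𝒟.idx 0 y) < n
    rwa [← hxy]
  · intro n
    have hfin : (e ⁻¹' Set.Iio n).Finite := (Set.finite_Iio n).preimage he.injOn
    have : {x | e (𝒟.idx 0 x) < n} ⊆ ⋃ c ∈ e ⁻¹' Set.Iio n, {x | 𝒟.idx 0 x = c} := by
      intro x hx
      simp only [Set.mem_iUnion]
      exact ⟨_, hx, rfl⟩
    refine (measure_mono this).trans_lt (measure_biUnion_lt_top hfin fun c _ => ?_)
    rcases Set.eq_empty_or_nonempty {x | 𝒟.idx 0 x = c} with h | ⟨x, rfl⟩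
    · simp [h]
    · exact (𝒟.ne_top 0 x).lt_top
  · ext x
    simp only [Set.mem_iUnion, Set.mem_univ, iff_true]
    exact ⟨e (𝒟.idx 0 x) + 1, Nat.lt_succ_self _⟩

end Countable

end Grid

/-- The constant in Doob's maximal inequality. -/
noncomputable def doobConst (p : ℝ≥0∞) : ℝ≥0 := (p.toReal / (p.toReal - 1)).toNNReal + 1

namespace Grid

variable {E : Type} [MeasurableSpace E] {μ : Measure E} {ι : Type} {D : ℝ≥0} (𝒟 : Grid E μ ι D)
variable [Countable ι]

/-- Doob's maximal inequality. -/
theorem eLpNorm_iSup_avg_le {p : ℝ≥0∞} (hp : 1 < p) {F : E → ℝ≥0∞} (hF : Measurable F) (I : ℕ) :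
    eLpNorm (fun x => ⨆ i ∈ Set.Ico 0 I, 𝒟.avg i F x) p μ ≤ doobConst p * eLpNorm F p μ := by
  have h0 : p ≠ 0 := (zero_lt_one.trans hp).ne'
  rcases eq_or_ne p ∞ with rfl | ht
  · have h1 : (doobConst ∞ : ℝ≥0∞) = 1 := by simp [doobConst]
    rw [h1, one_mul, eLpNorm_top_eq, eLpNorm_top_eq]
    refine essSup_le_of_ae_le _ (.of_forall fun x => iSup₂_le fun i _ => ?_)
    have : ∫⁻ y in 𝒟.cell i x, F y ∂μ ≤ ∫⁻ _ in 𝒟.cell i x, essSup F μ ∂μ :=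
      lintegral_mono_ae (ae_restrict_of_ae (ENNReal.ae_le_essSup F))
    refine (mul_le_mul_right this _).trans (le_of_eq ?_)
    exact 𝒟.avg_eq_of_const_on (f := fun _ => essSup F μ) fun y _ => rfl
  set r := p.toReal with hr
  have hr1 : 1 < r := by
    rw [hr, ← ENNReal.toReal_one]
    exact (ENNReal.toReal_lt_toReal ENNReal.one_ne_top ht).2 hp
  have hr0 : 0 < r := by linarith
  set H : E → ℝ≥0∞ := fun x => ⨆ i ∈ Set.Ico 0 I, 𝒟.avg i F x with hH
  have hHm : Measurable H :=
    Measurable.biSup _ (Set.to_countable _) fun i _ => 𝒟.measurable_avg i F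
  obtain ⟨B, hBmono, hBsat, hBfin, hBuniv⟩ := 𝒟.exists_exhaustion
  have hBm : ∀ n, MeasurableSet (B n) := fun n => (hBsat n).measurableSet 𝒟
  have hlev : ∀ t : ℝ≥0∞, {x | t < H x} = {x | ∃ i, 0 ≤ i ∧ i < I ∧ t < 𝒟.avg i F x} := by
    intro t
    ext x
    simp [hH, lt_iSup_iff]
  rw [eLpNorm_eq h0 ht, ← hr]
  -- The truncation in space uses unions of initial cells, so that the truncated level sets keep the
  -- form to which the weak type bound applies.
  refine (lintegral_rpow_le_of_absorb hr0
    (h := fun n x => (B n).indicator (fun x => min (H x) n) x) (fun n => ?_) ?_ ?_ ?_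
    (X := ENNReal.ofReal (r / (r - 1)) * eLpNorm F p μ) ?_).trans ?_
  · exact (hHm.min measurable_const).indicator (hBm n)
  · intro i j hij x
    by_cases hx : x ∈ B i
    · have hx' : x ∈ B j := hBmono hij hx
      simp only [Set.indicator_of_mem hx, Set.indicator_of_mem hx']
      exact min_le_min le_rfl (by exact_mod_cast hij)
    · simp only [Set.indicator_of_notMem hx]
      exact zero_le
  · intro x
    refine le_antisymm ?_ (iSup_le fun n => ?_)
    · refine le_of_forall_lt fun c hc => ?_
      obtain ⟨n₁, hn₁⟩ := ENNReal.exists_nat_gt (ne_top_of_lt hc)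
      have hx : x ∈ ⋃ n, B n := by simp [hBuniv]
      obtain ⟨n₂, hn₂⟩ := Set.mem_iUnion.1 hx
      refine lt_iSup_iff.2 ⟨max n₁ n₂, ?_⟩
      rw [Set.indicator_of_mem (hBmono (le_max_right n₁ n₂) hn₂)]
      refine lt_min hc (hn₁.trans_le ?_)
      exact_mod_cast le_max_left n₁ n₂
    · refine (Set.indicator_le_self' (fun _ _ => zero_le) x).trans (min_le_left _ _)
  · intro n
    have : ∫⁻ x, (B n).indicator (fun x => min (H x) n) x ^ r ∂μ
        ≤ ∫⁻ x, (B n).indicator (fun _ => (n : ℝ≥0∞) ^ r) x ∂μ := by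
      refine lintegral_mono fun x => ?_
      by_cases hx : x ∈ B n
      · simp only [Set.indicator_of_mem hx]
        exact ENNReal.rpow_le_rpow (min_le_right _ _) hr0.le
      · simp [Set.indicator_of_notMem hx, hr0]
    refine (this.trans_lt ?_).ne
    rw [lintegral_indicator_const (hBm n)]
    exact ENNReal.mul_lt_top (ENNReal.rpow_lt_top_of_nonneg hr0.le (ENNReal.natCast_ne_top n))
      (hBfin n)
  · intro n
    set h : E → ℝ≥0∞ := fun x => (B n).indicator (fun x => min (H x) n) x with hh
    have hhm : Measurable h := (hHm.min measurable_const).indicator (hBm n)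
    have hconj : r.HolderConjugate (r / (r - 1)) := Real.HolderConjugate.conjExponent hr1
    -- In terms of `ν` the weak type bound reads `t * μ {h > t} ≤ ν {h > t}`. The layer cake formula
    -- for `h ^ r` under `μ` and for `h ^ (r - 1)` under `ν` then produces the factor `r / (r - 1)`.
    set ν := μ.withDensity F with hν
    have hlevel : ∀ t : ℝ, 0 < t → ENNReal.ofReal t * μ {x | ENNReal.ofReal t < h x} ≤
        ν {x | ENNReal.ofReal t < h x} := by
      intro t ht
      rw [hν, withDensity_apply _ (measurableSet_lt measurable_const hhm)]
      by_cases hn : ENNReal.ofReal t < n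
      · have e : {x | ENNReal.ofReal t < h x} =
            B n ∩ {x | ∃ i, 0 ≤ i ∧ i < I ∧ ENNReal.ofReal t < 𝒟.avg i F x} := by
          rw [← hlev]
          ext x
          by_cases hx : x ∈ B n <;> simp [hh, hx, hn]
        rw [e]
        exact 𝒟.mul_measure_le_setLIntegral (hBsat n) F _ I
      · have e : {x | ENNReal.ofReal t < h x} = ∅ := by
          ext x
          by_cases hx : x ∈ B n <;> simp [hh, hx]
          intro _
          simpa using hn
        simp [e]
    have hanti : ∀ κ : Measure E, Antitone fun t : ℝ => κ {x | ENNReal.ofReal t < h x} :=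
      fun κ s t hst => measure_mono fun x hx => lt_of_le_of_lt (ENNReal.ofReal_le_ofReal hst) hx
    have hstep : ∫⁻ x, h x ^ r ∂μ ≤ ENNReal.ofReal (r / (r - 1)) * ∫⁻ x, h x ^ (r - 1) ∂ν := by
      have hr10 : 0 < r - 1 := by linarith
      rw [lintegral_rpow_eq_layercake hhm hr0, lintegral_rpow_eq_layercake hhm hr10, ← mul_assoc,
        ← ENNReal.ofReal_mul (by positivity), div_mul_cancel₀ _ hr10.ne']
      refine mul_le_mul_right (setLIntegral_mono' measurableSet_Ioi fun t ht => ?_) _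
      have ht' : (0 : ℝ) < t := ht
      have e : ENNReal.ofReal (t ^ (r - 1)) = ENNReal.ofReal t * ENNReal.ofReal (t ^ (r - 1 - 1)) := by
        rw [← ENNReal.ofReal_mul ht'.le, ← Real.rpow_one_add' ht'.le]
        · ring_nf
        · linarith
      rw [e, ← mul_assoc, mul_comm (μ _)]
      exact mul_le_mul_left (hlevel t ht') _
    refine hstep.trans ?_
    rw [mul_left_comm]
    refine mul_le_mul_right ?_ _
    rw [hν, lintegral_withDensity_eq_lintegral_mul _ hF (hhm.pow_const _)]
    refine (ENNReal.lintegral_mul_le_Lp_mul_Lq μ hconj hF.aemeasurable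
      (hhm.pow_const _).aemeasurable).trans (le_of_eq ?_)
    rw [eLpNorm_eq h0 ht, mul_comm]
    simp_rw [← ENNReal.rpow_mul]
    have e1 : (r - 1) * (r / (r - 1)) = r := by
      have : r - 1 ≠ 0 := by linarith
      field_simp
    have e2 : 1 / (r / (r - 1)) = 1 - 1 / r := by
      field_simp
    rw [e1, e2]
  · refine mul_le_mul_left ?_ _
    rw [doobConst, ENNReal.coe_add]
    exact le_self_add

end Grid

end VVMaximal


/-! ### Vector-valued averages and stopping times -/

namespace VVMaximal

/-- Exponents `p_j ∈ (1, ∞]`, `p' ∈ (0, ∞)` with `∑ θ_j / p_j = 1 / p'`. -/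
structure Admissible {n : ℕ} (θ : Fin n → ℝ) (p : Fin n → ℝ≥0∞) (p' : ℝ≥0∞) : Prop where
  one_lt : ∀ j, 1 < p j
  ne_zero : p' ≠ 0
  ne_top : p' ≠ ∞
  sum_eq : ∑ j, ENNReal.ofReal (θ j) * (p j)⁻¹ = p'⁻¹

/-- The properties of the norms on the source side used in extrapolation. -/
structure IsInputNorm {E : Type} [MeasurableSpace E] (μ : Measure E) {Ω : Type u}
    [MeasurableSpace Ω] (ρ : (Ω → ℝ≥0∞) → ℝ≥0∞) : Prop where
  measurable : ∀ f : E → Ω → ℝ≥0∞, Measurable (Function.uncurry f) → Measurable fun x => ρ (f x)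
  lintegral_le : ∀ f : E → Ω → ℝ≥0∞, Measurable (Function.uncurry f) → ∀ S : Set E,
    ρ (fun ω => ∫⁻ y in S, f y ω ∂μ) ≤ ∫⁻ y in S, ρ (f y) ∂μ
  const_mul : ∀ c : ℝ≥0∞, c ≠ ∞ → ∀ u : Ω → ℝ≥0∞, ρ (fun ω => c * u ω) = c * ρ u

/-- The properties of the quasi-norm on the target side used in extrapolation. -/
structure IsOutputNorm (E : Type) [MeasurableSpace E] {Ω : Type u}
    [MeasurableSpace Ω] (K : ℝ≥0) (ρ : (Ω → ℝ≥0∞) → ℝ≥0∞) : Prop where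
  measurable : ∀ f : E → Ω → ℝ≥0∞, Measurable (Function.uncurry f) → Measurable fun x => ρ (f x)
  mono : ∀ u v : Ω → ℝ≥0∞, (∀ ω, u ω ≤ v ω) → ρ u ≤ ρ v
  zero : ρ (fun _ => 0) = 0
  max_le : ∀ u v : Ω → ℝ≥0∞, Measurable u → Measurable v →
    ρ (fun ω => max (u ω) (v ω)) ≤ K * max (ρ u) (ρ v)

theorem measurable_select {E Ω : Type*} [MeasurableSpace E] [MeasurableSpace Ω]
    {V : ℕ → E → Ω → ℝ≥0∞} (hV : ∀ i, Measurable (Function.uncurry (V i))) {τ : E → ℕ}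
    (hτ : Measurable τ) {C : Set E} (hC : MeasurableSet C) :
    Measurable (Function.uncurry fun x ω => C.indicator (fun x => V (τ x) x ω) x) := by
  have h1 : Measurable fun z : ℕ × (E × Ω) => V z.1 z.2.1 z.2.2 :=
    measurable_from_prod_countable_right hV
  have h2 : Measurable fun z : E × Ω => V (τ z.1) z.1 z.2 :=
    h1.comp ((hτ.comp measurable_fst).prodMk measurable_id)
  have h3 : Function.uncurry (fun x ω => C.indicator (fun x => V (τ x) x ω) x) =
      (Prod.fst ⁻¹' C).indicator fun z : E × Ω => V (τ z.1) z.1 z.2 := by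
    funext z
    by_cases hz : z.1 ∈ C <;> simp [Function.uncurry, hz]
  rw [h3]
  exact h2.indicator (measurable_fst hC)

namespace Grid

variable {E : Type} [MeasurableSpace E] {μ : Measure E} {ι : Type} {D : ℝ≥0} (𝒟 : Grid E μ ι D)
variable {Ω : Type u} {n : ℕ}

/-- The averages in the first variable of a function of two variables. -/
noncomputable def vavg (i : ℕ) (f : E → Ω → ℝ≥0∞) (x : E) (ω : Ω) : ℝ≥0∞ :=
  𝒟.avg i (fun y => f y ω) x

theorem vavg_congr {i : ℕ} {x y : E} (h : 𝒟.idx i x = 𝒟.idx i y) (f : E → Ω → ℝ≥0∞) :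
    𝒟.vavg i f x = 𝒟.vavg i f y :=
  funext fun _ => 𝒟.avg_congr h _

/-- The maximal operator over the generations in `S` built from the averages and the operators
`A i` acting in the second variable. -/
noncomputable def maxOp (A : ℕ → (Fin n → Ω → ℝ≥0∞) → Ω → ℝ≥0∞) (S : Set ℕ)
    (f : Fin n → E → Ω → ℝ≥0∞) (x : E) (ω : Ω) : ℝ≥0∞ :=
  ⨆ i ∈ S, A i (fun j => 𝒟.vavg i (f j) x) ω

/-- Boundedness of the maximal operators from `∏ L^{p_j}(E; ρ_j)` to `L^{p'}(E; ρ')`. -/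
def MaxBound [MeasurableSpace Ω] (A : ℕ → (Fin n → Ω → ℝ≥0∞) → Ω → ℝ≥0∞)
    (ρ : Fin n → (Ω → ℝ≥0∞) → ℝ≥0∞) (ρ' : (Ω → ℝ≥0∞) → ℝ≥0∞) (θ : Fin n → ℝ)
    (p : Fin n → ℝ≥0∞) (p' : ℝ≥0∞) (C : ℝ≥0) : Prop :=
  ∀ (I : ℕ) (f : Fin n → E → Ω → ℝ≥0∞), (∀ j, Measurable (Function.uncurry (f j))) →
    eLpNorm (fun x => ρ' (𝒟.maxOp A (Set.Ico 0 I) f x)) p' μ ≤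
      C * ∏ j, eLpNorm (fun x => ρ j (f j x)) (p j) μ ^ θ j

variable {A : ℕ → (Fin n → Ω → ℝ≥0∞) → Ω → ℝ≥0∞}

theorem maxOp_mono_set {S T : Set ℕ} (h : S ⊆ T) (f : Fin n → E → Ω → ℝ≥0∞) (x : E) (ω : Ω) :
    𝒟.maxOp A S f x ω ≤ 𝒟.maxOp A T f x ω :=
  biSup_mono fun _ hi => h hi

theorem maxOp_Ico_split {l I : ℕ} (h : l ≤ I) (f : Fin n → E → Ω → ℝ≥0∞) (x : E) (ω : Ω) :
    𝒟.maxOp A (Set.Ico 0 I) f x ω =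
      max (𝒟.maxOp A (Set.Ico 0 l) f x ω) (𝒟.maxOp A (Set.Ico l I) f x ω) := by
  rw [← Set.Ico_union_Ico_eq_Ico (Nat.zero_le l) h]
  exact iSup_union

theorem maxOp_congr_of_factor {S : Set ℕ} {l : ℕ} (hS : ∀ i ∈ S, i ≤ l) {x y : E}
    (h : 𝒟.idx l x = 𝒟.idx l y) (f : Fin n → E → Ω → ℝ≥0∞) :
    𝒟.maxOp A S f x = 𝒟.maxOp A S f y := by
  funext ω
  refine iSup_congr fun i => iSup_congr fun hi => ?_
  congr 1
  funext j
  exact 𝒟.vavg_congr (𝒟.idx_eq_of_le (hS i hi) h) _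

section Measurable

variable [MeasurableSpace Ω]

theorem norm_vavg_le {ρ : (Ω → ℝ≥0∞) → ℝ≥0∞} (hρ : IsInputNorm μ ρ) (i : ℕ) {f : E → Ω → ℝ≥0∞}
    (hf : Measurable (Function.uncurry f)) (x : E) :
    ρ (𝒟.vavg i f x) ≤ 𝒟.avg i (fun y => ρ (f y)) x := by
  have h : ρ (𝒟.vavg i f x) = (μ (𝒟.cell i x))⁻¹ * ρ (fun ω => ∫⁻ y in 𝒟.cell i x, f y ω ∂μ) :=
    hρ.const_mul _ (ENNReal.inv_ne_top.2 (𝒟.measure_cell_ne_zero i x)) _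
  rw [h, avg]
  exact mul_le_mul_right (hρ.lintegral_le f hf _) _

variable [Countable ι]

theorem measurable_vavg [SFinite μ] (i : ℕ) {f : E → Ω → ℝ≥0∞}
    (hf : Measurable (Function.uncurry f)) : Measurable (Function.uncurry (𝒟.vavg i f)) :=
  𝒟.measurable_avg_prod i hf

theorem measurable_maxOp [SFinite μ]
    (hA : ∀ (i : ℕ) (f : Fin n → E → Ω → ℝ≥0∞), (∀ j, Measurable (Function.uncurry (f j))) →
      Measurable (Function.uncurry fun x => A i (fun j => f j x)))
    (S : Set ℕ) {f : Fin n → E → Ω → ℝ≥0∞} (hf : ∀ j, Measurable (Function.uncurry (f j))) :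
    Measurable (Function.uncurry (𝒟.maxOp A S f)) :=
  Measurable.biSup _ (Set.to_countable _) fun i _ =>
    hA i (fun j => 𝒟.vavg i (f j)) fun j => 𝒟.measurable_vavg i (hf j)

end Measurable

section Stopping

open Classical in
/-- The first generation `i ≥ l` at which the average of `F` exceeds `b`, or the last generation
before `I` if there is none. -/
noncomputable def stopLevel (F : E → ℝ≥0∞) (b : ℝ≥0∞) (l I : ℕ) (x : E) : ℕ :=
  Nat.find (p := fun i => l ≤ i ∧ (b < 𝒟.avg i F x ∨ I ≤ i + 1))
    ⟨max l I, le_max_left _ _, Or.inr ((le_max_right l I).trans (Nat.le_succ _))⟩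

variable {F : E → ℝ≥0∞} {b : ℝ≥0∞} {l I : ℕ}

open Classical in
theorem stop_spec (x : E) : l ≤ 𝒟.stopLevel F b l I x ∧
    (b < 𝒟.avg (𝒟.stopLevel F b l I x) F x ∨ I ≤ 𝒟.stopLevel F b l I x + 1) :=
  Nat.find_spec (p := fun i => l ≤ i ∧ (b < 𝒟.avg i F x ∨ I ≤ i + 1)) _

open Classical in
theorem stop_le {x : E} {i : ℕ} (hl : l ≤ i) (h : b < 𝒟.avg i F x ∨ I ≤ i + 1) :
    𝒟.stopLevel F b l I x ≤ i :=
  Nat.find_min' (p := fun i => l ≤ i ∧ (b < 𝒟.avg i F x ∨ I ≤ i + 1)) _ ⟨hl, h⟩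

theorem avg_le_of_lt_stopLevel {x : E} {i : ℕ} (hl : l ≤ i) (h : i < 𝒟.stopLevel F b l I x) :
    𝒟.avg i F x ≤ b := by
  by_contra hb
  exact absurd (𝒟.stop_le hl (Or.inl (not_le.1 hb))) (not_le.2 h)

theorem stop_lt (h : l < I) (x : E) : 𝒟.stopLevel F b l I x < I := by
  have := 𝒟.stop_le (F := F) (b := b) (x := x) (l := l) (I := I) (i := I - 1) (by omega)
    (Or.inr (by omega))
  omega

/-- The stopping time property: two points in the same cell of the stopping generation share all
averages up to that generation, so neither can stop before the other. -/
theorem stop_congr {x y : E} (h : 𝒟.idx (𝒟.stopLevel F b l I x) x = 𝒟.idx (𝒟.stopLevel F b l I x) y) :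
    𝒟.stopLevel F b l I y = 𝒟.stopLevel F b l I x := by
  obtain ⟨h1, h2⟩ := 𝒟.stop_spec (F := F) (b := b) (l := l) (I := I) x
  refine le_antisymm (𝒟.stop_le h1 (by rwa [𝒟.avg_congr h.symm])) ?_
  by_contra hlt
  rw [not_le] at hlt
  obtain ⟨h3, h4⟩ := 𝒟.stop_spec (F := F) (b := b) (l := l) (I := I) y
  refine absurd (𝒟.stop_le (x := x) h3 ?_) (not_le.2 hlt)
  rwa [𝒟.avg_congr (𝒟.idx_eq_of_le hlt.le h)]

theorem saturated_stop_eq (i : ℕ) : 𝒟.Saturated i {x | 𝒟.stopLevel F b l I x = i} := by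
  rintro x y hxy rfl
  exact 𝒟.stop_congr hxy

theorem stop_eq_of_forall_le (hlI : l < I) {x : E} (h : ∀ i, l ≤ i → i < I → 𝒟.avg i F x ≤ b) :
    𝒟.stopLevel F b l I x + 1 = I := by
  obtain ⟨h1, h2⟩ := 𝒟.stop_spec (F := F) (b := b) (l := l) (I := I) x
  have h3 := 𝒟.stop_lt (F := F) (b := b) hlI x
  rcases h2 with h2 | h2
  · exact absurd h2 (not_lt.2 (h _ h1 h3))
  · omega

/-- If the stop occurs at `l`, the average is still `a`. Otherwise the preceding generation had
average at most `Λ * a`, and one more generation costs the factor `D`. The constant `D + 1` covers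
both cases. -/
theorem avg_stop_le {Λ a : ℝ≥0∞} (hΛ : 1 ≤ Λ) {x : E} (ha : 𝒟.avg l F x = a) :
    𝒟.avg (𝒟.stopLevel F (Λ * a) l I x) F x ≤ (D + 1) * (Λ * a) := by
  obtain ⟨h1, -⟩ := 𝒟.stop_spec (F := F) (b := Λ * a) (l := l) (I := I) x
  rcases h1.eq_or_lt with h | h
  · rw [← h, ha]
    calc a = 1 * (1 * a) := by simp
      _ ≤ _ := mul_le_mul' le_add_self (mul_le_mul' hΛ le_rfl)
  · obtain ⟨i, hi⟩ : ∃ i, 𝒟.stopLevel F (Λ * a) l I x = i + 1 :=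
      ⟨𝒟.stopLevel F (Λ * a) l I x - 1, by omega⟩
    rw [hi]
    refine (𝒟.avg_le_doubling F x).trans ?_
    exact mul_le_mul' le_self_add
      (𝒟.avg_le_of_lt_stopLevel (b := Λ * a) (l := l) (I := I) (x := x) (by omega) (by omega))

/-- The function `f` stopped at `stopLevel F b l I` on the set `C`. -/
noncomputable def stopped (F : E → ℝ≥0∞) (b : ℝ≥0∞) (l I : ℕ) (C : Set E) (f : E → Ω → ℝ≥0∞)
    (x : E) (ω : Ω) : ℝ≥0∞ :=
  C.indicator (fun x => 𝒟.vavg (𝒟.stopLevel F b l I x) f x ω) x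

variable [Countable ι]

theorem measurable_stopped [SFinite μ] [MeasurableSpace Ω] (hlI : l < I) {C : Set E}
    (hC : MeasurableSet C) {f : E → Ω → ℝ≥0∞} (hf : Measurable (Function.uncurry f)) :
    Measurable (Function.uncurry (𝒟.stopped F b l I C f)) := by
  have hτ : Measurable (𝒟.stopLevel F b l I) := by
    refine 𝒟.measurable_of_factor I fun x y h => ?_
    exact (𝒟.stop_congr (𝒟.idx_eq_of_le (𝒟.stop_lt hlI x).le h)).symm
  exact measurable_select (V := fun i => 𝒟.vavg i f) (fun i => 𝒟.measurable_vavg i hf) hτ hC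

/-- Optional stopping. -/
theorem vavg_stopped (hlI : l < I) {x : E} {f : E → Ω → ℝ≥0∞}
    (hx : ∀ i, l ≤ i → i < I → 𝒟.avg i F x ≤ b) {i : ℕ} (hli : l ≤ i) (hiI : i < I) :
    𝒟.vavg i (𝒟.stopped F b l I (𝒟.cell l x) f) x = 𝒟.vavg i f x := by
  funext ω
  rw [vavg, vavg, avg, avg]
  congr 1
  have hpiece : ∀ k, 𝒟.Saturated k (𝒟.cell i x ∩ {y | 𝒟.stopLevel F b l I y = k}) := by
    intro k
    by_cases hk : i ≤ k
    · exact (𝒟.saturated_cell hk x).inter 𝒟 (𝒟.saturated_stop_eq k)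
    · rintro y z - ⟨hy, hyk⟩
      exfalso
      have hyk' : 𝒟.stopLevel F b l I y = k := hyk
      have h1 : 𝒟.stopLevel F b l I x = 𝒟.stopLevel F b l I y :=
        𝒟.stop_congr (𝒟.idx_eq_of_le (by omega) hy)
      have := 𝒟.stop_eq_of_forall_le hlI hx
      omega
  have hU : 𝒟.cell i x = ⋃ k, 𝒟.cell i x ∩ {y | 𝒟.stopLevel F b l I y = k} := by
    ext y
    simp
  have hm : ∀ k, MeasurableSet (𝒟.cell i x ∩ {y | 𝒟.stopLevel F b l I y = k}) :=
    fun k => (hpiece k).measurableSet 𝒟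
  have hd : Pairwise (Function.onFun Disjoint
      fun k => 𝒟.cell i x ∩ {y | 𝒟.stopLevel F b l I y = k}) := by
    intro k k' hkk
    exact Set.disjoint_left.2 fun y hy hy' => hkk (hy.2.symm.trans hy'.2)
  rw [hU, lintegral_iUnion hm hd, lintegral_iUnion hm hd]
  refine tsum_congr fun k => ?_
  -- On the piece with stopping level `k` the stopped function is the average of generation `k`,
  -- which has the same integral over this union of cells of generation `k`.
  rw [← 𝒟.setLIntegral_avg (hpiece k) (fun y => f y ω)]
  refine setLIntegral_congr_fun (hm k) fun y hy => ?_
  have hyk : 𝒟.stopLevel F b l I y = k := hy.2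
  have hyC : y ∈ 𝒟.cell l x := 𝒟.cell_subset hli x hy.1
  simp only [stopped, Set.indicator_of_mem hyC, hyk]
  rfl

/-- The weak type bound at height `Λ * a`, where `a` is the average over the cell: the integral over
the cell is `a` times its measure, and `a` cancels. The values `a = 0` and `a = ∞` leave an empty
set. -/
theorem measure_cell_inter_exceed_le {Λ : ℝ≥0∞} (hΛ0 : Λ ≠ 0) (hΛt : Λ ≠ ∞) (x : E) :
    μ (𝒟.cell l x ∩ {y | ∃ i, l ≤ i ∧ i < I ∧ Λ * 𝒟.avg l F x < 𝒟.avg i F y}) ≤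
      Λ⁻¹ * μ (𝒟.cell l x) := by
  set a := 𝒟.avg l F x with ha
  have hint := 𝒟.setLIntegral_cell l F x
  rw [← ha] at hint
  rcases eq_or_ne a ∞ with h | hat
  · simp [h, ENNReal.mul_top hΛ0]
  rcases eq_or_ne a 0 with h | ha0
  · have : 𝒟.cell l x ∩ {y | ∃ i, l ≤ i ∧ i < I ∧ Λ * a < 𝒟.avg i F y} = ∅ := by
      ext y
      simp only [Set.mem_inter_iff, Set.mem_ofPred_eq, Set.mem_empty_iff_false, iff_false, not_and,
        not_exists, not_lt]
      intro hy i hli _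
      have h1 : 𝒟.cell i y ⊆ 𝒟.cell l x := (𝒟.cell_subset hli y).trans
        (𝒟.cell_congr (show 𝒟.idx l y = 𝒟.idx l x from hy)).le
      have h2 : ∫⁻ z in 𝒟.cell i y, F z ∂μ = 0 := by
        refine le_antisymm ((lintegral_mono_set h1).trans ?_) zero_le
        rw [hint, h, zero_mul]
      rw [avg, h2, mul_zero]
      exact zero_le
    rw [this, measure_empty]
    exact zero_le
  · have h1 := 𝒟.mul_measure_le_setLIntegral (𝒟.saturated_cell (le_refl l) x) F (Λ * a) I
    have h2 := h1.trans (lintegral_mono_set Set.inter_subset_left)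
    generalize 𝒟.cell l x ∩ {y | ∃ i, l ≤ i ∧ i < I ∧ Λ * a < 𝒟.avg i F y} = S at h2 ⊢
    rw [hint, mul_comm Λ a, mul_assoc] at h2
    have h3 := (ENNReal.mul_le_mul_iff_right ha0 hat).1 h2
    rw [mul_comm Λ⁻¹, ← div_eq_mul_inv, ENNReal.le_div_iff_mul_le (Or.inl hΛ0) (Or.inl hΛt),
      mul_comm]
    exact h3

end Stopping

end Grid

/-- The exponent is written as `(p⁻¹).toReal` so that it becomes `0` for `p = ∞` and both cases
share one formula. -/
theorem eLpNorm_le_of_le_indicator {α : Type*} [MeasurableSpace α] {μ : Measure α} {p : ℝ≥0∞}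
    (h0 : p ≠ 0) {S : Set α} (hS : MeasurableSet S) {f : α → ℝ≥0∞} {b : ℝ≥0∞}
    (hf : ∀ x, f x ≤ S.indicator (fun _ => b) x) :
    eLpNorm f p μ ≤ b * μ S ^ (p⁻¹).toReal := by
  refine (eLpNorm_mono_ae' (.of_forall hf)).trans ?_
  rcases eq_or_ne p ∞ with rfl | ht
  · rw [eLpNorm_top_eq]
    simp only [ENNReal.inv_top, ENNReal.toReal_zero, ENNReal.rpow_zero, mul_one]
    exact essSup_le_of_ae_le _ (.of_forall fun x => Set.indicator_le_self' (fun _ _ => zero_le) x)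
  · have hp := ENNReal.toReal_pos h0 ht
    rw [eLpNorm_eq h0 ht]
    have : ∀ x, S.indicator (fun _ => b) x ^ p.toReal = S.indicator (fun _ => b ^ p.toReal) x := by
      intro x
      by_cases hx : x ∈ S <;> simp [hx, hp]
    simp_rw [this]
    rw [lintegral_indicator_const hS, ENNReal.mul_rpow_of_nonneg _ _ (by positivity),
      ← ENNReal.rpow_mul, mul_one_div_cancel hp.ne', ENNReal.rpow_one, ENNReal.toReal_inv, one_div]

end VVMaximal


/-! ### The good-`λ` inequality and extrapolation of exponents -/

namespace VVMaximal

/-- This is the scaling balance: the powers of the measure of a cell coming from the inputs multiply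
to the power `1 / p'` in the output. -/
theorem Admissible.sum_toReal {n : ℕ} {θ : Fin n → ℝ} (hθ : ∀ j, 0 < θ j) {p : Fin n → ℝ≥0∞}
    {p' : ℝ≥0∞} (hp : Admissible θ p p') :
    ∑ j, ((p j)⁻¹).toReal * θ j = 1 / p'.toReal := by
  have h1 := congrArg ENNReal.toReal hp.sum_eq
  rw [ENNReal.toReal_sum (fun j _ => ENNReal.mul_ne_top ENNReal.ofReal_ne_top
      (ENNReal.inv_ne_top.2 (zero_lt_one.trans (hp.one_lt j)).ne')), ENNReal.toReal_inv] at h1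
  simp only [ENNReal.toReal_mul, ENNReal.toReal_ofReal (hθ _).le] at h1
  rw [one_div, ← h1]
  exact Finset.sum_congr rfl fun j _ => mul_comm _ _

theorem prod_rpow_const {n : ℕ} {a : ℝ≥0∞} (h0 : a ≠ 0) (ht : a ≠ ∞) (e : Fin n → ℝ) :
    ∏ j, a ^ e j = a ^ ∑ j, e j := by
  induction n with
  | zero => simp
  | succ n ih => rw [Fin.prod_univ_succ, Fin.sum_univ_succ, ih, ENNReal.rpow_add _ _ h0 ht]

namespace Grid

variable {E : Type} [MeasurableSpace E] {μ : Measure E} {ι : Type} {D : ℝ≥0} (𝒟 : Grid E μ ι D)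
variable {Ω : Type u} {n : ℕ} {A : ℕ → (Fin n → Ω → ℝ≥0∞) → Ω → ℝ≥0∞}
/-- Scalar bound for the product of the maximal functions. -/
theorem eLpNorm_prod_iSup_avg_le [Countable ι] {θ : Fin n → ℝ} (hθ : ∀ j, 0 < θ j) {q : Fin n → ℝ≥0∞}
    {q' : ℝ≥0∞} (hq : Admissible θ q q') {F : Fin n → E → ℝ≥0∞} (hF : ∀ j, Measurable (F j))
    (I : ℕ) :
    eLpNorm (fun x => ∏ j, (⨆ i ∈ Set.Ico 0 I, 𝒟.avg i (F j) x) ^ θ j) q' μ ≤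
      (∏ j, (doobConst (q j) : ℝ≥0∞) ^ θ j) * ∏ j, eLpNorm (F j) (q j) μ ^ θ j := by
  refine (eLpNorm_prod_rpow_le hθ (fun j => (zero_lt_one.trans (hq.one_lt j)).ne') hq.ne_zero
    hq.ne_top hq.sum_eq fun j => ?_).trans ?_
  · exact Measurable.biSup _ (Set.to_countable _) fun i _ => 𝒟.measurable_avg i _
  · rw [← Finset.prod_mul_distrib]
    refine Finset.prod_le_prod' fun j _ => ?_
    rw [← ENNReal.mul_rpow_of_nonneg _ _ (hθ j).le]
    exact ENNReal.rpow_le_rpow (𝒟.eLpNorm_iSup_avg_le (hq.one_lt j) (hF j) I) (hθ j).le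

variable [SFinite μ] [MeasurableSpace Ω] [Countable ι]

/-- The part of the local distributional estimate off the exceptional sets. -/
theorem measure_cell_diff_exceed_le
    (hA : ∀ (i : ℕ) (f : Fin n → E → Ω → ℝ≥0∞), (∀ j, Measurable (Function.uncurry (f j))) →
      Measurable (Function.uncurry fun x => A i (fun j => f j x)))
    {ρ : Fin n → (Ω → ℝ≥0∞) → ℝ≥0∞} (hρ : ∀ j, IsInputNorm μ (ρ j))
    {ρ' : (Ω → ℝ≥0∞) → ℝ≥0∞} {K : ℝ≥0} (hρ' : IsOutputNorm E K ρ')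
    {θ : Fin n → ℝ} (hθ : ∀ j, 0 < θ j) {p : Fin n → ℝ≥0∞} {p' : ℝ≥0∞} (hp : Admissible θ p p')
    {C : ℝ≥0} (hB : 𝒟.MaxBound A ρ ρ' θ p p' C)
    {Λ : ℝ≥0} (hΛ : 1 ≤ Λ) {f : Fin n → E → Ω → ℝ≥0∞}
    (hf : ∀ j, Measurable (Function.uncurry (f j))) {l I : ℕ} (hlI : l < I) (x : E) (t : ℝ≥0∞) :
    t ^ p'.toReal * μ ((𝒟.cell l x ∩ {y | t < ρ' (𝒟.maxOp A (Set.Ico l I) f y)}) \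
      ⋃ j, {y | ∃ i, l ≤ i ∧ i < I ∧
        Λ * 𝒟.avg l (fun z => ρ j (f j z)) x < 𝒟.avg i (fun z => ρ j (f j z)) y}) ≤
      (C * ∏ j, ((D + 1) * (Λ * 𝒟.avg l (fun z => ρ j (f j z)) x)) ^ θ j) ^ p'.toReal *
        μ (𝒟.cell l x) := by
  set F : Fin n → E → ℝ≥0∞ := fun j z => ρ j (f j z) with hF
  set a : Fin n → ℝ≥0∞ := fun j => 𝒟.avg l (F j) x with ha
  set Q := 𝒟.cell l x with hQ
  have hr := ENNReal.toReal_pos hp.ne_zero hp.ne_top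
  set r := p'.toReal with hrdef
  -- The stopped functions are supported on `Q`, where their norms `ρ j` are at most `(D + 1) * (Λ *
  -- a j)`. The assumed bound `hB` is applied to them instead of to `f`.
  set g : Fin n → E → Ω → ℝ≥0∞ := fun j => 𝒟.stopped (F j) (Λ * a j) l I Q (f j) with hg
  have hgm : ∀ j, Measurable (Function.uncurry (g j)) := fun j =>
    𝒟.measurable_stopped hlI (𝒟.measurableSet_cell l x) (hf j)
  have hgle : ∀ j y, ρ j (g j y) ≤ Q.indicator (fun _ => (D + 1) * (Λ * a j)) y := by
    intro j y
    by_cases hy : y ∈ Q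
    · rw [Set.indicator_of_mem hy]
      have e : g j y = 𝒟.vavg (𝒟.stopLevel (F j) (Λ * a j) l I y) (f j) y := by
        funext ω
        simp only [hg, stopped, Set.indicator_of_mem hy]
      rw [e]
      refine (𝒟.norm_vavg_le (hρ j) _ (hf j) y).trans ?_
      exact 𝒟.avg_stop_le (by exact_mod_cast hΛ) (𝒟.avg_congr hy _)
    · rw [Set.indicator_of_notMem hy]
      have e : g j y = fun ω => 0 * (0 : Ω → ℝ≥0∞) ω := by
        funext ω
        simp only [hg, stopped, Set.indicator_of_notMem hy, zero_mul]
      rw [e, (hρ j).const_mul 0 (by simp), zero_mul]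
  have hbound := hB I g hgm
  have hprod : ∏ j, eLpNorm (fun y => ρ j (g j y)) (p j) μ ^ θ j ≤
      (∏ j, ((D + 1) * (Λ * a j)) ^ θ j) * μ Q ^ (1 / r) := by
    rw [← hp.sum_toReal hθ, ← prod_rpow_const (𝒟.measure_cell_ne_zero l x)
      (𝒟.measure_cell_ne_top l x), ← Finset.prod_mul_distrib]
    refine Finset.prod_le_prod' fun j _ => ?_
    rw [ENNReal.rpow_mul, ← ENNReal.mul_rpow_of_nonneg _ _ (hθ j).le]
    refine ENNReal.rpow_le_rpow ?_ (hθ j).le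
    exact eLpNorm_le_of_le_indicator (zero_lt_one.trans (hp.one_lt j)).ne'
      (𝒟.measurableSet_cell l x) (hgle j)
  set N : E → ℝ≥0∞ := fun y => ρ' (𝒟.maxOp A (Set.Ico 0 I) g y) with hN
  have hNm : Measurable N := hρ'.measurable _ (𝒟.measurable_maxOp hA _ hgm)
  -- At a point where no average exceeds its threshold, optional stopping gives `g` and `f` the same
  -- averages in all generations from `l` to `I - 1`. There the tail of the maximal function of `f`
  -- is at most the maximal function of `g`, and Chebyshev's inequality applies.
  have hsub : (Q ∩ {y | t < ρ' (𝒟.maxOp A (Set.Ico l I) f y)}) \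
      ⋃ j, {y | ∃ i, l ≤ i ∧ i < I ∧ Λ * a j < 𝒟.avg i (F j) y} ⊆ {y | t ≤ N y} := by
    rintro y ⟨⟨hyQ, hyt⟩, hyU⟩
    simp only [Set.mem_iUnion, not_exists] at hyU
    have hyle : ∀ j i, l ≤ i → i < I → 𝒟.avg i (F j) y ≤ Λ * a j := fun j i h1 h2 =>
      not_lt.1 fun h => hyU j ⟨i, h1, h2, h⟩
    refine (le_of_lt hyt).trans (hρ'.mono _ _ fun ω => ?_)
    refine iSup₂_le fun i hi => ?_
    refine le_trans (le_of_eq ?_) (le_iSup₂ (f := fun i (_ : i ∈ Set.Ico 0 I) =>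
      A i (fun j => 𝒟.vavg i (g j) y) ω) i ⟨Nat.zero_le i, hi.2⟩)
    congr 1
    funext j
    have hcell : Q = 𝒟.cell l y := (𝒟.cell_congr hyQ).symm
    simp only [hg]
    rw [hcell, 𝒟.vavg_stopped hlI (hyle j) hi.1 hi.2]
  calc t ^ r * μ ((Q ∩ {y | t < ρ' (𝒟.maxOp A (Set.Ico l I) f y)}) \
        ⋃ j, {y | ∃ i, l ≤ i ∧ i < I ∧ Λ * a j < 𝒟.avg i (F j) y})
      ≤ t ^ r * μ {y | t ^ r ≤ N y ^ r} := by
        refine mul_le_mul_right (measure_mono (hsub.trans fun y hy => ?_)) _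
        exact ENNReal.rpow_le_rpow hy hr.le
    _ ≤ ∫⁻ y, N y ^ r ∂μ := mul_meas_ge_le_lintegral (hNm.pow_const _) _
    _ = eLpNorm N p' μ ^ r := (eLpNorm_rpow_toReal hp.ne_zero hp.ne_top _).symm
    _ ≤ (C * ((∏ j, ((D + 1) * (Λ * a j)) ^ θ j) * μ Q ^ (1 / r))) ^ r :=
        ENNReal.rpow_le_rpow (hbound.trans (mul_le_mul_right hprod _)) hr.le
    _ = _ := by
        rw [← mul_assoc, ENNReal.mul_rpow_of_nonneg _ _ hr.le, ← ENNReal.rpow_mul,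
          one_div_mul_cancel hr.ne', ENNReal.rpow_one]

/-- The local distributional estimate. -/
theorem measure_cell_inter_le
    (hA : ∀ (i : ℕ) (f : Fin n → E → Ω → ℝ≥0∞), (∀ j, Measurable (Function.uncurry (f j))) →
      Measurable (Function.uncurry fun x => A i (fun j => f j x)))
    {ρ : Fin n → (Ω → ℝ≥0∞) → ℝ≥0∞} (hρ : ∀ j, IsInputNorm μ (ρ j))
    {ρ' : (Ω → ℝ≥0∞) → ℝ≥0∞} {K : ℝ≥0} (hρ' : IsOutputNorm E K ρ')
    {θ : Fin n → ℝ} (hθ : ∀ j, 0 < θ j) {p : Fin n → ℝ≥0∞} {p' : ℝ≥0∞} (hp : Admissible θ p p')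
    {C : ℝ≥0} (hB : 𝒟.MaxBound A ρ ρ' θ p p' C)
    {Λ : ℝ≥0} (hΛ : 1 ≤ Λ) {ε : ℝ≥0∞} (hΛε : (n : ℝ≥0∞) * (Λ : ℝ≥0∞)⁻¹ ≤ ε / 2) {κ : ℝ≥0∞}
    (hκ : (C * ∏ j, ((D + 1) * (Λ : ℝ≥0∞)) ^ θ j) ^ p'.toReal ≤ ε / 2 * κ ^ p'.toReal)
    {f : Fin n → E → Ω → ℝ≥0∞} (hf : ∀ j, Measurable (Function.uncurry (f j)))
    {l I : ℕ} (hlI : l < I) (x : E) {t : ℝ≥0∞} (ht0 : t ≠ 0) (ht : t ≠ ∞)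
    (hle : κ * ∏ j, 𝒟.avg l (fun z => ρ j (f j z)) x ^ θ j ≤ t) :
    μ (𝒟.cell l x ∩ {y | t < ρ' (𝒟.maxOp A (Set.Ico l I) f y)}) ≤ ε * μ (𝒟.cell l x) := by
  have hr := ENNReal.toReal_pos hp.ne_zero hp.ne_top
  have hgood := 𝒟.measure_cell_diff_exceed_le hA hρ hρ' hθ hp hB hΛ hf hlI x t
  set F : Fin n → E → ℝ≥0∞ := fun j z => ρ j (f j z) with hF
  set r := p'.toReal with hrdef
  set Q := 𝒟.cell l x with hQ
  set U : Fin n → Set E := fun j =>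
    {y | ∃ i, l ≤ i ∧ i < I ∧ Λ * 𝒟.avg l (F j) x < 𝒟.avg i (F j) y} with hU
  set S := Q ∩ {y | t < ρ' (𝒟.maxOp A (Set.Ico l I) f y)} with hS
  have hΛ0 : (Λ : ℝ≥0∞) ≠ 0 := by
    simpa using (zero_lt_one.trans_le hΛ).ne'
  -- By `hle`, `κ` times the product of the averages is at most `t`; after the constant is bounded
  -- by `hκ`, the factor `t ^ r` cancels.
  have h1 : μ (S \ ⋃ j, U j) ≤ ε / 2 * μ Q := by
    have ht1 : t ^ r ≠ 0 := by simp [ht0, ht]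
    have ht2 : t ^ r ≠ ∞ := ENNReal.rpow_ne_top_of_nonneg hr.le ht
    refine (ENNReal.mul_le_mul_iff_right ht1 ht2).1 (hgood.trans ?_)
    have e : C * ∏ j, ((D + 1) * (Λ * 𝒟.avg l (F j) x)) ^ θ j =
        (C * ∏ j, ((D + 1) * (Λ : ℝ≥0∞)) ^ θ j) * ∏ j, 𝒟.avg l (F j) x ^ θ j := by
      rw [mul_assoc, ← Finset.prod_mul_distrib]
      congr 1
      refine Finset.prod_congr rfl fun j _ => ?_
      rw [← mul_assoc, ENNReal.mul_rpow_of_nonneg _ _ (hθ j).le]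
    rw [e, ENNReal.mul_rpow_of_nonneg _ _ hr.le, mul_left_comm]
    calc _ ≤ ε / 2 * κ ^ r * (∏ j, 𝒟.avg l (F j) x ^ θ j) ^ r * μ Q := by gcongr
      _ = ε / 2 * ((κ * ∏ j, 𝒟.avg l (F j) x ^ θ j) ^ r * μ Q) := by
          rw [ENNReal.mul_rpow_of_nonneg _ _ hr.le]
          ring
      _ ≤ _ := by gcongr
  -- Each of the `n` exceptional sets has relative measure at most `1 / Λ`, and `Λ` is large enough
  -- for `n / Λ ≤ ε / 2`.
  have h2 : μ (Q ∩ ⋃ j, U j) ≤ ε / 2 * μ Q := by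
    rw [Set.inter_iUnion]
    refine (measure_iUnion_le _).trans ?_
    rw [tsum_fintype]
    calc ∑ j, μ (Q ∩ U j) ≤ ∑ _j : Fin n, (Λ : ℝ≥0∞)⁻¹ * μ Q :=
          Finset.sum_le_sum fun j _ =>
            𝒟.measure_cell_inter_exceed_le hΛ0 ENNReal.coe_ne_top x
      _ = n * (Λ : ℝ≥0∞)⁻¹ * μ Q := by
          simp [mul_assoc]
      _ ≤ _ := mul_le_mul_left hΛε _
  have hcover : S ⊆ (S \ ⋃ j, U j) ∪ (Q ∩ ⋃ j, U j) := by
    intro y hy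
    by_cases hyU : y ∈ ⋃ j, U j
    · exact Or.inr ⟨hy.1, hyU⟩
    · exact Or.inl ⟨hy, hyU⟩
  refine (measure_mono hcover).trans ((measure_union_le _ _).trans ((add_le_add h1 h2).trans ?_))
  rw [← add_mul, ENNReal.add_halves]

/-- The good-`λ` inequality. -/
theorem good_lambda
    (hA : ∀ (i : ℕ) (f : Fin n → E → Ω → ℝ≥0∞), (∀ j, Measurable (Function.uncurry (f j))) →
      Measurable (Function.uncurry fun x => A i (fun j => f j x)))
    {ρ : Fin n → (Ω → ℝ≥0∞) → ℝ≥0∞} (hρ : ∀ j, IsInputNorm μ (ρ j))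
    {ρ' : (Ω → ℝ≥0∞) → ℝ≥0∞} {K : ℝ≥0} (hρ' : IsOutputNorm E K ρ')
    {θ : Fin n → ℝ} (hθ : ∀ j, 0 < θ j) {p : Fin n → ℝ≥0∞} {p' : ℝ≥0∞} (hp : Admissible θ p p')
    {C : ℝ≥0} (hB : 𝒟.MaxBound A ρ ρ' θ p p' C)
    {Λ : ℝ≥0} (hΛ : 1 ≤ Λ) {ε : ℝ≥0∞} (hΛε : (n : ℝ≥0∞) * (Λ : ℝ≥0∞)⁻¹ ≤ ε / 2) {κ : ℝ≥0∞}
    (hκ : (C * ∏ j, ((D + 1) * (Λ : ℝ≥0∞)) ^ θ j) ^ p'.toReal ≤ ε / 2 * κ ^ p'.toReal)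
    {f : Fin n → E → Ω → ℝ≥0∞} (hf : ∀ j, Measurable (Function.uncurry (f j)))
    (hK : 1 ≤ K) {B : Set E} (hBs : 𝒟.Saturated 0 B) (I : ℕ) {t : ℝ≥0∞} (ht0 : t ≠ 0)
    (ht : t ≠ ∞) :
    μ (B ∩ {x | K * t < ρ' (𝒟.maxOp A (Set.Ico 0 I) f x)}) ≤
      μ (B ∩ {x | t < κ * ∏ j, (⨆ i ∈ Set.Ico 0 I, 𝒟.avg i (fun z => ρ j (f j z)) x) ^ θ j}) +
        ε * μ (B ∩ {x | t < ρ' (𝒟.maxOp A (Set.Ico 0 I) f x)}) := by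
  set G : E → ℝ≥0∞ := fun x =>
    κ * ∏ j, (⨆ i ∈ Set.Ico 0 I, 𝒟.avg i (fun z => ρ j (f j z)) x) ^ θ j with hG
  set N : Set ℕ → E → ℝ≥0∞ := fun S x => ρ' (𝒟.maxOp A S f x) with hN
  have hNm : ∀ S, Measurable (N S) := fun S => hρ'.measurable _ (𝒟.measurable_maxOp hA _ hf)
  have hNmono : ∀ l m x, l ≤ m → N (Set.Ico 0 l) x ≤ N (Set.Ico 0 m) x := fun l m x h =>
    hρ'.mono _ _ fun ω => 𝒟.maxOp_mono_set (Set.Ico_subset_Ico_right h) f x ω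
  have hN0 : ∀ x, N (Set.Ico 0 0) x = 0 := by
    intro x
    have : 𝒟.maxOp A (Set.Ico 0 0) f x = fun _ => 0 := by
      funext ω
      simp [maxOp]
    simp only [hN, this, hρ'.zero]
  have hGm : Measurable G := by
    refine Measurable.const_mul (Finset.measurable_prod _ fun j _ => Measurable.pow_const ?_ _) _
    exact Measurable.biSup _ (Set.to_countable _) fun i _ => 𝒟.measurable_avg i _
  have hBm := hBs.measurableSet 𝒟
  -- `V l` is the set where including generation `l` first pushes the norm of the maximal function
  -- above `t`. It is decided by generations up to `l`, hence is a union of cells of generation `l`.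
  set V : ℕ → Set E := fun l =>
    B ∩ {x | t < N (Set.Ico 0 (l + 1)) x ∧ N (Set.Ico 0 l) x ≤ t} with hV
  have hVs : ∀ l, 𝒟.Saturated l (V l) := by
    intro l x y hxy hx
    refine ⟨hBs (𝒟.idx_eq_of_le (Nat.zero_le l) hxy) hx.1, ?_, ?_⟩
    · have := 𝒟.maxOp_congr_of_factor (A := A) (S := Set.Ico 0 (l + 1))
        (fun i hi => Nat.lt_succ_iff.1 hi.2) hxy f
      have h2 : t < N (Set.Ico 0 (l + 1)) x := hx.2.1
      simp only [hN] at h2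
      rwa [this] at h2
    · have := 𝒟.maxOp_congr_of_factor (A := A) (S := Set.Ico 0 l)
        (fun i hi => le_of_lt hi.2) hxy f
      have h2 : N (Set.Ico 0 l) x ≤ t := hx.2.2
      simp only [hN] at h2
      rwa [this] at h2
  set S : ℕ → Set E := fun l => {x | t < N (Set.Ico l I) x ∧ G x ≤ t} with hS
  have hSm : ∀ l, MeasurableSet (S l) := fun l =>
    (measurableSet_lt measurable_const (hNm _)).inter (measurableSet_le hGm measurable_const)
  have hVS : ∀ l, l < I → μ (V l ∩ S l) ≤ ε * μ (V l) := by
    intro l hl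
    refine 𝒟.measure_inter_le_of_cells (hVs l) (hSm l) fun x hx => ?_
    -- One point of the cell with `G ≤ t` suffices: averages of generation `l` are constant on the
    -- cell, so this bounds them at `x` as the local estimate requires.
    rcases Set.eq_empty_or_nonempty (𝒟.cell l x ∩ S l) with h | ⟨y, hyx, hyS⟩
    · simp [h]
    · refine (measure_mono ?_).trans (𝒟.measure_cell_inter_le hA hρ hρ' hθ hp hB hΛ hΛε hκ hf hl x
        ht0 ht ?_)
      · exact Set.inter_subset_inter_right _ fun z hz => hz.1
      · refine le_trans (mul_le_mul_right (Finset.prod_le_prod' fun j _ => ?_) _) hyS.2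
        refine ENNReal.rpow_le_rpow ?_ (hθ j).le
        rw [𝒟.avg_congr (show 𝒟.idx l x = 𝒟.idx l y from hyx.symm)]
        exact le_iSup₂ (f := fun i (_ : i ∈ Set.Ico 0 I) => 𝒟.avg i (fun z => ρ j (f j z)) y) l
          ⟨Nat.zero_le l, hl⟩
  have hVd : Pairwise (Function.onFun Disjoint V) := by
    have key : ∀ l m, l < m → Disjoint (V l) (V m) := fun l m hlm =>
      Set.disjoint_left.2 fun x hx hx' =>
        absurd (hx.2.1.trans_le (hNmono _ _ x hlm)) (not_lt.2 hx'.2.2)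
    intro l m hlm
    rcases hlm.lt_or_gt with h | h
    · exact key l m h
    · exact (key m l h).symm
  have hexists : ∀ x ∈ B, t < N (Set.Ico 0 I) x → ∃ l, l < I ∧ x ∈ V l := by
    classical
    intro x hxB hx
    have hex : ∃ m, t < N (Set.Ico 0 m) x := ⟨I, hx⟩
    have h1 := Nat.find_spec hex
    have h2 := Nat.find_min' hex hx
    have h3 : Nat.find hex ≠ 0 := by
      intro h
      rw [h, hN0] at h1
      exact absurd h1 (by simp)
    obtain ⟨l, hl⟩ := Nat.exists_eq_succ_of_ne_zero h3
    refine ⟨l, by omega, hxB, ?_, ?_⟩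
    · rwa [hl] at h1
    · exact not_lt.1 (Nat.find_min hex (by omega))
  have hcover : B ∩ {x | K * t < N (Set.Ico 0 I) x} ⊆
      (B ∩ {x | t < G x}) ∪ ⋃ l : Fin I, V l ∩ S l := by
    rintro x ⟨hxB, hx⟩
    have hx' : (K : ℝ≥0∞) * t < N (Set.Ico 0 I) x := hx
    by_cases hGx : t < G x
    · exact Or.inl ⟨hxB, hGx⟩
    · have htK : t ≤ K * t := le_mul_of_one_le_left zero_le (by exact_mod_cast hK)
      obtain ⟨l, hl, hxl⟩ := hexists x hxB (htK.trans_lt hx')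
      refine Or.inr (Set.mem_iUnion.2 ⟨⟨l, hl⟩, hxl, ?_, not_lt.1 hGx⟩)
      -- The head, over generations below `l`, is at most `t` by definition of `V l`. If the tail
      -- from `l` on were also at most `t`, the quasi-maximum inequality would bound the whole by `K
      -- * t`.
      by_contra hcon
      have hcon' : N (Set.Ico l I) x ≤ t := not_lt.1 hcon
      refine absurd hx' (not_lt.2 ?_)
      have e : 𝒟.maxOp A (Set.Ico 0 I) f x = fun ω =>
          max (𝒟.maxOp A (Set.Ico 0 l) f x ω) (𝒟.maxOp A (Set.Ico l I) f x ω) :=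
        funext fun ω => 𝒟.maxOp_Ico_split hl.le f x ω
      have hmeas : ∀ S, Measurable (𝒟.maxOp A S f x) := fun S =>
        (𝒟.measurable_maxOp hA S hf).of_uncurry_left
      have := hρ'.max_le _ _ (hmeas (Set.Ico 0 l)) (hmeas (Set.Ico l I))
      rw [← e] at this
      exact this.trans (mul_le_mul_right (max_le hxl.2.2 hcon') _)
  refine (measure_mono hcover).trans ((measure_union_le _ _).trans (add_le_add le_rfl ?_))
  have hsum : ∑ l : Fin I, μ (V l) ≤ μ (B ∩ {x | t < N (Set.Ico 0 I) x}) := by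
    have h1 : μ (⋃ l : Fin I, V l) = ∑' l : Fin I, μ (V l) :=
      measure_iUnion (fun l m hlm => hVd (fun h => hlm (Fin.ext h)))
        (fun l => (hVs l).measurableSet 𝒟)
    rw [tsum_fintype] at h1
    rw [← h1]
    refine measure_mono (Set.iUnion_subset fun l x hx => ⟨hx.1, ?_⟩)
    exact hx.2.1.trans_le (hNmono _ _ x l.2)
  calc μ (⋃ l : Fin I, V l ∩ S l) ≤ ∑ l : Fin I, μ (V l ∩ S l) := by
        refine (measure_iUnion_le _).trans ?_
        rw [tsum_fintype]
    _ ≤ ∑ l : Fin I, ε * μ (V l) := Finset.sum_le_sum fun l _ => hVS l l.2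
    _ = ε * ∑ l : Fin I, μ (V l) := by rw [Finset.mul_sum]
    _ ≤ _ := mul_le_mul_right hsum _

end Grid

/-- Extrapolation: boundedness of the maximal operators for one tuple of exponents implies
boundedness for all tuples of exponents. -/
theorem exists_extrapolation {n : ℕ} {θ : Fin n → ℝ} (hθ : ∀ j, 0 < θ j) {p q : Fin n → ℝ≥0∞}
    {p' q' : ℝ≥0∞} (hp : Admissible θ p p') (hq : Admissible θ q q') (D K C : ℝ≥0) (hK : 1 ≤ K) :
    ∃ C' : ℝ≥0, ∀ {E : Type} [MeasurableSpace E] {μ : Measure E} [SFinite μ] {ι : Type}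
      [Countable ι] (𝒟 : Grid E μ ι D) {Ω : Type u} [MeasurableSpace Ω]
      (A : ℕ → (Fin n → Ω → ℝ≥0∞) → Ω → ℝ≥0∞)
      (_ : ∀ (i : ℕ) (f : Fin n → E → Ω → ℝ≥0∞), (∀ j, Measurable (Function.uncurry (f j))) →
        Measurable (Function.uncurry fun x => A i (fun j => f j x)))
      (ρ : Fin n → (Ω → ℝ≥0∞) → ℝ≥0∞) (_ : ∀ j, IsInputNorm μ (ρ j))
      (ρ' : (Ω → ℝ≥0∞) → ℝ≥0∞) (_ : IsOutputNorm E K ρ'),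
      𝒟.MaxBound A ρ ρ' θ p p' C → 𝒟.MaxBound A ρ ρ' θ q q' C' := by
  have hr := ENNReal.toReal_pos hp.ne_zero hp.ne_top
  have hs := ENNReal.toReal_pos hq.ne_zero hq.ne_top
  set r := p'.toReal with hrdef
  set s := q'.toReal with hsdef
  have hK0 : (0 : ℝ) < K := by exact_mod_cast zero_lt_one.trans_le hK
  -- Chosen so that `K ^ s * ε = 1 / 2`, the absorption condition of the good-`λ` method at the
  -- target exponent `s`.
  set ε : ℝ≥0 := (2 * K ^ s)⁻¹ with hε
  have hε0 : 0 < ε := by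
    have : 0 < K := by exact_mod_cast hK0
    rw [hε]
    positivity
  set Λ : ℝ≥0 := 2 * n / ε + 1 with hΛdef
  have hΛ : 1 ≤ Λ := le_add_self
  obtain ⟨c, hc⟩ : ∃ c : ℝ≥0, c = C * ∏ j, ((D + 1) * Λ) ^ θ j := ⟨_, rfl⟩
  -- Solves `c ^ r = ε / 2 * κ ^ r`, which makes the Chebyshev part of the local estimate equal to
  -- its share `ε / 2`.
  obtain ⟨κ, hκdef⟩ : ∃ κ : ℝ≥0, κ = c * (2 / ε) ^ (1 / r) := ⟨_, rfl⟩
  have hκc : c ^ r ≤ ε / 2 * κ ^ r := by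
    rw [hκdef, NNReal.mul_rpow, ← NNReal.rpow_mul, one_div_mul_cancel hr.ne', NNReal.rpow_one]
    refine le_of_eq ?_
    field_simp
  refine ⟨2 ^ (1 / s) * K * κ * ∏ j, doobConst (q j) ^ θ j, ?_⟩
  intro E _ μ _ ι _ 𝒟 Ω _ A hA ρ hρ ρ' hρ' hB I f hf
  have hΛε : (n : ℝ≥0∞) * (Λ : ℝ≥0∞)⁻¹ ≤ (ε : ℝ≥0∞) / 2 := by
    have h : (n : ℝ≥0) * Λ⁻¹ ≤ ε / 2 := by
      rw [← div_eq_mul_inv, div_le_iff₀ (zero_lt_one.trans_le hΛ), hΛdef]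
      have : ε / 2 * (2 * n / ε + 1) = n + ε / 2 := by
        field_simp
      rw [this]
      exact le_self_add
    have h2 := ENNReal.coe_le_coe.2 h
    rwa [ENNReal.coe_mul, ENNReal.coe_inv (zero_lt_one.trans_le hΛ).ne',
      ENNReal.coe_div two_ne_zero] at h2
  have hκ : (C * ∏ j, ((D + 1) * (Λ : ℝ≥0∞)) ^ θ j) ^ r ≤ (ε : ℝ≥0∞) / 2 * (κ : ℝ≥0∞) ^ r := by
    have h2 := ENNReal.coe_le_coe.2 hκc
    have hcc : (c : ℝ≥0∞) = C * ∏ j, ((D + 1) * (Λ : ℝ≥0∞)) ^ θ j := by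
      rw [hc, ENNReal.coe_mul, ENNReal.ofNNReal_finsetProd]
      congr 1
      refine Finset.prod_congr rfl fun j _ => ?_
      rw [ENNReal.coe_rpow_of_nonneg _ (hθ j).le]
      push_cast
      rfl
    rwa [ENNReal.coe_mul, ENNReal.coe_rpow_of_nonneg _ hr.le, ENNReal.coe_rpow_of_nonneg _ hr.le,
      ENNReal.coe_div two_ne_zero, hcc] at h2
  set N : E → ℝ≥0∞ := fun x => ρ' (𝒟.maxOp A (Set.Ico 0 I) f x) with hN
  have hNm : Measurable N := hρ'.measurable _ (𝒟.measurable_maxOp hA _ hf)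
  have hFm : ∀ j, Measurable fun x => ρ j (f j x) := fun j => (hρ j).measurable _ (hf j)
  set G : E → ℝ≥0∞ := fun x =>
    ∏ j, (⨆ i ∈ Set.Ico 0 I, 𝒟.avg i (fun z => ρ j (f j z)) x) ^ θ j with hG
  have hGm : Measurable G := Finset.measurable_prod _ fun j _ => Measurable.pow_const
    (Measurable.biSup _ (Set.to_countable _) fun i _ => 𝒟.measurable_avg i _) _
  obtain ⟨B, hBmono, hBsat, hBfin, hBuniv⟩ := 𝒟.exists_exhaustion
  have hεK : ENNReal.ofReal ((K : ℝ) ^ s) * (ε : ℝ≥0∞) ≤ 2⁻¹ := by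
    have hKs : ENNReal.ofReal ((K : ℝ) ^ s) = ((K ^ s : ℝ≥0) : ℝ≥0∞) := by
      rw [← NNReal.coe_rpow, ENNReal.ofReal_coe_nnreal]
    rw [hKs, ← ENNReal.coe_mul, hε]
    have hK1 : K ^ s ≠ 0 := by
      have : 0 < K := by exact_mod_cast hK0
      positivity
    have : K ^ s * (2 * K ^ s)⁻¹ = 2⁻¹ := by
      field_simp
    rw [this, ENNReal.coe_inv two_ne_zero]
    rfl
  -- Absorption needs finite measure, so the good-`λ` method runs on each set of the exhaustion. The
  -- bound does not depend on that set and passes to the union.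
  have hloc : ∀ n, ∫⁻ x in B n, N x ^ s ∂μ ≤
      2 * ENNReal.ofReal ((K : ℝ) ^ s) * ∫⁻ x, (κ * G x) ^ s ∂μ := by
    intro n
    have hBm := (hBsat n).measurableSet 𝒟
    have : IsFiniteMeasure (μ.restrict (B n)) := ⟨by simpa using hBfin n⟩
    refine (lintegral_rpow_le_of_good_lambda hs (by exact_mod_cast hK) hεK hNm
      (hGm.const_mul κ) fun t ht => ?_).trans (mul_le_mul_right (setLIntegral_le_lintegral _ _) _)
    have hmul : ENNReal.ofReal ((K : ℝ) * t) = K * ENNReal.ofReal t := by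
      rw [ENNReal.ofReal_mul (NNReal.coe_nonneg K), ENNReal.ofReal_coe_nnreal]
    have := 𝒟.good_lambda hA hρ hρ' hθ hp hB hΛ hΛε hκ hf hK (hBsat n) I
      (t := ENNReal.ofReal t) (by simpa using ht) ENNReal.ofReal_ne_top
    rw [hmul, Measure.restrict_apply' hBm, Measure.restrict_apply' hBm, Measure.restrict_apply' hBm,
      Set.inter_comm _ (B n), Set.inter_comm _ (B n), Set.inter_comm _ (B n)]
    exact this
  have hglob : ∫⁻ x, N x ^ s ∂μ ≤
      2 * ENNReal.ofReal ((K : ℝ) ^ s) * ∫⁻ x, (κ * G x) ^ s ∂μ := by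
    rw [← setLIntegral_univ, ← hBuniv, setLIntegral_iUnion_of_directed _ hBmono.directed_le]
    exact iSup_le hloc
  have hGle : eLpNorm G q' μ ≤ _ := 𝒟.eLpNorm_prod_iSup_avg_le hθ hq hFm I
  have hKs : ENNReal.ofReal ((K : ℝ) ^ s) = (K : ℝ≥0∞) ^ s := by
    rw [← ENNReal.ofReal_rpow_of_pos hK0, ENNReal.ofReal_coe_nnreal]
  calc eLpNorm N q' μ = (∫⁻ x, N x ^ s ∂μ) ^ (1 / s) := eLpNorm_eq hq.ne_zero hq.ne_top _
    _ ≤ (2 * ENNReal.ofReal ((K : ℝ) ^ s) * ∫⁻ x, (κ * G x) ^ s ∂μ) ^ (1 / s) :=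
        ENNReal.rpow_le_rpow hglob (by positivity)
    _ = 2 ^ (1 / s) * K * eLpNorm (fun x => κ * G x) q' μ := by
        rw [ENNReal.mul_rpow_of_nonneg _ _ (by positivity),
          ENNReal.mul_rpow_of_nonneg _ _ (by positivity), hKs, ← ENNReal.rpow_mul,
          mul_one_div_cancel hs.ne', ENNReal.rpow_one, eLpNorm_eq hq.ne_zero hq.ne_top]
    _ = 2 ^ (1 / s) * K * κ * eLpNorm G q' μ := by
        rw [eLpNorm_const_mul' ENNReal.coe_ne_top, mul_assoc _ (κ : ℝ≥0∞)]
    _ ≤ 2 ^ (1 / s) * K * κ * ((∏ j, (doobConst (q j) : ℝ≥0∞) ^ θ j) *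
          ∏ j, eLpNorm (fun x => ρ j (f j x)) (q j) μ ^ θ j) := mul_le_mul_right hGle _
    _ = _ := by
        rw [← mul_assoc]
        congr 1
        rw [ENNReal.coe_mul, ENNReal.coe_mul, ENNReal.coe_mul, ENNReal.ofNNReal_finsetProd,
          ENNReal.coe_rpow_of_nonneg _ (by positivity)]
        congr 1
        refine Finset.prod_congr rfl fun j _ => ?_
        rw [ENNReal.coe_rpow_of_nonneg _ (hθ j).le]

end VVMaximal


/-! ### Dyadic grids, product grids, and mixed norms in the remaining variables -/

namespace VVMaximal

/-- The index of the dyadic interval of length `L / 2 ^ i`, in the grid translated by `t`. -/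
noncomputable def dyadicIdx (t L : ℝ) (i : ℕ) (x : ℝ) : ℤ := ⌊(x - t) * (2 ^ i / L)⌋

theorem measurable_dyadicIdx (t L : ℝ) (i : ℕ) : Measurable (dyadicIdx t L i) :=
  Int.measurable_floor.comp (by fun_prop)

theorem setOf_dyadicIdx_eq {L : ℝ} (hL : 0 < L) (t : ℝ) (i : ℕ) (c : ℤ) :
    {y | dyadicIdx t L i y = c} = Set.Ico (t + c * (L / 2 ^ i)) (t + (c + 1) * (L / 2 ^ i)) := by
  ext y
  have h2 : (0 : ℝ) < 2 ^ i := by positivity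
  have e : (y - t) * (2 ^ i / L) = (y - t) / (L / 2 ^ i) := by field_simp
  have hpos : 0 < L / 2 ^ i := by positivity
  simp only [Set.mem_ofPred_eq, dyadicIdx, Int.floor_eq_iff, Set.mem_Ico, e, le_div_iff₀ hpos,
    div_lt_iff₀ hpos]
  constructor
  · rintro ⟨h1, h2⟩
    constructor <;> linarith
  · rintro ⟨h1, h2⟩
    constructor <;> linarith

theorem volume_dyadicIdx_eq {L : ℝ} (hL : 0 < L) (t : ℝ) (i : ℕ) (c : ℤ) :
    volume {y | dyadicIdx t L i y = c} = ENNReal.ofReal (L / 2 ^ i) := by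
  rw [setOf_dyadicIdx_eq hL, Real.volume_Ico]
  congr 1
  ring

theorem dyadicIdx_nested (t L : ℝ) (i : ℕ) {x y : ℝ}
    (h : dyadicIdx t L (i + 1) x = dyadicIdx t L (i + 1) y) :
    dyadicIdx t L i x = dyadicIdx t L i y := by
  -- The index of the parent interval is the integer half of the index of the child.
  have key : ∀ z : ℝ, dyadicIdx t L i z = dyadicIdx t L (i + 1) z / 2 := by
    intro z
    have e : (z - t) * (2 ^ (i + 1) / L) = 2 * ((z - t) * (2 ^ i / L)) := by ring
    rw [dyadicIdx, dyadicIdx, e, Int.floor_eq_iff]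
    set w := (z - t) * (2 ^ i / L)
    have h1 := Int.floor_le (2 * w)
    have h2 := Int.lt_floor_add_one (2 * w)
    set c := ⌊2 * w⌋
    have h3 : (2 * (c / 2) : ℤ) ≤ c := by omega
    have h4 : c + 1 ≤ 2 * (c / 2) + 2 := by omega
    have h3' : (2 * ((c / 2 : ℤ) : ℝ)) ≤ c := by exact_mod_cast h3
    have h4' : (c : ℝ) + 1 ≤ 2 * ((c / 2 : ℤ) : ℝ) + 2 := by exact_mod_cast h4
    constructor <;> linarith
  rw [key, key, h]

/-- The translated dyadic grid on the line with intervals of length `L / 2 ^ i`. -/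
noncomputable def realGrid (t : ℝ) {L : ℝ} (hL : 0 < L) : Grid ℝ volume ℤ 2 where
  idx := dyadicIdx t L
  measurableSet_idx i c := measurable_dyadicIdx t L i (measurableSet_singleton c)
  nested i _ _ h := dyadicIdx_nested t L i h
  ne_zero i x := by
    rw [volume_dyadicIdx_eq hL]
    simp only [ne_eq, ENNReal.ofReal_eq_zero, not_le]
    positivity
  ne_top i x := by
    rw [volume_dyadicIdx_eq hL]
    exact ENNReal.ofReal_ne_top
  doubling i x := by
    rw [volume_dyadicIdx_eq hL, volume_dyadicIdx_eq hL]
    have : L / 2 ^ i = 2 * (L / 2 ^ (i + 1)) := by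
      rw [pow_succ]
      field_simp
    rw [this, ENNReal.ofReal_mul zero_le_two]
    simp

/-- The grid on a point. -/
noncomputable def unitGrid : Grid Unit (Measure.dirac ()) Unit 1 where
  idx _ _ := ()
  measurableSet_idx _ _ := MeasurableSet.of_discrete
  nested _ _ _ _ := rfl
  ne_zero i x := by simp
  ne_top i x := by simp
  doubling i x := by simp

theorem unitGrid_avg (i : ℕ) (f : Unit → ℝ≥0∞) (x : Unit) : unitGrid.avg i f x = f x :=
  unitGrid.avg_eq_of_const_on fun _ _ => rfl

namespace Grid

variable {E E' : Type} [MeasurableSpace E] [MeasurableSpace E'] {μ : Measure E} {μ' : Measure E'}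
  {ι ι' : Type} {D D' : ℝ≥0}

theorem prod_aux [SFinite μ'] (𝒟 : Grid E μ ι D) (𝒟' : Grid E' μ' ι' D') (i : ℕ) (x : E × E') :
    (μ.prod μ') {y | (𝒟.idx i y.1, 𝒟'.idx i y.2) = (𝒟.idx i x.1, 𝒟'.idx i x.2)} =
      μ (𝒟.cell i x.1) * μ' (𝒟'.cell i x.2) := by
  rw [← Measure.prod_prod]
  congr 1
  ext y
  simp [cell]

/-- The product of two grids. -/
def prod [SFinite μ'] (𝒟 : Grid E μ ι D) (𝒟' : Grid E' μ' ι' D') :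
    Grid (E × E') (μ.prod μ') (ι × ι') (D * D') where
  idx i x := (𝒟.idx i x.1, 𝒟'.idx i x.2)
  measurableSet_idx i c := by
    have : {x : E × E' | (𝒟.idx i x.1, 𝒟'.idx i x.2) = c} =
        {x | 𝒟.idx i x = c.1} ×ˢ {x | 𝒟'.idx i x = c.2} := by
      ext x
      simp [Prod.ext_iff]
    rw [this]
    exact (𝒟.measurableSet_idx i _).prod (𝒟'.measurableSet_idx i _)
  nested i x y h := by
    rw [Prod.mk.injEq] at h ⊢
    exact ⟨𝒟.nested i _ _ h.1, 𝒟'.nested i _ _ h.2⟩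
  ne_zero i x := by
    rw [prod_aux]
    exact mul_ne_zero (𝒟.measure_cell_ne_zero i _) (𝒟'.measure_cell_ne_zero i _)
  ne_top i x := by
    rw [prod_aux]
    exact ENNReal.mul_ne_top (𝒟.measure_cell_ne_top i _) (𝒟'.measure_cell_ne_top i _)
  doubling i x := by
    rw [prod_aux, prod_aux, ENNReal.coe_mul, mul_mul_mul_comm]
    exact mul_le_mul' (𝒟.doubling i _) (𝒟'.doubling i _)

theorem cell_prod [SFinite μ'] (𝒟 : Grid E μ ι D) (𝒟' : Grid E' μ' ι' D') (i : ℕ) (x : E × E') :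
    (𝒟.prod 𝒟').cell i x = 𝒟.cell i x.1 ×ˢ 𝒟'.cell i x.2 := by
  ext y
  simp [cell, prod]

theorem avg_prod [SFinite μ] [SFinite μ'] (𝒟 : Grid E μ ι D) (𝒟' : Grid E' μ' ι' D') (i : ℕ)
    {h : E × E' → ℝ≥0∞} (hh : Measurable h) (x : E × E') :
    (𝒟.prod 𝒟').avg i h x = 𝒟'.avg i (fun b => 𝒟.avg i (fun a => h (a, b)) x.1) x.2 := by
  rw [avg, cell_prod, Measure.prod_prod, avg]
  simp only [avg]
  rw [lintegral_const_mul' _ _ (ENNReal.inv_ne_top.2 (𝒟.measure_cell_ne_zero i x.1)),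
    ENNReal.mul_inv (Or.inl (𝒟.measure_cell_ne_zero i x.1))
    (Or.inl (𝒟.measure_cell_ne_top i x.1)), ← mul_assoc, mul_comm (μ (𝒟.cell i x.1))⁻¹]
  congr 1
  rw [← Measure.prod_restrict, lintegral_prod _ hh.aemeasurable]
  exact lintegral_lintegral_swap hh.aemeasurable

end Grid

section PiAvg

variable {k : ℕ}

/-- The dyadic cube of side length `L / 2 ^ i` containing `y`, in the grid translated by `t`. -/
def piCell (t : Fin k → ℝ) (L : ℝ) (i : ℕ) (y : Fin k → ℝ) : Set (Fin k → ℝ) :=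
  Set.univ.pi fun c => {z | dyadicIdx (t c) L i z = dyadicIdx (t c) L i (y c)}

/-- The average over the dyadic cube of side length `L / 2 ^ i` containing `y`. -/
noncomputable def piAvg (t : Fin k → ℝ) (L : ℝ) (i : ℕ) (u : (Fin k → ℝ) → ℝ≥0∞)
    (y : Fin k → ℝ) : ℝ≥0∞ :=
  (volume (piCell t L i y))⁻¹ * ∫⁻ z in piCell t L i y, u z

theorem measurableSet_piCell (t : Fin k → ℝ) (L : ℝ) (i : ℕ) (y : Fin k → ℝ) :
    MeasurableSet (piCell t L i y) :=
  MeasurableSet.univ_pi fun c => measurable_dyadicIdx (t c) L i (measurableSet_singleton _)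

theorem volume_piCell (t : Fin k → ℝ) {L : ℝ} (hL : 0 < L) (i : ℕ) (y : Fin k → ℝ) :
    volume (piCell t L i y) = ENNReal.ofReal (L / 2 ^ i) ^ k := by
  rw [piCell, volume_pi_pi]
  simp [volume_dyadicIdx_eq hL]

theorem volume_piCell_ne_zero (t : Fin k → ℝ) {L : ℝ} (hL : 0 < L) (i : ℕ) (y : Fin k → ℝ) :
    volume (piCell t L i y) ≠ 0 := by
  rw [volume_piCell t hL]
  have : 0 < L / 2 ^ i := by positivity
  exact pow_ne_zero _ (by simpa using this)

theorem volume_piCell_ne_top (t : Fin k → ℝ) {L : ℝ} (hL : 0 < L) (i : ℕ) (y : Fin k → ℝ) :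
    volume (piCell t L i y) ≠ ∞ := by
  rw [volume_piCell t hL]
  exact ENNReal.pow_ne_top ENNReal.ofReal_ne_top

theorem piAvg_zero_dim (t : Fin 0 → ℝ) (L : ℝ) (i : ℕ) (u : (Fin 0 → ℝ) → ℝ≥0∞)
    (y : Fin 0 → ℝ) : piAvg t L i u y = u y := by
  have h : piCell t L i y = Set.univ := by
    ext z
    simp [piCell]
  rw [piAvg, h, setLIntegral_univ, volume_pi, Measure.pi_of_empty _ y]
  simp

theorem measurable_piAvg {X : Type*} [MeasurableSpace X] (t : Fin k → ℝ) {L : ℝ} (hL : 0 < L)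
    (i : ℕ) {u : X → (Fin k → ℝ) → ℝ≥0∞} (hu : Measurable (Function.uncurry u)) :
    Measurable fun z : X × (Fin k → ℝ) => piAvg t L i (u z.1) z.2 := by
  simp only [piAvg, volume_piCell t hL]
  refine Measurable.const_mul ?_ _
  have hS : MeasurableSet {z : (X × (Fin k → ℝ)) × (Fin k → ℝ) | z.2 ∈ piCell t L i z.1.2} := by
    have : {z : (X × (Fin k → ℝ)) × (Fin k → ℝ) | z.2 ∈ piCell t L i z.1.2} =
        ⋂ c, {z | dyadicIdx (t c) L i (z.2 c) = dyadicIdx (t c) L i (z.1.2 c)} := by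
      ext z
      simp [piCell]
    rw [this]
    refine MeasurableSet.iInter fun c => measurableSet_eq_fun ?_ ?_
    · exact (measurable_dyadicIdx (t c) L i).comp (by fun_prop)
    · exact (measurable_dyadicIdx (t c) L i).comp (by fun_prop)
  have e : (fun z : X × (Fin k → ℝ) => ∫⁻ y in piCell t L i z.2, u z.1 y) = fun z =>
      ∫⁻ y, {z : (X × (Fin k → ℝ)) × (Fin k → ℝ) | z.2 ∈ piCell t L i z.1.2}.indicator
        (fun z => u z.1.1 z.2) (z, y) := by
    funext z
    rw [← lintegral_indicator (measurableSet_piCell t L i z.2)]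
    rfl
  rw [e]
  refine Measurable.lintegral_prod_right' (Measurable.indicator ?_ hS)
  exact hu.comp ((measurable_fst.comp measurable_fst).prodMk measurable_snd)

theorem piAvg_succ (t : Fin (k + 1) → ℝ) {L : ℝ} (hL : 0 < L) (i : ℕ)
    {u : (Fin (k + 1) → ℝ) → ℝ≥0∞} (hu : Measurable u) (a : ℝ) (y : Fin k → ℝ) :
    piAvg t L i u (Fin.cons a y) = (realGrid (t 0) hL).avg i
      (fun b => piAvg (fun c => t c.succ) L i (fun z => u (Fin.cons b z)) y) a := by
  have hmp := measurePreserving_finCons (α := fun _ : Fin (k + 1) => ℝ) (fun _ => volume)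
  rw [← volume_pi, ← volume_pi] at hmp
  have hpre : (fun z : ℝ × (Fin k → ℝ) => (Fin.cons z.1 z.2 : Fin (k + 1) → ℝ)) ⁻¹'
      piCell t L i (Fin.cons a y) =
        (realGrid (t 0) hL).cell i a ×ˢ piCell (fun c => t c.succ) L i y := by
    ext z
    simp [piCell, Grid.cell, realGrid, Fin.forall_fin_succ]
  have hm := measurableSet_piCell t L i (Fin.cons a y)
  rw [piAvg, Grid.avg, ← hmp.measure_preimage hm.nullMeasurableSet,
    ← hmp.setLIntegral_comp_preimage hm hu, hpre, Measure.prod_prod, ← Measure.prod_restrict,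
    lintegral_prod (fun z : ℝ × (Fin k → ℝ) => u (Fin.cons z.1 z.2))
      (hu.comp measurable_finCons).aemeasurable]
  simp only [piAvg]
  rw [lintegral_const_mul' _ _ (ENNReal.inv_ne_top.2 (volume_piCell_ne_zero _ hL i y)), ← mul_assoc,
    ENNReal.mul_inv (Or.inl ((realGrid (t 0) hL).measure_cell_ne_zero i a))
    (Or.inl ((realGrid (t 0) hL).measure_cell_ne_top i a))]

theorem piAvg_avg_comm {E : Type} [MeasurableSpace E] {μ : Measure E} [SFinite μ] {ι : Type}
    {D : ℝ≥0} (𝒟 : Grid E μ ι D) (t : Fin k → ℝ) {L : ℝ} (hL : 0 < L) (i : ℕ)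
    {u : E → (Fin k → ℝ) → ℝ≥0∞} (hu : Measurable (Function.uncurry u)) (a : E) (y : Fin k → ℝ) :
    piAvg t L i (fun z => 𝒟.avg i (fun b => u b z) a) y =
      𝒟.avg i (fun b => piAvg t L i (u b) y) a := by
  simp only [piAvg, Grid.avg]
  rw [lintegral_const_mul' _ _ (ENNReal.inv_ne_top.2 (𝒟.measure_cell_ne_zero i a)),
    lintegral_const_mul' _ _ (ENNReal.inv_ne_top.2 (volume_piCell_ne_zero t hL i y)),
    mul_left_comm]
  congr 2
  exact (lintegral_lintegral_swap hu.aemeasurable).symm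

end PiAvg

/-- Exponents `P_j ∈ (1, ∞]^k` and `P' ∈ (0, ∞)^k` that are admissible in each component. -/
def AdmissibleTuple {n k : ℕ} (θ : Fin n → ℝ) (P : Fin n → Fin k → ℝ≥0∞) (P' : Fin k → ℝ≥0∞) :
    Prop :=
  ∀ i, Admissible θ (fun j => P j i) (P' i)

section Norms

variable {E : Type} [MeasurableSpace E] {k m : ℕ} {W : Fin m → Type u}
  [∀ i, MeasurableSpace (W i)] (ν : ∀ i, Measure (W i))

/-- The mixed norm of a function on `ℝ^k × 𝒲`. -/
noncomputable def pairNorm (P : Fin k → ℝ≥0∞) (R : Fin m → ℝ≥0∞)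
    (u : (Fin k → ℝ) × (∀ i, W i) → ℝ≥0∞) : ℝ≥0∞ :=
  vvMixedNorm P R ν fun y w => u (y, w)

theorem pairNorm_mono (P : Fin k → ℝ≥0∞) (R : Fin m → ℝ≥0∞)
    {u v : (Fin k → ℝ) × (∀ i, W i) → ℝ≥0∞} (h : ∀ z, u z ≤ v z) :
    pairNorm ν P R u ≤ pairNorm ν P R v :=
  mixedNorm_mono _ _ fun _ => mixedNorm_mono _ _ fun _ => h _

variable [∀ i, SigmaFinite (ν i)]

/-- Minkowski's integral inequality is the reason for exponents at least `1` on the source side; `∞`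
is allowed. -/
theorem isInputNorm_mixedNorm (μ : Measure E) [SFinite μ] {R : Fin m → ℝ≥0∞} (hR : ∀ i, 1 ≤ R i) :
    IsInputNorm μ (mixedNorm R ν) where
  measurable _ hf := measurable_mixedNorm R ν hf
  lintegral_le _ hf _ := mixedNorm_lintegral_le hR ν hf
  const_mul _ hc u := mixedNorm_const_mul R ν hc u

/-- No triangle inequality is asked for, only the quasi-maximum bound, so exponents below `1` are
admitted. -/
theorem isOutputNorm_mixedNorm {R : Fin m → ℝ≥0∞} (h0 : ∀ i, R i ≠ 0) (ht : ∀ i, R i ≠ ∞) :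
    IsOutputNorm E (quasiConst R) (mixedNorm R ν) where
  measurable _ hf := measurable_mixedNorm R ν hf
  mono _ _ h := mixedNorm_mono R ν h
  zero := mixedNorm_zero R ν
  max_le _ _ hu _ := mixedNorm_max_le h0 ht ν hu

theorem measurable_inner {R : Fin m → ℝ≥0∞} {X : Type*} [MeasurableSpace X]
    {f : X → (Fin k → ℝ) × (∀ i, W i) → ℝ≥0∞} (hf : Measurable (Function.uncurry f)) :
    Measurable (Function.uncurry fun x (y : Fin k → ℝ) => mixedNorm R ν fun w => f x (y, w)) :=
  measurable_mixedNorm R ν (X := X × (Fin k → ℝ)) (F := fun z w => f z.1 (z.2, w))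
    (hf.comp ((measurable_fst.comp measurable_fst).prodMk
      ((measurable_snd.comp measurable_fst).prodMk measurable_snd)))

theorem measurable_pairNorm (P : Fin k → ℝ≥0∞) (R : Fin m → ℝ≥0∞) {X : Type*} [MeasurableSpace X]
    {f : X → (Fin k → ℝ) × (∀ i, W i) → ℝ≥0∞} (hf : Measurable (Function.uncurry f)) :
    Measurable fun x => pairNorm ν P R (f x) :=
  measurable_mixedNorm P _ (measurable_inner ν hf)

theorem isInputNorm_pairNorm (μ : Measure E) [SFinite μ] {P : Fin k → ℝ≥0∞} {R : Fin m → ℝ≥0∞}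
    (hP : ∀ i, 1 ≤ P i) (hR : ∀ i, 1 ≤ R i) : IsInputNorm μ (pairNorm ν P R) where
  measurable _ hf := measurable_pairNorm ν P R hf
  lintegral_le f hf S := by
    refine le_trans (mixedNorm_mono _ _ fun y => ?_)
      (mixedNorm_lintegral_le hP _ (measurable_inner ν hf))
    refine mixedNorm_lintegral_le hR ν (F := fun x w => f x (y, w)) ?_
    exact hf.comp (measurable_fst.prodMk (measurable_const.prodMk measurable_snd))
  const_mul c hc u := by
    rw [pairNorm, vvMixedNorm]
    simp_rw [mixedNorm_const_mul R ν hc]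
    exact mixedNorm_const_mul P _ hc _

theorem pairNorm_max_le {P : Fin k → ℝ≥0∞} {R : Fin m → ℝ≥0∞}
    (hP0 : ∀ i, P i ≠ 0) (hPt : ∀ i, P i ≠ ∞) (hR0 : ∀ i, R i ≠ 0) (hRt : ∀ i, R i ≠ ∞)
    {u v : (Fin k → ℝ) × (∀ i, W i) → ℝ≥0∞} (hu : Measurable u) :
    pairNorm ν P R (fun z => max (u z) (v z)) ≤
      (quasiConst R * quasiConst P : ℝ≥0) * max (pairNorm ν P R u) (pairNorm ν P R v) := by
  rw [ENNReal.coe_mul, mul_assoc]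
  refine (mixedNorm_mono _ _ fun y => mixedNorm_max_le hR0 hRt ν (F := fun w => u (y, w))
    (G := fun w => v (y, w)) (hu.comp measurable_prodMk_left)).trans ?_
  rw [mixedNorm_const_mul _ _ ENNReal.coe_ne_top]
  refine mul_le_mul_right (mixedNorm_max_le hP0 hPt _ ?_) _
  exact measurable_mixedNorm R ν (F := fun y w => u (y, w)) hu

theorem isOutputNorm_pairNorm {P : Fin k → ℝ≥0∞} {R : Fin m → ℝ≥0∞}
    (hP0 : ∀ i, P i ≠ 0) (hPt : ∀ i, P i ≠ ∞) (hR0 : ∀ i, R i ≠ 0) (hRt : ∀ i, R i ≠ ∞) :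
    IsOutputNorm E (quasiConst R * quasiConst P) (pairNorm ν P R) where
  measurable _ hf := measurable_pairNorm ν P R hf
  mono _ _ h := pairNorm_mono ν P R h
  zero := by
    rw [pairNorm, vvMixedNorm]
    simp_rw [mixedNorm_zero]
  max_le _ _ hu _ := pairNorm_max_le ν hP0 hPt hR0 hRt hu

end Norms

end VVMaximal


/-! ### Induction over the inner and the Euclidean variables -/

namespace VVMaximal

theorem measurable_uncurry_cons {E : Type*} [MeasurableSpace E] {m : ℕ} {W : Fin (m + 1) → Type*}
    [∀ i, MeasurableSpace (W i)] {F : E → (∀ i, W i) → ℝ≥0∞}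
    (hF : Measurable (Function.uncurry F)) :
    Measurable (Function.uncurry fun (z : E × W 0) (b : ∀ i : Fin m, W i.succ) =>
      F z.1 (Fin.cons z.2 b)) :=
  hF.comp ((measurable_fst.comp measurable_fst).prodMk
    (measurable_finCons.comp ((measurable_snd.comp measurable_fst).prodMk measurable_snd)))

theorem measurable_uncurry_cons_pair {E Ω : Type*} [MeasurableSpace E] [MeasurableSpace Ω] {k : ℕ}
    {F : E → (Fin (k + 1) → ℝ) × Ω → ℝ≥0∞} (hF : Measurable (Function.uncurry F)) :
    Measurable (Function.uncurry fun (q : E × ℝ) (z : (Fin k → ℝ) × Ω) =>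
      F q.1 (Fin.cons q.2 z.1, z.2)) := by
  have hcons : Measurable fun q : ℝ × (Fin k → ℝ) => (Fin.cons q.1 q.2 : Fin (k + 1) → ℝ) :=
    measurable_finCons (α := fun _ => ℝ)
  exact hF.comp ((measurable_fst.comp measurable_fst).prodMk
    ((hcons.comp ((measurable_snd.comp measurable_fst).prodMk
      (measurable_fst.comp measurable_snd))).prodMk (measurable_snd.comp measurable_snd)))

theorem measurable_section_pair {E Y Ω : Type*} [MeasurableSpace E] [MeasurableSpace Y]
    [MeasurableSpace Ω] {F : E → Y × Ω → ℝ≥0∞} (hF : Measurable (Function.uncurry F)) (x : E)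
    (w : Ω) : Measurable fun y => F x (y, w) :=
  hF.comp (measurable_const.prodMk (measurable_id.prodMk measurable_const))

theorem measurable_rearrange {E Y Ω : Type*} [MeasurableSpace E] [MeasurableSpace Y]
    [MeasurableSpace Ω] {H : E × Ω → Y → ℝ≥0∞} (hH : Measurable fun z : (E × Ω) × Y => H z.1 z.2) :
    Measurable fun z : E × (Y × Ω) => H (z.1, z.2.2) z.2.1 :=
  hH.comp ((measurable_fst.prodMk (measurable_snd.comp measurable_snd)).prodMk
    (measurable_fst.comp measurable_snd))

section InnerVariables

variable {n : ℕ} {θ : Fin n → ℝ}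

/-- The pointwise product of powers. -/
noncomputable def prodPow {Ω : Type u} (θ : Fin n → ℝ) (u : Fin n → Ω → ℝ≥0∞) (ω : Ω) : ℝ≥0∞ :=
  ∏ j, u j ω ^ θ j

theorem measurable_prodPow {Ω : Type u} [MeasurableSpace Ω] {E : Type} [MeasurableSpace E]
    {f : Fin n → E → Ω → ℝ≥0∞} (hf : ∀ j, Measurable (Function.uncurry (f j))) :
    Measurable (Function.uncurry fun x => prodPow θ (fun j => f j x)) := by
  change Measurable fun z : E × Ω => ∏ j, Function.uncurry (f j) z ^ θ j
  exact Finset.measurable_prod _ fun j _ => (hf j).pow_const _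

/-- Induction on `m`. Give `E` the exponents of the outermost variable of `𝒲`; the norms over `E`
and over that variable can then be exchanged. For a fixed value of the variable the induction
hypothesis applies, Hölder's inequality integrates the result, and extrapolation restores the
exponents `p`, `p'`. Without inner variables, the operator is at most the product of scalar maximal
functions. -/
theorem exists_maxBound_inner (hθ : ∀ j, 0 < θ j) {m : ℕ} {R : Fin n → Fin m → ℝ≥0∞}
    {R' : Fin m → ℝ≥0∞} (hR : AdmissibleTuple θ R R') {p : Fin n → ℝ≥0∞} {p' : ℝ≥0∞}
    (hp : Admissible θ p p') (D : ℝ≥0) :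
    ∃ C : ℝ≥0, ∀ {E : Type} [MeasurableSpace E] {μ : Measure E} [SFinite μ] {ι : Type}
      [Countable ι] (𝒟 : Grid E μ ι D) (W : Fin m → Type u) [∀ i, MeasurableSpace (W i)]
      (ν : ∀ i, Measure (W i)) [∀ i, SigmaFinite (ν i)],
      𝒟.MaxBound (fun _ => prodPow θ) (fun j => mixedNorm (R j) ν) (mixedNorm R' ν) θ p p' C := by
  induction m generalizing p p' with
  | zero =>
    refine ⟨∏ j, doobConst (p j) ^ θ j, ?_⟩
    intro E _ μ _ ι _ 𝒟 W _ ν _ I f hf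
    set w : ∀ i, W i := fun i => i.elim0 with hw
    have hF : ∀ j, Measurable fun x => f j x w := fun j => (hf j).of_uncurry_right
    have h := 𝒟.eLpNorm_prod_iSup_avg_le hθ hp hF I
    refine le_trans (eLpNorm_mono_ae' (.of_forall fun x => ?_)) (h.trans (le_of_eq ?_))
    · change 𝒟.maxOp (fun _ => prodPow θ) (Set.Ico 0 I) f x w ≤ _
      refine iSup₂_le fun i hi => Finset.prod_le_prod' fun j _ => ?_
      refine ENNReal.rpow_le_rpow ?_ (hθ j).le
      exact le_iSup₂ (f := fun i (_ : i ∈ Set.Ico 0 I) => 𝒟.avg i (fun z => f j z w) x) i hi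
    · rw [ENNReal.ofNNReal_finsetProd]
      congr 1
      refine Finset.prod_congr rfl fun j _ => ?_
      rw [ENNReal.coe_rpow_of_nonneg _ (hθ j).le]
  | succ m ih =>
    have h0 := hR 0
    -- The induction hypothesis is used with the exponents of the variable `W 0` on `E`; it holds
    -- for all admissible tuples there.
    obtain ⟨C, hC⟩ := ih (R := fun j i => R j i.succ) (R' := fun i => R' i.succ)
      (fun i => hR i.succ) h0
    obtain ⟨C', hC'⟩ := exists_extrapolation.{u} hθ h0 hp D (quasiConst R') C (one_le_quasiConst R')
    refine ⟨C', ?_⟩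
    intro E _ μ _ ι _ 𝒟 W _ ν _
    refine hC' 𝒟 (fun _ => prodPow θ) (fun _ f hf => measurable_prodPow hf)
      (fun j => mixedNorm (R j) ν)
      (fun j => isInputNorm_mixedNorm ν μ fun i => ((hR i).one_lt j).le) (mixedNorm R' ν)
      (isOutputNorm_mixedNorm ν (fun i => (hR i).ne_zero) (fun i => (hR i).ne_top)) ?_
    intro I f hf
    set g : W 0 → Fin n → E → (∀ i : Fin m, W i.succ) → ℝ≥0∞ :=
      fun a j x b => f j x (Fin.cons a b) with hg
    have hgm : ∀ a j, Measurable (Function.uncurry (g a j)) := fun a j =>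
      (measurable_uncurry_cons (hf j)).comp
        ((measurable_fst.prodMk measurable_const).prodMk measurable_snd)
    have hin : ∀ j, Measurable (Function.uncurry fun (x : E) (a : W 0) =>
        mixedNorm (fun i => R j i.succ) (fun i => ν i.succ) (g a j x)) := fun j =>
      measurable_mixedNorm _ _ (X := E × W 0) (F := fun z b => f j z.1 (Fin.cons z.2 b))
        (measurable_uncurry_cons (hf j))
    have hMm := 𝒟.measurable_maxOp (A := fun _ => prodPow θ)
      (fun _ f hf => measurable_prodPow hf) (Set.Ico 0 I) hf
    have hout : Measurable (Function.uncurry fun (x : E) (a : W 0) =>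
        mixedNorm (fun i => R' i.succ) (fun i => ν i.succ)
          (fun b => 𝒟.maxOp (fun _ => prodPow θ) (Set.Ico 0 I) f x (Fin.cons a b))) :=
      measurable_mixedNorm _ _ (X := E × W 0)
        (F := fun z b => 𝒟.maxOp (fun _ => prodPow θ) (Set.Ico 0 I) f z.1 (Fin.cons z.2 b))
        (measurable_uncurry_cons hMm)
    simp_rw [mixedNorm_succ]
    rw [eLpNorm_eLpNorm_swap hout]
    have hstep : ∀ a, eLpNorm (fun x => mixedNorm (fun i => R' i.succ) (fun i => ν i.succ)
          (fun b => 𝒟.maxOp (fun _ => prodPow θ) (Set.Ico 0 I) f x (Fin.cons a b))) (R' 0) μ ≤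
        C * ∏ j, eLpNorm (fun x => mixedNorm (fun i => R j i.succ) (fun i => ν i.succ) (g a j x))
          (R j 0) μ ^ θ j := fun a =>
      hC 𝒟 (fun i => W i.succ) (fun i => ν i.succ) I (g a) (hgm a)
    refine (eLpNorm_mono_ae' (.of_forall hstep)).trans ?_
    rw [eLpNorm_const_mul' ENNReal.coe_ne_top]
    refine mul_le_mul_right ((eLpNorm_prod_rpow_le hθ
      (fun j => (zero_lt_one.trans (h0.one_lt j)).ne') h0.ne_zero h0.ne_top h0.sum_eq
      fun j => ?_).trans (le_of_eq ?_)) _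
    · exact measurable_eLpNorm_right (f := fun a x => mixedNorm (fun i => R j i.succ)
        (fun i => ν i.succ) (g a j x)) ((hin j).comp measurable_swap) _
    · refine Finset.prod_congr rfl fun j _ => ?_
      rw [← eLpNorm_eLpNorm_swap (hin j)]

end InnerVariables

section OuterVariables

variable {n : ℕ} {θ : Fin n → ℝ} {k : ℕ}

/-- The product of powers of averages over the dyadic cubes of generation `i` in the variables
in `ℝ^k`. -/
noncomputable def cubeOp {Ω : Type u} (θ : Fin n → ℝ) (t : Fin k → ℝ) (L : ℝ) (i : ℕ)
    (u : Fin n → (Fin k → ℝ) × Ω → ℝ≥0∞) (z : (Fin k → ℝ) × Ω) : ℝ≥0∞ :=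
  ∏ j, piAvg t L i (fun y => u j (y, z.2)) z.1 ^ θ j

theorem measurable_cubeOp {Ω : Type u} [MeasurableSpace Ω] {E : Type} [MeasurableSpace E]
    (t : Fin k → ℝ) {L : ℝ} (hL : 0 < L) (i : ℕ) {f : Fin n → E → (Fin k → ℝ) × Ω → ℝ≥0∞}
    (hf : ∀ j, Measurable (Function.uncurry (f j))) :
    Measurable (Function.uncurry fun x => cubeOp θ t L i (fun j => f j x)) := by
  change Measurable fun z : E × ((Fin k → ℝ) × Ω) =>
    ∏ j, piAvg t L i (fun y => f j z.1 (y, z.2.2)) z.2.1 ^ θ j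
  refine Finset.measurable_prod _ fun j _ => Measurable.pow_const ?_ _
  have h1 : Measurable (Function.uncurry fun (z : E × Ω) (y : Fin k → ℝ) => f j z.1 (y, z.2)) :=
    (hf j).comp ((measurable_fst.comp measurable_fst).prodMk
      (measurable_snd.prodMk (measurable_snd.comp measurable_fst)))
  exact measurable_rearrange
    (H := fun (z : E × Ω) (y : Fin k → ℝ) => piAvg t L i (fun y => f j z.1 (y, z.2)) y)
    (measurable_piAvg t hL i h1)

/-- Averaging over the cells of `E × ℝ`, then over cubes in `ℝ^k`, is averaging over the cells of
`E`, then over cubes in `ℝ^(k+1)`. -/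
theorem piAvg_vavg_cons {E : Type} [MeasurableSpace E] {μ : Measure E} [SFinite μ] {ι : Type}
    [Countable ι] {D : ℝ≥0} (𝒟 : Grid E μ ι D) {Ω : Type u} [MeasurableSpace Ω]
    (t : Fin (k + 1) → ℝ) {L : ℝ} (hL : 0 < L) (i : ℕ) {f : E → (Fin (k + 1) → ℝ) × Ω → ℝ≥0∞}
    (hf : Measurable (Function.uncurry f)) (x : E) (a : ℝ) (y : Fin k → ℝ) (w : Ω) :
    piAvg t L i (fun z => 𝒟.vavg i f x (z, w)) (Fin.cons a y) =
      piAvg (fun c => t c.succ) L i (fun z => (𝒟.prod (realGrid (t 0) hL)).vavg i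
        (fun (q : E × ℝ) (z : (Fin k → ℝ) × Ω) => f q.1 (Fin.cons q.2 z.1, z.2)) (x, a) (z, w))
        y := by
  have hv := 𝒟.measurable_vavg i hf
  have hm : Measurable fun z => 𝒟.vavg i f x (z, w) := measurable_section_pair hv x w
  rw [piAvg_succ t hL i hm,
    ← piAvg_avg_comm (realGrid (t 0) hL) _ hL i (measurable_cons_left (α := fun _ => ℝ) hm)]
  congr 1
  funext z
  simp only [Grid.vavg]
  rw [Grid.avg_prod]
  exact (measurable_uncurry_cons_pair hf).comp
    (measurable_id.prodMk (measurable_const (a := ((z, w) : (Fin k → ℝ) × Ω))))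

/-- Induction on `k`. If `E` carries the exponents of the first Euclidean coordinate, Tonelli merges
the two norms into one over `E × ℝ`. The averages merge too, into averages over the product grid,
since cells of `E` and cubes are taken from the same generation. The hypothesis for `k` variables
applies over `E × ℝ`, and extrapolation on `E` then changes the exponents. -/
theorem exists_maxBound (hθ : ∀ j, 0 < θ j) {m : ℕ} {R : Fin n → Fin m → ℝ≥0∞}
    {R' : Fin m → ℝ≥0∞} (hR : AdmissibleTuple θ R R') {P : Fin n → Fin k → ℝ≥0∞}
    {P' : Fin k → ℝ≥0∞} (hP : AdmissibleTuple θ P P') {p : Fin n → ℝ≥0∞} {p' : ℝ≥0∞}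
    (hp : Admissible θ p p') (D : ℝ≥0) :
    ∃ C : ℝ≥0, ∀ {E : Type} [MeasurableSpace E] {μ : Measure E} [SFinite μ] {ι : Type}
      [Countable ι] (𝒟 : Grid E μ ι D) (W : Fin m → Type u) [∀ i, MeasurableSpace (W i)]
      (ν : ∀ i, Measure (W i)) [∀ i, SigmaFinite (ν i)] (t : Fin k → ℝ) (L : ℝ), 0 < L →
      𝒟.MaxBound (cubeOp θ t L) (fun j => pairNorm ν (P j) (R j)) (pairNorm ν P' R') θ p p' C := by
  induction k generalizing p p' D with
  | zero =>
    obtain ⟨C, hC⟩ := exists_maxBound_inner.{u} hθ hR hp D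
    refine ⟨C, ?_⟩
    intro E _ μ _ ι _ 𝒟 W _ ν _ t L hL I f hf
    have h := hC 𝒟 W ν I (fun j x w => f j x (fun i => i.elim0, w)) fun j =>
      (hf j).comp (measurable_fst.prodMk (measurable_const.prodMk measurable_snd))
    refine le_trans (le_of_eq ?_) h
    congr 1
    funext x
    change mixedNorm R' ν _ = _
    congr 1
    funext w
    refine iSup_congr fun i => iSup_congr fun _ => ?_
    refine Finset.prod_congr rfl fun j _ => ?_
    rw [piAvg_zero_dim]
    rfl
  | succ k ih =>
    have h0 := hP 0
    -- The dyadic grid on the line has doubling constant `2`, so the product grid has constant `D *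
    -- 2`; hence the induction varies `D`.
    obtain ⟨C, hC⟩ := ih (P := fun j i => P j i.succ) (P' := fun i => P' i.succ)
      (fun i => hP i.succ) h0 (D * 2)
    obtain ⟨C', hC'⟩ := exists_extrapolation.{u} hθ h0 hp D (quasiConst R' * quasiConst P') C
      (one_le_mul (one_le_quasiConst R') (one_le_quasiConst P'))
    refine ⟨C', ?_⟩
    intro E _ μ _ ι _ 𝒟 W _ ν _ t L hL
    have hA := fun (i : ℕ) (f : Fin n → E → (Fin (k + 1) → ℝ) × (∀ i, W i) → ℝ≥0∞)
      (hf : ∀ j, Measurable (Function.uncurry (f j))) => measurable_cubeOp (θ := θ) t hL i hf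
    refine hC' 𝒟 (cubeOp θ t L) hA
      (fun j => pairNorm ν (P j) (R j))
      (fun j => isInputNorm_pairNorm ν μ (fun i => ((hP i).one_lt j).le)
        fun i => ((hR i).one_lt j).le)
      (pairNorm ν P' R')
      (isOutputNorm_pairNorm ν (fun i => (hP i).ne_zero) (fun i => (hP i).ne_top)
        (fun i => (hR i).ne_zero) (fun i => (hR i).ne_top)) ?_
    intro I f hf
    set g : Fin n → E × ℝ → (Fin k → ℝ) × (∀ i, W i) → ℝ≥0∞ :=
      fun j q z => f j q.1 (Fin.cons q.2 z.1, z.2) with hg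
    have hgm : ∀ j, Measurable (Function.uncurry (g j)) := fun j =>
      measurable_uncurry_cons_pair (hf j)
    set 𝒟₁ := 𝒟.prod (realGrid (t 0) hL) with h𝒟₁
    set t₁ : Fin k → ℝ := fun c => t c.succ with ht₁
    have hmax : ∀ (q : E × ℝ) (z : (Fin k → ℝ) × (∀ i, W i)),
        𝒟.maxOp (cubeOp θ t L) (Set.Ico 0 I) f q.1 (Fin.cons q.2 z.1, z.2) =
          𝒟₁.maxOp (cubeOp θ t₁ L) (Set.Ico 0 I) g q z := by
      intro q z
      refine iSup_congr fun i => iSup_congr fun _ => ?_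
      refine Finset.prod_congr rfl fun j _ => ?_
      congr 1
      exact piAvg_vavg_cons 𝒟 t hL i (hf j) q.1 q.2 z.1 z.2
    have hnorm : ∀ (Q : Fin (k + 1) → ℝ≥0∞) (S : Fin m → ℝ≥0∞)
        (h : E → (Fin (k + 1) → ℝ) × (∀ i, W i) → ℝ≥0∞), Measurable (Function.uncurry h) →
        eLpNorm (fun x => pairNorm ν Q S (h x)) (Q 0) μ =
          eLpNorm (fun q : E × ℝ => pairNorm ν (fun i => Q i.succ) S
            (fun z => h q.1 (Fin.cons q.2 z.1, z.2))) (Q 0) (μ.prod volume) := by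
      intro Q S h hh
      have hm : Measurable (Function.uncurry fun (x : E) (a : ℝ) =>
          pairNorm ν (fun i => Q i.succ) S (fun z => h x (Fin.cons a z.1, z.2))) :=
        measurable_pairNorm ν _ S (X := E × ℝ)
          (f := fun q z => h q.1 (Fin.cons q.2 z.1, z.2)) (measurable_uncurry_cons_pair hh)
      exact eLpNorm_eLpNorm hm (Q 0)
    rw [hnorm P' R' _ (𝒟.measurable_maxOp hA _ hf)]
    simp_rw [hmax]
    refine (hC 𝒟₁ W ν t₁ L hL I g hgm).trans (le_of_eq ?_)
    congr 1
    refine Finset.prod_congr rfl fun j _ => ?_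
    rw [hnorm (P j) (R j) (f j) (hf j)]

/-- Boundedness of the dyadic maximal operator on `ℝ^d × 𝒲`. -/
theorem exists_dyadic_bound (hθ : ∀ j, 0 < θ j) {m : ℕ} {R : Fin n → Fin m → ℝ≥0∞}
    {R' : Fin m → ℝ≥0∞} (hR : AdmissibleTuple θ R R') {P : Fin n → Fin k → ℝ≥0∞}
    {P' : Fin k → ℝ≥0∞} (hP : AdmissibleTuple θ P P') (hk : 1 ≤ k) :
    ∃ C : ℝ≥0, ∀ (W : Fin m → Type u) [∀ i, MeasurableSpace (W i)]
      (ν : ∀ i, Measure (W i)) [∀ i, SigmaFinite (ν i)] (t : Fin k → ℝ) (L : ℝ), 0 < L →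
      ∀ (I : ℕ) (f : Fin n → (Fin k → ℝ) × (∀ i, W i) → ℝ≥0∞), (∀ j, Measurable (f j)) →
        pairNorm ν P' R' (fun z => ⨆ i ∈ Set.Ico 0 I, cubeOp θ t L i f z) ≤
          C * ∏ j, pairNorm ν (P j) (R j) (f j) ^ θ j := by
  -- Over a single point every norm is the value itself, so any admissible exponents serve; `hk`
  -- provides those of the first coordinate.
  obtain ⟨C, hC⟩ := exists_maxBound.{u} hθ hR hP (hP ⟨0, hk⟩) 1
  refine ⟨C, ?_⟩
  intro W _ ν _ t L hL I f hf
  have h := hC unitGrid W ν t L hL I (fun j _ z => f j z) fun j => (hf j).comp measurable_snd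
  have hconst : ∀ {p : ℝ≥0∞}, p ≠ 0 → ∀ a : ℝ≥0∞,
      eLpNorm (fun _ : Unit => a) p (Measure.dirac ()) = a := by
    intro p hp a
    rcases eq_or_ne p ∞ with rfl | ht
    · rw [eLpNorm_top_eq, essSup_const]
      exact Measure.dirac_ne_zero
    · have hp' := ENNReal.toReal_pos hp ht
      rw [eLpNorm_eq hp ht, lintegral_const, measure_univ, mul_one, ← ENNReal.rpow_mul,
        mul_one_div_cancel hp'.ne', ENNReal.rpow_one]
  have hv : ∀ j i, unitGrid.vavg i (fun (_ : Unit) z => f j z) = fun _ z => f j z := by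
    intro j i
    funext x z
    exact unitGrid_avg i _ x
  refine (le_of_eq (hconst (hP ⟨0, hk⟩).ne_zero _).symm).trans
    (le_trans (le_of_eq ?_) (h.trans (le_of_eq ?_)))
  · congr 1
    funext x
    congr 1
    funext z
    refine iSup_congr fun i => iSup_congr fun _ => ?_
    refine Finset.prod_congr rfl fun j _ => ?_
    change _ = piAvg t L i (fun y => unitGrid.vavg i (fun _ z => f j z) x (y, z.2)) z.1 ^ θ j
    rw [hv]
  · congr 1
    refine Finset.prod_congr rfl fun j _ => ?_
    congr 1
    exact hconst (zero_lt_one.trans ((hP ⟨0, hk⟩).one_lt _)).ne' _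

end OuterVariables

end VVMaximal


/-! ### Cubes, weights, and measurability of the maximal function -/

namespace VVMaximal

section Cubes

variable {d n : ℕ}

theorem mem_cube {a x : Fin d → ℝ} {l : ℝ} : x ∈ cube a l ↔ ∀ i, a i < x i ∧ x i < a i + l := by
  simp [cube, Set.mem_pi]

theorem measurableSet_cube (a : Fin d → ℝ) (l : ℝ) : MeasurableSet (cube a l) :=
  MeasurableSet.univ_pi fun _ => measurableSet_Ioo

theorem volume_cube (a : Fin d → ℝ) (l : ℝ) : volume (cube a l) = ENNReal.ofReal l ^ d := by
  rw [cube, volume_pi_pi]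
  simp

theorem volume_cube_ne_zero (a : Fin d → ℝ) {l : ℝ} (hl : 0 < l) : volume (cube a l) ≠ 0 := by
  rw [volume_cube]
  exact pow_ne_zero _ (by simpa using hl)

theorem volume_cube_ne_top (a : Fin d → ℝ) (l : ℝ) : volume (cube a l) ≠ ∞ := by
  rw [volume_cube]
  exact ENNReal.pow_ne_top ENNReal.ofReal_ne_top

/-- The average of `g` with respect to the weight `χ` adapted to a cube. -/
noncomputable def cubeAvg (χ : (Fin d → ℝ) → ℝ → (Fin d → ℝ) → ℝ≥0∞) (a : Fin d → ℝ) (l : ℝ)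
    (g : (Fin d → ℝ) → ℝ≥0∞) : ℝ≥0∞ :=
  (volume (cube a l))⁻¹ * ∫⁻ y, g y * χ a l y

/-- The contribution of one cube to the maximal function. -/
noncomputable def cubeTerm (χ : (Fin d → ℝ) → ℝ → (Fin d → ℝ) → ℝ≥0∞) (θ : Fin n → ℝ)
    (a : Fin d → ℝ) (l : ℝ) (g : Fin n → (Fin d → ℝ) → ℝ≥0∞) (x : Fin d → ℝ) : ℝ≥0∞ :=
  (cube a l).indicator (fun _ => ∏ j, cubeAvg χ a l (g j) ^ θ j) x

/-- The maximal function of a tuple of nonnegative functions. -/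
noncomputable def cubeMax (χ : (Fin d → ℝ) → ℝ → (Fin d → ℝ) → ℝ≥0∞) (θ : Fin n → ℝ)
    (g : Fin n → (Fin d → ℝ) → ℝ≥0∞) (x : Fin d → ℝ) : ℝ≥0∞ :=
  ⨆ (a : Fin d → ℝ) (l : ℝ) (_ : 0 < l), cubeTerm χ θ a l g x

theorem multiMaximal_eq (χ : (Fin d → ℝ) → ℝ → (Fin d → ℝ) → ℝ≥0∞) (s : Fin n → ℝ)
    (f : Fin n → (Fin d → ℝ) → ℂ) (x : Fin d → ℝ) :
    multiMaximal χ s f x = cubeMax χ (fun j => 1 / s j) (fun j y => ‖f j y‖ₑ ^ s j) x := by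
  refine iSup_congr fun a => iSup_congr fun l => iSup_congr fun _ => ?_
  by_cases hx : x ∈ cube a l
  · simp [cubeTerm, hx, cubeAvg]
  · simp [cubeTerm, hx]

/-- Weights that increase with the cube. -/
structure IsCubeWeight (χ : (Fin d → ℝ) → ℝ → (Fin d → ℝ) → ℝ≥0∞) : Prop where
  measurable : ∀ a l, Measurable (χ a l)
  mono : ∀ a l a' l', 0 < l → l ≤ l' → cube a l ⊆ cube a' l' → ∀ y, χ a l y ≤ χ a' l' y

theorem isCubeWeight_sharpWeight : IsCubeWeight (sharpWeight (d := d)) where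
  measurable a l := measurable_one.indicator (measurableSet_cube a l)
  mono _ _ _ _ _ _ h y := Set.indicator_le_indicator_of_subset h (fun _ => zero_le) y

theorem cube_nonempty (a : Fin d → ℝ) {l : ℝ} (hl : 0 < l) : (cube a l).Nonempty :=
  ⟨fun i => a i + l / 2, mem_cube.2 fun i => ⟨by linarith, by linarith⟩⟩

theorem isCubeWeight_bumpWeight {M : ℝ} (hM : 0 ≤ M) : IsCubeWeight (bumpWeight (d := d) M) where
  measurable a l := by
    refine ENNReal.measurable_ofReal.comp (Measurable.pow_const ?_ _)
    exact measurable_const.add ((Metric.continuous_infDist_pt _).measurable.div_const l)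
  mono a l a' l' hl hll h y := by
    refine ENNReal.ofReal_le_ofReal (Real.rpow_le_rpow_of_nonpos ?_ ?_ (by linarith))
    · have := div_nonneg (Metric.infDist_nonneg (x := y) (s := cube a' l')) (hl.le.trans hll)
      linarith
    · gcongr
      · exact Metric.infDist_nonneg
      · exact Metric.infDist_le_infDist_of_subset h (cube_nonempty a hl)

theorem exists_rat_cube (a : Fin d → ℝ) {l c : ℝ} (hl : 0 < l) (hc : 1 < c) :
    ∃ (b : Fin d → ℚ) (r : ℚ), l ≤ r ∧ (r : ℝ) ≤ c * l ∧ cube a l ⊆ cube (fun i => (b i : ℝ)) r := by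
  -- Half of the slack `(c - 1) * l` is spent on moving the lower corner down; the side length grows
  -- by more than that half, so the opposite faces are still covered.
  have hε : 0 < (c - 1) * l / 2 := by
    have : 0 < (c - 1) * l := mul_pos (by linarith) hl
    linarith
  choose b hb1 hb2 using fun i => exists_rat_btwn (show a i - (c - 1) * l / 2 < a i by linarith)
  obtain ⟨r, hr1, hr2⟩ := exists_rat_btwn (show l + (c - 1) * l / 2 < c * l by linarith)
  refine ⟨b, r, by linarith, hr2.le, fun x hx => ?_⟩
  rw [mem_cube] at hx ⊢
  intro i
  have := hx i
  have := hb1 i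
  have := hb2 i
  constructor <;> linarith

theorem inv_volume_cube_le {a a' : Fin d → ℝ} {l l' c : ℝ} (hl : 0 < l) (hl' : 0 < l')
    (hc : l' ≤ c * l) :
    (volume (cube a l))⁻¹ ≤ ENNReal.ofReal c ^ d * (volume (cube a' l'))⁻¹ := by
  have hc0 : 0 ≤ c := by
    by_contra! hneg
    have := mul_neg_of_neg_of_pos hneg hl
    linarith
  rw [← div_eq_mul_inv, ENNReal.le_div_iff_mul_le (Or.inl (volume_cube_ne_zero _ hl'))
    (Or.inl (volume_cube_ne_top _ _)), mul_comm, ← div_eq_mul_inv]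
  refine ENNReal.div_le_of_le_mul ?_
  rw [volume_cube, volume_cube, ← mul_pow, ← ENNReal.ofReal_mul hc0]
  gcongr

theorem cubeAvg_le {χ : (Fin d → ℝ) → ℝ → (Fin d → ℝ) → ℝ≥0∞} (hχ : IsCubeWeight χ)
    {a a' : Fin d → ℝ} {l l' c : ℝ} (hl : 0 < l) (hll : l ≤ l') (hc : l' ≤ c * l)
    (h : cube a l ⊆ cube a' l') (g : (Fin d → ℝ) → ℝ≥0∞) :
    cubeAvg χ a l g ≤ ENNReal.ofReal c ^ d * cubeAvg χ a' l' g := by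
  rw [cubeAvg, cubeAvg, ← mul_assoc]
  refine mul_le_mul' (inv_volume_cube_le hl (hl.trans_le hll) hc) (lintegral_mono fun y => ?_)
  exact mul_le_mul_right (hχ.mono a l a' l' hl hll h y) _

/-- Only cubes with rational corners and side lengths matter. -/
theorem cubeMax_eq_iSup_rat {χ : (Fin d → ℝ) → ℝ → (Fin d → ℝ) → ℝ≥0∞} (hχ : IsCubeWeight χ)
    {θ : Fin n → ℝ} (hθ : ∀ j, 0 < θ j) (g : Fin n → (Fin d → ℝ) → ℝ≥0∞) (x : Fin d → ℝ) :
    cubeMax χ θ g x = ⨆ q : {q : (Fin d → ℚ) × ℚ // 0 < q.2},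
      cubeTerm χ θ (fun i => (q.1.1 i : ℝ)) q.1.2 g x := by
  refine le_antisymm (iSup_le fun a => iSup_le fun l => iSup_le fun hl => ?_)
    (iSup_le fun q => ?_)
  · set S := ⨆ q : {q : (Fin d → ℚ) × ℚ // 0 < q.2},
      cubeTerm χ θ (fun i => (q.1.1 i : ℝ)) q.1.2 g x
    by_cases hx : x ∈ cube a l
    swap
    · simp [cubeTerm, hx]
    -- Rounding a cube up to a rational one costs a power of `c`; letting `c` decrease to `1`
    -- removes the loss and leaves an exact equality.
    have key : ∀ c : ℝ, 1 < c → cubeTerm χ θ a l g x ≤ (∏ j, (ENNReal.ofReal c ^ d) ^ θ j) * S := by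
      intro c hc
      obtain ⟨b, r, hr1, hr2, hsub⟩ := exists_rat_cube a hl hc
      have hr0 : 0 < r := by exact_mod_cast hl.trans_le hr1
      have h1 : cubeTerm χ θ (fun i => (b i : ℝ)) r g x ≤ S :=
        le_iSup (fun q : {q : (Fin d → ℚ) × ℚ // 0 < q.2} =>
          cubeTerm χ θ (fun i => (q.1.1 i : ℝ)) q.1.2 g x) ⟨(b, r), hr0⟩
      refine le_trans ?_ (mul_le_mul_right h1 _)
      rw [cubeTerm, cubeTerm, Set.indicator_of_mem hx, Set.indicator_of_mem (hsub hx),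
        ← Finset.prod_mul_distrib]
      refine Finset.prod_le_prod' fun j _ => ?_
      rw [← ENNReal.mul_rpow_of_nonneg _ _ (hθ j).le]
      exact ENNReal.rpow_le_rpow (cubeAvg_le hχ hl hr1 hr2 hsub _) (hθ j).le
    have hlim : Filter.Tendsto (fun c : ℝ => (∏ j, (ENNReal.ofReal c ^ d) ^ θ j) * S)
        (nhdsWithin 1 (Set.Ioi 1)) (nhds ((∏ j : Fin n, (ENNReal.ofReal 1 ^ d) ^ θ j) * S)) := by
      refine ENNReal.Tendsto.mul_const ?_ (Or.inl (by simp))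
      refine tendsto_nhdsWithin_of_tendsto_nhds ?_
      have hfin : ∀ j ∈ Finset.univ, (ENNReal.ofReal 1 ^ d) ^ θ j ≠ ∞ := by simp
      have hj : ∀ j : Fin n, Filter.Tendsto (fun c : ℝ => (ENNReal.ofReal c ^ d) ^ θ j) (nhds 1)
          (nhds ((ENNReal.ofReal 1 ^ d) ^ θ j)) := fun j =>
        ((ENNReal.continuous_rpow_const.comp ((ENNReal.continuous_pow d).comp
          ENNReal.continuous_ofReal)).tendsto 1)
      refine ENNReal.tendsto_finsetProd_of_ne_top _ (fun j _ => hj j) hfin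
    have h1 : (∏ j : Fin n, (ENNReal.ofReal 1 ^ d) ^ θ j) * S = S := by simp
    rw [h1] at hlim
    exact ge_of_tendsto hlim (Filter.eventually_of_mem self_mem_nhdsWithin key)
  · have h0 : (0 : ℝ) < q.1.2 := by exact_mod_cast q.2
    exact le_iSup_of_le (fun i => (q.1.1 i : ℝ)) (le_iSup_of_le (q.1.2 : ℝ)
      (le_iSup_of_le h0 le_rfl))

theorem measurable_cubeTerm {Ω : Type*} [MeasurableSpace Ω]
    {χ : (Fin d → ℝ) → ℝ → (Fin d → ℝ) → ℝ≥0∞} (hχ : IsCubeWeight χ)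
    (θ : Fin n → ℝ) (a : Fin d → ℝ) (l : ℝ) {g : Fin n → (Fin d → ℝ) × Ω → ℝ≥0∞}
    (hg : ∀ j, Measurable (g j)) :
    Measurable fun z : (Fin d → ℝ) × Ω => cubeTerm χ θ a l (fun j y => g j (y, z.2)) z.1 := by
  have h1 : Measurable fun z : (Fin d → ℝ) × Ω =>
      ∏ j, cubeAvg χ a l (fun y => g j (y, z.2)) ^ θ j := by
    refine Finset.measurable_prod _ fun j _ => Measurable.pow_const (Measurable.const_mul ?_ _) _
    refine Measurable.lintegral_prod_right' (f := fun q : ((Fin d → ℝ) × Ω) × (Fin d → ℝ) =>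
      g j (q.2, q.1.2) * χ a l q.2) ?_
    exact ((hg j).comp (measurable_snd.prodMk (measurable_snd.comp measurable_fst))).mul
      ((hχ.measurable a l).comp measurable_snd)
  have h2 := h1.indicator (measurable_fst (measurableSet_cube a l) :
    MeasurableSet (Prod.fst ⁻¹' cube a l : Set ((Fin d → ℝ) × Ω)))
  exact h2

theorem measurable_cubeMax {Ω : Type*} [MeasurableSpace Ω]
    {χ : (Fin d → ℝ) → ℝ → (Fin d → ℝ) → ℝ≥0∞} (hχ : IsCubeWeight χ)
    {θ : Fin n → ℝ} (hθ : ∀ j, 0 < θ j) {g : Fin n → (Fin d → ℝ) × Ω → ℝ≥0∞}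
    (hg : ∀ j, Measurable (g j)) :
    Measurable fun z : (Fin d → ℝ) × Ω => cubeMax χ θ (fun j y => g j (y, z.2)) z.1 := by
  simp_rw [cubeMax_eq_iSup_rat hχ hθ]
  exact Measurable.iSup fun q => measurable_cubeTerm hχ θ _ _ hg

end Cubes

end VVMaximal


/-! ### Covering cubes by cells of shifted dyadic grids -/

namespace VVMaximal

section Dyadic

variable {d n : ℕ}

/-- A short interval lies in one cell of one of two dyadic grids, shifted by a third. -/
theorem exists_shift {L : ℝ} (hL : 0 < L) (i : ℕ) (a l : ℝ) (hl : 3 * l ≤ L / 2 ^ i) :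
    ∃ b : Bool, ∀ x ∈ Set.Ioo a (a + l), ∀ y ∈ Set.Ioo a (a + l),
      dyadicIdx (cond b (L / 3) 0) L i y = dyadicIdx (cond b (L / 3) 0) L i x := by
  set δ := L / 2 ^ i with hδ
  have hδ0 : 0 < δ := by positivity
  have hLδ : L = 2 ^ i * δ := by rw [hδ]; field_simp
  -- Two points of the interval have different indices only if some endpoint of the grid lies
  -- strictly inside the interval.
  have cell : ∀ t : ℝ, (∀ c : ℤ, ¬ (a < t + c * δ ∧ t + c * δ < a + l)) →
      ∀ x ∈ Set.Ioo a (a + l), ∀ y ∈ Set.Ioo a (a + l), dyadicIdx t L i y = dyadicIdx t L i x := by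
    intro t ht x hx y hy
    have hmem : ∀ y, y ∈ Set.Ico (t + dyadicIdx t L i y * δ) (t + (dyadicIdx t L i y + 1) * δ) := by
      intro y
      rw [hδ, ← setOf_dyadicIdx_eq hL]
      rfl
    have hle : ∀ x ∈ Set.Ioo a (a + l), ∀ y ∈ Set.Ioo a (a + l),
        dyadicIdx t L i y ≤ dyadicIdx t L i x := by
      intro x hx y hy
      by_contra! hlt
      have h1 := (hmem x).2
      have h2 := (hmem y).1
      have h3 : ((dyadicIdx t L i x : ℝ) + 1) ≤ dyadicIdx t L i y := by exact_mod_cast hlt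
      have h4 := ht (dyadicIdx t L i x + 1)
      push_cast at h4
      have h5 := mul_le_mul_of_nonneg_right h3 hδ0.le
      exact h4 ⟨by linarith [hx.1], by linarith [hy.2]⟩
    exact le_antisymm (hle x hx y hy) (hle y hy x hx)
  by_contra! hcon
  have h0 : ∃ c : ℤ, a < 0 + c * δ ∧ 0 + c * δ < a + l := by
    by_contra! h
    obtain ⟨x, hx, y, hy, hne⟩ := hcon false
    exact hne (cell 0 (fun c hc => absurd hc.2 (not_lt.2 (h c hc.1))) x hx y hy)
  have h1 : ∃ c : ℤ, a < L / 3 + c * δ ∧ L / 3 + c * δ < a + l := by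
    by_contra! h
    obtain ⟨x, hx, y, hy, hne⟩ := hcon true
    exact hne (cell (L / 3) (fun c hc => absurd hc.2 (not_lt.2 (h c hc.1))) x hx y hy)
  obtain ⟨c, hc1, hc2⟩ := h0
  obtain ⟨c', hc1', hc2'⟩ := h1
  rw [hLδ] at hc1' hc2'
  -- Endpoints of both grids in one interval would be at distance less than `l ≤ δ / 3`. That
  -- distance is `δ / 3` times the absolute value of the integer `2 ^ i + 3 * (c' - c)`, which would
  -- have to be `0`, and then `3` would divide a power of `2`.
  have e1 : ((2 : ℝ) ^ i + 3 * (c' - c)) * δ < 1 * δ := by linarith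
  have e2 : (-1) * δ < ((2 : ℝ) ^ i + 3 * (c' - c)) * δ := by linarith
  have e3 := lt_of_mul_lt_mul_right e1 hδ0.le
  have e4 := lt_of_mul_lt_mul_right e2 hδ0.le
  have e5 : (2 : ℤ) ^ i + 3 * (c' - c) < 1 := by exact_mod_cast e3
  have e6 : -1 < (2 : ℤ) ^ i + 3 * (c' - c) := by exact_mod_cast e4
  have e7 : (3 : ℤ) ∣ 2 ^ i := ⟨-(c' - c), by linarith⟩
  have e8 := (Int.prime_three.dvd_of_dvd_pow e7)
  omega

/-- Take `2 ^ i ≤ 2 ^ N / l < 2 ^ (i + 1)`. The factor `3` is what the shift by a third requires,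
and `6` is twice that, from rounding to a power of `2`. -/
theorem exists_scale {N : ℕ} {l : ℝ} (hl : 0 < l) (hN : l ≤ 2 ^ N) :
    ∃ i : ℕ, 3 * l ≤ (3 * 2 ^ N) / 2 ^ i ∧ (3 * 2 ^ N : ℝ) / 2 ^ i ≤ 6 * l := by
  obtain ⟨i, h1, h2⟩ := exists_nat_pow_near (x := (2 : ℝ) ^ N / l) (y := 2)
    ((one_le_div hl).2 hN) one_lt_two
  have hp : (0 : ℝ) < 2 ^ i := by positivity
  rw [le_div_iff₀ hl] at h1
  rw [div_lt_iff₀ hl, pow_succ] at h2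
  refine ⟨i, ?_, ?_⟩
  · rw [le_div_iff₀ hp]
    linarith
  · rw [div_le_iff₀ hp]
    linarith

/-- The `2 ^ d` translations of the dyadic grid. -/
noncomputable def gridShift (L : ℝ) (b : Fin d → Bool) (c : Fin d) : ℝ := cond (b c) (L / 3) 0

theorem exists_cube_subset_piCell {L : ℝ} (hL : 0 < L) (i : ℕ) (a : Fin d → ℝ) (l : ℝ)
    (hl : 3 * l ≤ L / 2 ^ i) :
    ∃ b : Fin d → Bool, ∀ x ∈ cube a l, cube a l ⊆ piCell (gridShift L b) L i x := by
  choose b hb using fun c => exists_shift hL i (a c) l hl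
  refine ⟨b, fun x hx y hy c _ => ?_⟩
  exact hb c (x c) (hx c trivial) (y c) (hy c trivial)

theorem cubeAvg_sharp (a : Fin d → ℝ) (l : ℝ) (g : (Fin d → ℝ) → ℝ≥0∞) :
    cubeAvg sharpWeight a l g = (volume (cube a l))⁻¹ * ∫⁻ y in cube a l, g y := by
  rw [cubeAvg, ← lintegral_indicator (measurableSet_cube a l)]
  congr 2
  funext y
  by_cases hy : y ∈ cube a l <;> simp [sharpWeight, hy]

theorem cubeAvg_sharp_le_piAvg {L : ℝ} (hL : 0 < L) (i : ℕ) {a : Fin d → ℝ} {l : ℝ}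
    (hl : L / 2 ^ i ≤ 6 * l) {t x : Fin d → ℝ} (h : cube a l ⊆ piCell t L i x)
    (g : (Fin d → ℝ) → ℝ≥0∞) :
    cubeAvg sharpWeight a l g ≤ 6 ^ d * piAvg t L i g x := by
  rw [cubeAvg_sharp, piAvg, ← mul_assoc]
  refine mul_le_mul' ?_ (lintegral_mono_set h)
  rw [← div_eq_mul_inv, ENNReal.le_div_iff_mul_le (Or.inl (volume_piCell_ne_zero _ hL _ _))
    (Or.inl (volume_piCell_ne_top _ hL _ _)), mul_comm, ← div_eq_mul_inv]
  refine ENNReal.div_le_of_le_mul ?_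
  rw [volume_cube, volume_piCell t hL, ← mul_pow]
  have : (6 : ℝ≥0∞) = ENNReal.ofReal 6 := by simp
  rw [this, ← ENNReal.ofReal_mul (by norm_num)]
  gcongr

/-- Finitely many cubes are controlled by the dyadic maximal operators of `2 ^ d` grids. -/
theorem exists_cubeTerm_le {θ : Fin n → ℝ} (hθ : ∀ j, 0 < θ j) (K : ℕ)
    (a : ℕ → Fin d → ℝ) (l : ℕ → ℝ) (hl : ∀ k, 0 < l k) :
    ∃ (L : ℝ) (I : ℕ), 0 < L ∧ ∀ {Ω : Type u} (g : Fin n → (Fin d → ℝ) × Ω → ℝ≥0∞)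
      (z : (Fin d → ℝ) × Ω), ∀ k < K,
      cubeTerm sharpWeight θ (a k) (l k) (fun j y => g j (y, z.2)) z.1 ≤
        (∏ j, ((6 : ℝ≥0∞) ^ d) ^ θ j) *
          ⨆ b, ⨆ i ∈ Set.Ico 0 I, cubeOp θ (gridShift L b) L i g z := by
  -- Finitely many cubes have bounded side length, so a grid whose coarsest cells have length `3 * 2
  -- ^ N` accommodates all of them.
  obtain ⟨N, hN⟩ : ∃ N : ℕ, ∀ k < K, l k ≤ 2 ^ N := by
    have hB : ∀ k ∈ Finset.range K, l k ≤ ∑ k ∈ Finset.range K, l k := fun k hk =>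
      Finset.single_le_sum (fun k _ => (hl k).le) hk
    obtain ⟨N, hN⟩ := pow_unbounded_of_one_lt (∑ k ∈ Finset.range K, l k) (one_lt_two (α := ℝ))
    exact ⟨N, fun k hk => (hB k (Finset.mem_range.2 hk)).trans hN.le⟩
  have hL : (0 : ℝ) < 3 * 2 ^ N := by positivity
  have hi : ∀ k, ∃ i : ℕ, k < K →
      3 * l k ≤ (3 * 2 ^ N) / 2 ^ i ∧ (3 * 2 ^ N : ℝ) / 2 ^ i ≤ 6 * l k := by
    intro k
    by_cases hk : k < K
    · obtain ⟨i, hi⟩ := exists_scale (hl k) (hN k hk)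
      exact ⟨i, fun _ => hi⟩
    · exact ⟨0, fun h => absurd h hk⟩
  choose i hi using hi
  -- The `+ 1` includes the finest generation needed, since `Set.Ico` omits its right endpoint.
  refine ⟨3 * 2 ^ N, (Finset.range K).sup i + 1, hL, fun {Ω} g z k hk => ?_⟩
  by_cases hz : z.1 ∈ cube (a k) (l k)
  swap
  · simp [cubeTerm, hz]
  obtain ⟨b, hb⟩ := exists_cube_subset_piCell hL (i k) (a k) (l k) (hi k hk).1
  rw [cubeTerm, Set.indicator_of_mem hz]
  have h1 : cubeOp θ (gridShift (3 * 2 ^ N) b) (3 * 2 ^ N) (i k) g z ≤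
      ⨆ b, ⨆ i' ∈ Set.Ico 0 ((Finset.range K).sup i + 1),
        cubeOp θ (gridShift (3 * 2 ^ N) b) (3 * 2 ^ N) i' g z := by
    refine le_iSup_of_le b (le_iSup₂_of_le (i k) ⟨Nat.zero_le _, ?_⟩ le_rfl)
    exact Nat.lt_succ_of_le (Finset.le_sup (Finset.mem_range.2 hk))
  refine le_trans ?_ (mul_le_mul_right h1 _)
  rw [cubeOp, ← Finset.prod_mul_distrib]
  refine Finset.prod_le_prod' fun j _ => ?_
  rw [← ENNReal.mul_rpow_of_nonneg _ _ (hθ j).le]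
  exact ENNReal.rpow_le_rpow (cubeAvg_sharp_le_piAvg hL (i k) (hi k hk).2 (hb _ hz) _)
    (hθ j).le

end Dyadic

/-! ### Domination of bump weights by sharp cubes -/

section Bump

variable {d n : ℕ}

/-- Suprema are taken out one factor at a time, with independent indices. The case analysis in the
proof is due to `0 * ∞ = 0`. -/
theorem prod_iSup_le {ι : Type*} {n : ℕ} (x : Fin n → ι → ℝ≥0∞) [Nonempty ι] {B : ℝ≥0∞}
    (h : ∀ κ : Fin n → ι, ∏ j, x j (κ j) ≤ B) : ∏ j, ⨆ k, x j k ≤ B := by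
  induction n generalizing B with
  | zero => simpa using h (fun j => j.elim0)
  | succ n ih =>
    have aux : ∀ c : ℝ≥0∞, (∀ κ : Fin n → ι, c * ∏ j, x j.succ (κ j) ≤ B) →
        c * ∏ j, ⨆ k, x (Fin.succ j) k ≤ B := by
      intro c hc
      rcases eq_or_ne c 0 with rfl | hc0
      · simp
      -- An infinite factor with finite `B` forces all remaining products to vanish; the induction
      -- hypothesis with bound `0` then handles the product of suprema.
      rcases eq_or_ne c ∞ with rfl | hct
      · by_cases hB : B = ∞
        · simp [hB]
        have hz : ∀ κ : Fin n → ι, ∏ j, x j.succ (κ j) ≤ 0 := by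
          intro κ
          by_contra hne
          have := hc κ
          rw [ENNReal.top_mul (by simpa using hne)] at this
          exact hB (top_le_iff.1 this)
        have h0 := ih (fun j => x j.succ) hz
        rw [nonpos_iff_eq_zero] at h0
        simp [h0]
      · have := ih (fun j => x j.succ) (B := B / c) fun κ => by
          rw [ENNReal.le_div_iff_mul_le (Or.inl hc0) (Or.inl hct), mul_comm]
          exact hc κ
        rwa [ENNReal.le_div_iff_mul_le (Or.inl hc0) (Or.inl hct), mul_comm] at this
    rw [Fin.prod_univ_succ, ENNReal.iSup_mul]
    refine iSup_le fun k => aux _ fun κ => ?_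
    have := h (Fin.cons k κ)
    rwa [Fin.prod_univ_succ] at this

theorem iSup_rpow {ι : Type*} {p : ℝ} (hp : 0 < p) (x : ι → ℝ≥0∞) :
    (⨆ k, x k) ^ p = ⨆ k, x k ^ p :=
  (ENNReal.orderIsoRpow p hp).map_iSup x


/-- The cubes `Q_k` that contain a given cube `Q` and have side length `5 * 2 ^ k * ℓ(Q)`. -/
def dilate (a : Fin d → ℝ) (l : ℝ) (k : ℕ) : Set (Fin d → ℝ) :=
  cube (fun i => a i - 2 * (2 ^ k * l)) (5 * (2 ^ k * l))

theorem measurableSet_dilate (a : Fin d → ℝ) (l : ℝ) (k : ℕ) : MeasurableSet (dilate a l k) :=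
  measurableSet_cube _ _

theorem cube_subset_dilate (a : Fin d → ℝ) {l : ℝ} (hl : 0 < l) (k : ℕ) :
    cube a l ⊆ dilate a l k := by
  intro x hx
  have h1 : 1 * l ≤ 2 ^ k * l :=
    mul_le_mul_of_nonneg_right (one_le_pow₀ one_le_two) hl.le
  refine mem_cube.2 fun i => ?_
  have := mem_cube.1 hx i
  constructor <;> linarith

theorem dilate_mono (a : Fin d → ℝ) {l : ℝ} (hl : 0 < l) {k K : ℕ} (h : k ≤ K) :
    dilate a l k ⊆ dilate a l K := by
  intro x hx
  have h1 : 2 ^ k * l ≤ 2 ^ K * l :=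
    mul_le_mul_of_nonneg_right (pow_le_pow_right₀ one_le_two h) hl.le
  refine mem_cube.2 fun i => ?_
  have := mem_cube.1 hx i
  constructor <;> linarith

/-- Take `2 ^ k ≤ 1 + dist / l < 2 ^ (k + 1)`. The lower bound gives the decay of the weight. The
upper bound puts `y` within `2 * 2 ^ k * l` of the cube, and such a margin on both sides, together
with the cube itself, fits into side length `5 * 2 ^ k * l`. -/
theorem exists_bumpWeight_le {M : ℝ} (hM : 0 ≤ M) (a : Fin d → ℝ) {l : ℝ} (hl : 0 < l)
    (y : Fin d → ℝ) :
    ∃ k : ℕ, y ∈ dilate a l k ∧ bumpWeight M a l y ≤ (2 : ℝ≥0∞) ^ (-(M * k)) := by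
  have h0 : 0 ≤ Metric.infDist y (cube a l) / l := div_nonneg Metric.infDist_nonneg hl.le
  obtain ⟨k, h1, h2⟩ := exists_nat_pow_near (x := 1 + Metric.infDist y (cube a l) / l) (y := 2)
    (by linarith) one_lt_two
  have hp : (0 : ℝ) < 2 ^ k := by positivity
  refine ⟨k, ?_, ?_⟩
  · have h3 : Metric.infDist y (cube a l) < 2 * (2 ^ k * l) := by
      have : Metric.infDist y (cube a l) / l < 2 * 2 ^ k := by
        rw [pow_succ] at h2
        linarith
      rw [div_lt_iff₀ hl] at this
      linarith
    obtain ⟨x, hx, hxy⟩ := (Metric.infDist_lt_iff (cube_nonempty a hl)).1 h3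
    refine mem_cube.2 fun i => ?_
    have h4 := (dist_le_pi_dist y x i).trans_lt hxy
    rw [Real.dist_eq, abs_lt] at h4
    have := mem_cube.1 hx i
    have h5 : 1 * l ≤ 2 ^ k * l :=
      mul_le_mul_of_nonneg_right (one_le_pow₀ one_le_two) hl.le
    constructor <;> linarith
  · have h3 : (1 + Metric.infDist y (cube a l) / l) ^ (-M) ≤ ((2 : ℝ) ^ k) ^ (-M) :=
      Real.rpow_le_rpow_of_nonpos hp h1 (by linarith)
    refine (ENNReal.ofReal_le_ofReal h3).trans (le_of_eq ?_)
    rw [← Real.rpow_natCast, ← Real.rpow_mul zero_le_two, ← ENNReal.ofReal_rpow_of_pos two_pos,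
      ENNReal.ofReal_ofNat]
    congr 1
    ring

theorem two_pow_pow_eq (K d : ℕ) : ENNReal.ofReal (2 ^ K) ^ d = (2 : ℝ≥0∞) ^ ((K : ℝ) * d) := by
  rw [ENNReal.ofReal_pow zero_le_two, ENNReal.ofReal_ofNat, ENNReal.rpow_mul, ENNReal.rpow_natCast,
    ENNReal.rpow_natCast]

/-- The averages over the dilated cubes. -/
noncomputable def dilateAvg (a : Fin d → ℝ) (l : ℝ) (g : (Fin d → ℝ) → ℝ≥0∞) (k : ℕ) : ℝ≥0∞ :=
  cubeAvg sharpWeight (fun i => a i - 2 * (2 ^ k * l)) (5 * (2 ^ k * l)) g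

theorem dilateAvg_le (a : Fin d → ℝ) {l : ℝ} (hl : 0 < l) (g : (Fin d → ℝ) → ℝ≥0∞) {k K : ℕ}
    (h : k ≤ K) : dilateAvg a l g k ≤ (2 : ℝ≥0∞) ^ ((K : ℝ) * d) * dilateAvg a l g K := by
  rw [← two_pow_pow_eq]
  have h1 : 1 * l ≤ 2 ^ k * l :=
    mul_le_mul_of_nonneg_right (one_le_pow₀ one_le_two) hl.le
  have h2 : 2 ^ k * l ≤ 2 ^ K * l :=
    mul_le_mul_of_nonneg_right (pow_le_pow_right₀ one_le_two h) hl.le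
  have h3 : (2 : ℝ) ^ K * (1 * l) ≤ 2 ^ K * (2 ^ k * l) :=
    mul_le_mul_of_nonneg_left h1 (by positivity)
  exact cubeAvg_le isCubeWeight_sharpWeight (by linarith) (by linarith) (by linarith)
    (dilate_mono a hl h) g

/-- The weight is at most the sum of `2 ^ (-M k)` times the indicators of the dilates. Normalizing
by the volume of a dilate costs `5 ^ d * 2 ^ (k d)`. A further `2 ^ (-k)` is set aside so that the
sum converges, with value `2`, and the remaining decay `M - d - 1` stays inside the supremum. -/
theorem cubeAvg_bump_le {M : ℝ} (hM : 0 ≤ M) (a : Fin d → ℝ) {l : ℝ} (hl : 0 < l)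
    {g : (Fin d → ℝ) → ℝ≥0∞} (hg : Measurable g) :
    cubeAvg (bumpWeight M) a l g ≤
      (5 ^ d * 2) * ⨆ k : ℕ, (2 : ℝ≥0∞) ^ (-((M - d - 1) * k)) * dilateAvg a l g k := by
  set S := ⨆ k : ℕ, (2 : ℝ≥0∞) ^ (-((M - d - 1) * k)) * dilateAvg a l g k with hS
  have h1 : ∫⁻ y, g y * bumpWeight M a l y ≤
      ∑' k : ℕ, (2 : ℝ≥0∞) ^ (-(M * k)) * ∫⁻ y in dilate a l k, g y := by
    have h2 : ∀ k : ℕ, (2 : ℝ≥0∞) ^ (-(M * k)) * ∫⁻ y in dilate a l k, g y =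
        ∫⁻ y, (dilate a l k).indicator (fun y => (2 : ℝ≥0∞) ^ (-(M * k)) * g y) y := by
      intro k
      rw [lintegral_indicator (measurableSet_dilate _ _ _), lintegral_const_mul _ hg]
    simp_rw [h2]
    rw [← lintegral_tsum fun k =>
      ((hg.const_mul _).indicator (measurableSet_dilate _ _ _)).aemeasurable]
    refine lintegral_mono fun y => ?_
    obtain ⟨k, hk, hle⟩ := exists_bumpWeight_le hM a hl y
    refine le_trans ?_ (ENNReal.le_tsum k)
    rw [Set.indicator_of_mem hk, mul_comm]
    exact mul_le_mul_left hle _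
  have h2 : ∀ k : ℕ, (volume (cube a l))⁻¹ * ((2 : ℝ≥0∞) ^ (-(M * k)) *
      ∫⁻ y in dilate a l k, g y) ≤ (2 : ℝ≥0∞)⁻¹ ^ k * (5 ^ d * S) := by
    intro k
    have hk : 0 < 2 ^ k * l := by positivity
    have hv := inv_volume_cube_le (a := a) (a' := fun i => a i - 2 * (2 ^ k * l)) hl
      (show 0 < 5 * (2 ^ k * l) by positivity) (c := 5 * 2 ^ k) (by linarith)
    have e1 : ENNReal.ofReal (5 * 2 ^ k) ^ d = 5 ^ d * (2 : ℝ≥0∞) ^ ((k : ℝ) * d) := by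
      rw [ENNReal.ofReal_mul (by norm_num), mul_pow, two_pow_pow_eq, ENNReal.ofReal_ofNat]
    have e2 : (2 : ℝ≥0∞) ^ ((k : ℝ) * d) * (2 : ℝ≥0∞) ^ (-(M * k)) =
        (2 : ℝ≥0∞)⁻¹ ^ k * (2 : ℝ≥0∞) ^ (-((M - d - 1) * k)) := by
      rw [← ENNReal.inv_pow, ← ENNReal.rpow_natCast, ← ENNReal.rpow_neg,
        ← ENNReal.rpow_add _ _ two_ne_zero ENNReal.ofNat_ne_top,
        ← ENNReal.rpow_add _ _ two_ne_zero ENNReal.ofNat_ne_top]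
      congr 1
      ring
    rw [e1] at hv
    calc (volume (cube a l))⁻¹ * ((2 : ℝ≥0∞) ^ (-(M * k)) * ∫⁻ y in dilate a l k, g y)
        ≤ (5 ^ d * (2 : ℝ≥0∞) ^ ((k : ℝ) * d) * (volume (dilate a l k))⁻¹) *
          ((2 : ℝ≥0∞) ^ (-(M * k)) * ∫⁻ y in dilate a l k, g y) := mul_le_mul_left hv _
      _ = 5 ^ d * ((2 : ℝ≥0∞) ^ ((k : ℝ) * d) * (2 : ℝ≥0∞) ^ (-(M * k))) *
          ((volume (dilate a l k))⁻¹ * ∫⁻ y in dilate a l k, g y) := by ring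
      _ = (2 : ℝ≥0∞)⁻¹ ^ k * (5 ^ d *
          ((2 : ℝ≥0∞) ^ (-((M - d - 1) * k)) * dilateAvg a l g k)) := by
        rw [e2, dilateAvg, cubeAvg_sharp, dilate]
        ring
      _ ≤ _ := by
        refine mul_le_mul_right (mul_le_mul_right ?_ _) _
        exact le_iSup (fun k : ℕ => (2 : ℝ≥0∞) ^ (-((M - d - 1) * k)) * dilateAvg a l g k) k
  rw [cubeAvg]
  refine (mul_le_mul_right h1 _).trans ?_
  rw [← ENNReal.tsum_mul_left]
  refine (ENNReal.tsum_le_tsum h2).trans (le_of_eq ?_)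
  rw [ENNReal.tsum_mul_right, ENNReal.tsum_geometric, ENNReal.one_sub_inv_two, inv_inv]
  ring

/-- Different `j` may select different dilates `κ j`, but the maximal function needs one common
cube. All averages are moved to the largest index `K`, at a total cost of at most `2 ^ (K * d * ∑ θ
i)`. -/
theorem cubeTerm_bump_le {θ : Fin n → ℝ} (hθ : ∀ j, 0 < θ j) {M : ℝ}
    (hM : ∀ j, d + 1 + d * (∑ i, θ i) / θ j ≤ M) (hM0 : 0 ≤ M) (a : Fin d → ℝ) {l : ℝ}
    (hl : 0 < l) {g : Fin n → (Fin d → ℝ) → ℝ≥0∞} (hg : ∀ j, Measurable (g j)) (x : Fin d → ℝ) :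
    cubeTerm (bumpWeight M) θ a l g x ≤
      (∏ j, ((5 : ℝ≥0∞) ^ d * 2) ^ θ j) * cubeMax sharpWeight θ g x := by
  by_cases hx : x ∈ cube a l
  swap
  · simp [cubeTerm, hx]
  rw [cubeTerm, Set.indicator_of_mem hx]
  have h1 : ∏ j, cubeAvg (bumpWeight M) a l (g j) ^ θ j ≤ (∏ j, ((5 : ℝ≥0∞) ^ d * 2) ^ θ j) *
      ∏ j, ⨆ k : ℕ, ((2 : ℝ≥0∞) ^ (-((M - d - 1) * k)) * dilateAvg a l (g j) k) ^ θ j := by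
    rw [← Finset.prod_mul_distrib]
    refine Finset.prod_le_prod' fun j _ => ?_
    rw [← iSup_rpow (hθ j), ← ENNReal.mul_rpow_of_nonneg _ _ (hθ j).le]
    exact ENNReal.rpow_le_rpow (cubeAvg_bump_le hM0 a hl (hg j)) (hθ j).le
  refine h1.trans (mul_le_mul_right (prod_iSup_le _ fun κ => ?_) _)
  set K := Finset.univ.sup κ with hK
  have hκ : ∀ j, κ j ≤ K := fun j => Finset.le_sup (Finset.mem_univ j)
  have h2 : ∏ j, dilateAvg a l (g j) K ^ θ j ≤ cubeMax sharpWeight θ g x := by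
    refine le_iSup_of_le (fun i => a i - 2 * (2 ^ K * l)) (le_iSup_of_le (5 * (2 ^ K * l))
      (le_iSup_of_le (by positivity : (0 : ℝ) < 5 * (2 ^ K * l)) (le_of_eq ?_)))
    exact (Set.indicator_of_mem (cube_subset_dilate a hl K hx)
      (fun _ => ∏ j, dilateAvg a l (g j) K ^ θ j)).symm
  refine le_trans ?_ h2
  have h3 : ∀ j, ((2 : ℝ≥0∞) ^ (-((M - d - 1) * (κ j : ℝ))) * dilateAvg a l (g j) (κ j)) ^ θ j ≤
      (2 : ℝ≥0∞) ^ ((-((M - d - 1) * (κ j : ℝ)) + K * d) * θ j) * dilateAvg a l (g j) K ^ θ j := by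
    intro j
    rw [ENNReal.rpow_mul, ← ENNReal.mul_rpow_of_nonneg _ _ (hθ j).le,
      ENNReal.rpow_add _ _ two_ne_zero ENNReal.ofNat_ne_top, mul_assoc]
    exact ENNReal.rpow_le_rpow (mul_le_mul_right (dilateAvg_le a hl (g j) (hκ j)) _) (hθ j).le
  refine (Finset.prod_le_prod' fun j _ => h3 j).trans ?_
  rw [Finset.prod_mul_distrib]
  refine mul_le_of_le_one_left' ?_
  have h4 : ∀ (S : Finset (Fin n)) (e : Fin n → ℝ),
      ∏ j ∈ S, (2 : ℝ≥0∞) ^ e j = (2 : ℝ≥0∞) ^ ∑ j ∈ S, e j := by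
    intro S e
    induction S using Finset.cons_induction with
    | empty => simp
    | cons a S ha ih =>
      rw [Finset.prod_cons, Finset.sum_cons, ih,
        ENNReal.rpow_add _ _ two_ne_zero ENNReal.ofNat_ne_top]
  rw [h4]
  refine (ENNReal.rpow_le_rpow_of_exponent_le (z := 0) one_le_two ?_).trans_eq ENNReal.rpow_zero
  rcases isEmpty_or_nonempty (Fin n) with hn | hn
  · simp
  -- The decay of a single factor, one with `κ j₀ = K`, pays the whole cost. Since any `j` may be
  -- that one, `M` must satisfy the condition for every `j`.
  obtain ⟨j₀, -, hj₀⟩ := Finset.exists_mem_eq_sup Finset.univ Finset.univ_nonempty κ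
  have hA : ∀ j, d * (∑ i, θ i) ≤ (M - d - 1) * θ j := by
    intro j
    rw [← div_le_iff₀ (hθ j)]
    linarith [hM j]
  have hA0 : 0 ≤ (d : ℝ) * ∑ i, θ i :=
    mul_nonneg (Nat.cast_nonneg _) (Finset.sum_nonneg fun i _ => (hθ i).le)
  have h5 : (d * ∑ i, θ i) * K ≤ ∑ j, (M - d - 1) * θ j * κ j := by
    refine le_trans ?_ (Finset.single_le_sum (f := fun j => (M - d - 1) * θ j * (κ j : ℝ))
      (fun j _ => mul_nonneg (hA0.trans (hA j)) (Nat.cast_nonneg _)) (Finset.mem_univ j₀))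
    rw [hK, hj₀]
    exact mul_le_mul_of_nonneg_right (hA j₀) (Nat.cast_nonneg _)
  have h6 : ∑ j, (-((M - d - 1) * (κ j : ℝ)) + K * d) * θ j =
      (d * ∑ i, θ i) * K - ∑ j, (M - d - 1) * θ j * κ j := by
    rw [Finset.mul_sum, Finset.sum_mul, ← Finset.sum_sub_distrib]
    exact Finset.sum_congr rfl fun j _ => by ring
  linarith

/-- The maximal function with bump weights is controlled by the one with sharp weights. -/
theorem cubeMax_bump_le {θ : Fin n → ℝ} (hθ : ∀ j, 0 < θ j) {M : ℝ}
    (hM : ∀ j, d + 1 + d * (∑ i, θ i) / θ j ≤ M) (hM0 : 0 ≤ M)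
    {g : Fin n → (Fin d → ℝ) → ℝ≥0∞} (hg : ∀ j, Measurable (g j)) (x : Fin d → ℝ) :
    cubeMax (bumpWeight M) θ g x ≤
      (∏ j, ((5 : ℝ≥0∞) ^ d * 2) ^ θ j) * cubeMax sharpWeight θ g x :=
  iSup_le fun a => iSup_le fun _ => iSup_le fun hl => cubeTerm_bump_le hθ hM hM0 a hl hg x

end Bump

end VVMaximal


/-! ### Assembly of the bound -/

namespace VVMaximal

section Bound

variable {d n m : ℕ}

theorem pairNorm_iSup {W : Fin m → Type u} [∀ i, MeasurableSpace (W i)] (ν : ∀ i, Measure (W i))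
    [∀ i, SigmaFinite (ν i)] {P : Fin d → ℝ≥0∞} {R : Fin m → ℝ≥0∞}
    (hP0 : ∀ i, P i ≠ 0) (hPt : ∀ i, P i ≠ ∞) (hR0 : ∀ i, R i ≠ 0) (hRt : ∀ i, R i ≠ ∞)
    {u : ℕ → (Fin d → ℝ) × (∀ i, W i) → ℝ≥0∞} (hu : ∀ N, Measurable (u N)) (hm : Monotone u) :
    pairNorm ν P R (fun z => ⨆ N, u N z) = ⨆ N, pairNorm ν P R (u N) := by
  have h1 : ∀ y : Fin d → ℝ, mixedNorm R ν (fun w => ⨆ N, u N (y, w)) =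
      ⨆ N, mixedNorm R ν (fun w => u N (y, w)) := fun y =>
    mixedNorm_iSup hR0 hRt ν (F := fun N w => u N (y, w))
      (fun N => (hu N).comp measurable_prodMk_left) fun _ _ h _ => hm h _
  simp_rw [pairNorm, vvMixedNorm, h1]
  exact mixedNorm_iSup hP0 hPt _ (F := fun N y => mixedNorm R ν fun w => u N (y, w))
    (fun N => measurable_mixedNorm R ν (F := fun y w => u N (y, w)) (hu N))
    fun _ _ h _ => mixedNorm_mono _ _ fun _ => hm h _

theorem pairNorm_const_mul {W : Fin m → Type u} [∀ i, MeasurableSpace (W i)]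
    (ν : ∀ i, Measure (W i)) [∀ i, SigmaFinite (ν i)] (P : Fin d → ℝ≥0∞) (R : Fin m → ℝ≥0∞)
    {c : ℝ≥0∞} (hc : c ≠ ∞) (u : (Fin d → ℝ) × (∀ i, W i) → ℝ≥0∞) :
    pairNorm ν P R (fun z => c * u z) = c * pairNorm ν P R u := by
  rw [pairNorm, vvMixedNorm]
  simp_rw [mixedNorm_const_mul R ν hc]
  exact mixedNorm_const_mul P _ hc _

theorem pairNorm_finset_sup_le {W : Fin m → Type u} [∀ i, MeasurableSpace (W i)]
    (ν : ∀ i, Measure (W i)) [∀ i, SigmaFinite (ν i)] {P : Fin d → ℝ≥0∞} {R : Fin m → ℝ≥0∞}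
    (hP0 : ∀ i, P i ≠ 0) (hPt : ∀ i, P i ≠ ∞) (hR0 : ∀ i, R i ≠ 0) (hRt : ∀ i, R i ≠ ∞)
    {β : Type*} (S : Finset β) {u : β → (Fin d → ℝ) × (∀ i, W i) → ℝ≥0∞}
    (hu : ∀ b, Measurable (u b)) {B : ℝ≥0∞} (hB : ∀ b, pairNorm ν P R (u b) ≤ B) :
    pairNorm ν P R (fun z => S.sup fun b => u b z) ≤
      ((quasiConst R * quasiConst P) ^ S.card : ℝ≥0) * B := by
  induction S using Finset.cons_induction with
  | empty =>
    have h0 : pairNorm ν P R (fun _ => 0) = 0 := by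
      rw [pairNorm, vvMixedNorm]
      simp_rw [mixedNorm_zero]
    simp [h0]
  | cons b S hb ih =>
    simp_rw [Finset.sup_cons]
    refine (pairNorm_max_le ν hP0 hPt hR0 hRt (hu b)).trans ?_
    have h1 : (1 : ℝ≥0∞) ≤ ((quasiConst R * quasiConst P) ^ S.card : ℝ≥0) :=
      ENNReal.one_le_coe_iff.2 (one_le_pow₀
        (one_le_mul (one_le_quasiConst R) (one_le_quasiConst P)))
    rw [Finset.card_cons, pow_succ', ENNReal.coe_mul (quasiConst R * quasiConst P), mul_assoc]
    exact mul_le_mul_right (max_le ((hB b).trans (le_mul_of_one_le_left' h1)) ih) _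

/-- A sequence of cubes that suffices to compute the maximal functions. -/
theorem exists_cubeMax_eq_iSup (d : ℕ) : ∃ (a : ℕ → Fin d → ℝ) (l : ℕ → ℝ), (∀ k, 0 < l k) ∧
    ∀ {n : ℕ} {χ : (Fin d → ℝ) → ℝ → (Fin d → ℝ) → ℝ≥0∞}, IsCubeWeight χ → ∀ {θ : Fin n → ℝ},
      (∀ j, 0 < θ j) → ∀ (g : Fin n → (Fin d → ℝ) → ℝ≥0∞) (x : Fin d → ℝ),
        cubeMax χ θ g x = ⨆ k, cubeTerm χ θ (a k) (l k) g x := by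
  have : Nonempty {q : (Fin d → ℚ) × ℚ // 0 < q.2} := ⟨⟨(0, 1), one_pos⟩⟩
  obtain ⟨q, hq⟩ := exists_surjective_nat {q : (Fin d → ℚ) × ℚ // 0 < q.2}
  refine ⟨fun k i => ((q k).1.1 i : ℝ), fun k => ((q k).1.2 : ℝ),
    fun k => Rat.cast_pos.2 (q k).2, fun hχ θ hθ g x => ?_⟩
  rw [cubeMax_eq_iSup_rat hχ hθ]
  exact (hq.iSup_comp (g := fun r : {q : (Fin d → ℚ) × ℚ // 0 < q.2} =>
    cubeTerm _ θ (fun i => (r.1.1 i : ℝ)) r.1.2 g x)).symm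

theorem measurable_iSup_cubeOp {Ω : Type u} [MeasurableSpace Ω] {θ : Fin n → ℝ} (t : Fin d → ℝ)
    {L : ℝ} (hL : 0 < L) (I : ℕ) {g : Fin n → (Fin d → ℝ) × Ω → ℝ≥0∞}
    (hg : ∀ j, Measurable (g j)) :
    Measurable fun z => ⨆ i ∈ Set.Ico 0 I, cubeOp θ t L i g z := by
  refine Measurable.iSup fun i => Measurable.iSup_Prop _ ?_
  have h1 := measurable_cubeOp (θ := θ) (E := Unit) t hL i
    (f := fun j _ => g j) fun j => (hg j).comp measurable_snd
  exact Measurable.of_uncurry_left h1 (x := ())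

theorem iSup_iSup_lt {α : Type*} (T : ℕ → α → ℝ≥0∞) (z : α) :
    ⨆ k, T k z = ⨆ N, ⨆ k, ⨆ _ : k < N, T k z :=
  le_antisymm (iSup_le fun k => le_iSup_of_le (k + 1) (le_iSup₂_of_le k k.lt_succ_self le_rfl))
    (iSup_le fun _ => iSup₂_le fun k _ => le_iSup (fun k => T k z) k)

/-- Boundedness of the maximal operator over cubes, for nonnegative functions. -/
theorem exists_cubeMax_bound {θ : Fin n → ℝ} (hθ : ∀ j, 0 < θ j) {R : Fin n → Fin m → ℝ≥0∞}
    {R' : Fin m → ℝ≥0∞} (hR : AdmissibleTuple θ R R') {P : Fin n → Fin d → ℝ≥0∞}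
    {P' : Fin d → ℝ≥0∞} (hP : AdmissibleTuple θ P P') (hd : 1 ≤ d) :
    ∃ C : ℝ≥0, ∀ (W : Fin m → Type u) [∀ i, MeasurableSpace (W i)]
      (ν : ∀ i, Measure (W i)) [∀ i, SigmaFinite (ν i)]
      (g : Fin n → (Fin d → ℝ) × (∀ i, W i) → ℝ≥0∞), (∀ j, Measurable (g j)) →
        pairNorm ν P' R' (fun z => cubeMax sharpWeight θ (fun j y => g j (y, z.2)) z.1) ≤
          C * ∏ j, pairNorm ν (P j) (R j) (g j) ^ θ j := by
  obtain ⟨C, hC⟩ := exists_dyadic_bound.{u} hθ hR hP hd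
  obtain ⟨a, l, hl, hmax⟩ := exists_cubeMax_eq_iSup d
  have hP0 := fun i => (hP i).ne_zero
  have hPt := fun i => (hP i).ne_top
  have hR0 := fun i => (hR i).ne_zero
  have hRt := fun i => (hR i).ne_top
  have hct : ∏ j, ((6 : ℝ≥0∞) ^ d) ^ θ j ≠ ∞ :=
    ENNReal.prod_ne_top fun j _ => ENNReal.rpow_ne_top_of_nonneg (hθ j).le
      (ENNReal.pow_ne_top ENNReal.ofNat_ne_top)
  obtain ⟨c, hc⟩ : ∃ c : ℝ≥0, ∏ j, ((6 : ℝ≥0∞) ^ d) ^ θ j = c := ⟨_, (ENNReal.coe_toNNReal hct).symm⟩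
  refine ⟨c * ((quasiConst R' * quasiConst P') ^
    (Finset.univ : Finset (Fin d → Bool)).card * C), ?_⟩
  intro W _ ν _ g hg
  simp_rw [hmax isCubeWeight_sharpWeight hθ]
  have hT : ∀ k, Measurable fun z : (Fin d → ℝ) × (∀ i, W i) =>
      cubeTerm sharpWeight θ (a k) (l k) (fun j y => g j (y, z.2)) z.1 := fun k =>
    measurable_cubeTerm isCubeWeight_sharpWeight θ (a k) (l k) hg
  generalize hTdef : (fun k (z : (Fin d → ℝ) × (∀ i, W i)) =>
    cubeTerm sharpWeight θ (a k) (l k) (fun j y => g j (y, z.2)) z.1) = T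
  have hTk : ∀ k z, cubeTerm sharpWeight θ (a k) (l k) (fun j y => g j (y, z.2)) z.1 = T k z :=
    fun k z => congrFun (congrFun hTdef k) z
  simp_rw [hTk] at hT ⊢
  simp_rw [iSup_iSup_lt T]
  rw [pairNorm_iSup ν hP0 hPt hR0 hRt (u := fun N z => ⨆ k, ⨆ _ : k < N, T k z)
    (fun N => Measurable.iSup fun k => Measurable.iSup_Prop _ (hT k))
    (fun N N' h z => iSup_mono fun k => iSup_le fun hk => le_iSup_of_le (hk.trans_le h) le_rfl)]
  refine iSup_le fun N => ?_
  -- The grid size `L` and the depth `I` depend on `N`, but the dyadic constant `C` does not, so the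
  -- bound survives the limit in `N`.
  obtain ⟨L, I, hL, hLI⟩ := exists_cubeTerm_le.{u} hθ N a l hl
  have hV := fun b => measurable_iSup_cubeOp (θ := θ) (gridShift L b) hL I hg
  have h1 : pairNorm ν P' R' (fun z => ⨆ k, ⨆ _ : k < N, T k z) ≤ pairNorm ν P' R'
      (fun z => c * Finset.univ.sup fun b => ⨆ i ∈ Set.Ico 0 I, cubeOp θ (gridShift L b) L i g z) := by
    refine pairNorm_mono ν P' R' fun z => iSup_le fun k => iSup_le fun hk => ?_
    rw [Finset.sup_univ_eq_iSup, ← hc, ← hTk]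
    exact hLI g z k hk
  refine h1.trans ?_
  rw [pairNorm_const_mul ν P' R' ENNReal.coe_ne_top, ENNReal.coe_mul c,
    ENNReal.coe_mul (_ ^ _), mul_assoc, mul_assoc]
  exact mul_le_mul_right (pairNorm_finset_sup_le ν hP0 hPt hR0 hRt _ hV
    fun b => hC W ν (gridShift L b) L hL I g hg) _

/-- Locality `1 / p_j < 1 / s_j` is the condition `1 < p_j / s_j`, and the weight `1 / s_j` undoes
the division by `s_j` in the Hölder sum. -/
theorem admissible_div {s : Fin n → ℝ} (hs : ∀ j, 0 < s j) {p : Fin n → ℝ≥0∞} {p' : ℝ≥0∞}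
    (hloc : IsLocalTuple (fun j => 1 / s j) p) (hp : IsHolderTuple p p') :
    Admissible (fun j => 1 / s j) (fun j => p j / ENNReal.ofReal (s j)) p' where
  one_lt j := by
    have h0 : ENNReal.ofReal (s j) ≠ 0 := by simpa using hs j
    have h := hloc j
    dsimp only at h
    rw [one_div, ENNReal.ofReal_inv_of_pos (hs j), ENNReal.inv_lt_inv] at h
    rw [ENNReal.lt_div_iff_mul_lt (Or.inl h0) (Or.inl ENNReal.ofReal_ne_top), one_mul]
    exact h
  ne_zero := (zero_le.trans_lt hp.inv_lt).ne'
  ne_top := hp.lt_top.ne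
  sum_eq := by
    rw [← hp.sum_inv]
    refine Finset.sum_congr rfl fun j _ => ?_
    have h0 : ENNReal.ofReal (s j) ≠ 0 := by simpa using hs j
    rw [one_div, ENNReal.ofReal_inv_of_pos (hs j),
      ENNReal.inv_div (Or.inl ENNReal.ofReal_ne_top) (Or.inl h0), div_eq_mul_inv, ← mul_assoc,
      ENNReal.inv_mul_cancel h0 ENNReal.ofReal_ne_top, one_mul]

theorem pairNorm_rpow {W : Fin m → Type u} [∀ i, MeasurableSpace (W i)] (ν : ∀ i, Measure (W i))
    {P : Fin d → ℝ≥0∞} {R : Fin m → ℝ≥0∞} (hP : ∀ i, P i ≠ 0) (hR : ∀ i, R i ≠ 0) {s : ℝ}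
    (hs : 0 < s) (u : (Fin d → ℝ) × (∀ i, W i) → ℝ≥0∞) :
    pairNorm ν (fun i => P i / ENNReal.ofReal s) (fun i => R i / ENNReal.ofReal s)
      (fun z => u z ^ s) = pairNorm ν P R u ^ s := by
  rw [pairNorm, vvMixedNorm]
  simp_rw [mixedNorm_rpow hR ν hs]
  exact mixedNorm_rpow hP _ hs _

theorem vvMixedNorm_congr_ae {W : Fin m → Type u} [∀ i, MeasurableSpace (W i)]
    (ν : ∀ i, Measure (W i)) [∀ i, SigmaFinite (ν i)] (P : Fin d → ℝ≥0∞) (R : Fin m → ℝ≥0∞)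
    {F G : (Fin d → ℝ) → (∀ i, W i) → ℝ≥0∞}
    (h : ∀ᵐ z ∂(volume : Measure (Fin d → ℝ)).prod (Measure.pi ν), F z.1 z.2 = G z.1 z.2) :
    vvMixedNorm P R ν F = vvMixedNorm P R ν G := by
  refine mixedNorm_congr_ae P _ ?_
  rw [← volume_pi]
  filter_upwards [Measure.ae_ae_of_ae_prod h] with x hx
  exact mixedNorm_congr_ae R ν hx

theorem multiMaximal_congr_ae (χ : (Fin d → ℝ) → ℝ → (Fin d → ℝ) → ℝ≥0∞) (s : Fin n → ℝ)
    {f g : Fin n → (Fin d → ℝ) → ℂ} (h : ∀ j, f j =ᵐ[volume] g j) (x : Fin d → ℝ) :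
    multiMaximal χ s f x = multiMaximal χ s g x := by
  refine iSup_congr fun a => iSup_congr fun l => iSup_congr fun _ => iSup_congr fun _ =>
    Finset.prod_congr rfl fun j _ => ?_
  congr 2
  refine lintegral_congr_ae ?_
  filter_upwards [h j] with y hy
  rw [hy]

/-- A family of weights whose maximal function is pointwise controlled by the sharp one yields
a bounded maximal operator. -/
theorem exists_maximalBoundedOn (hd : 1 ≤ d) {s : Fin n → ℝ} (hs : ∀ j, 0 < s j)
    {P : Fin n → Fin d → ℝ≥0∞} {P' : Fin d → ℝ≥0∞} {R : Fin n → Fin m → ℝ≥0∞}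
    {R' : Fin m → ℝ≥0∞}
    (hPloc : ∀ i, IsLocalTuple (fun j => 1 / s j) (fun j => P j i))
    (hRloc : ∀ i, IsLocalTuple (fun j => 1 / s j) (fun j => R j i))
    (hP : ∀ i, IsHolderTuple (fun j => P j i) (P' i))
    (hR : ∀ i, IsHolderTuple (fun j => R j i) (R' i))
    {χ : (Fin d → ℝ) → ℝ → (Fin d → ℝ) → ℝ≥0∞} (hχ : IsCubeWeight χ) {c : ℝ≥0∞} (hc : c ≠ ∞)
    (hχle : ∀ g : Fin n → (Fin d → ℝ) → ℝ≥0∞, (∀ j, Measurable (g j)) → ∀ x,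
      cubeMax χ (fun j => 1 / s j) g x ≤ c * cubeMax sharpWeight (fun j => 1 / s j) g x) :
    ∃ C : ℝ≥0, ∀ (W : Fin m → Type u) [∀ i, MeasurableSpace (W i)]
      (μ : ∀ i, Measure (W i)) [∀ i, SigmaFinite (μ i)],
      MaximalBoundedOn χ s P P' R R' C W μ := by
  have hθ : ∀ j, 0 < 1 / s j := fun j => one_div_pos.2 (hs j)
  have hPA : AdmissibleTuple (fun j => 1 / s j) (fun j i => P j i / ENNReal.ofReal (s j)) P' :=
    fun i => admissible_div hs (hPloc i) (hP i)
  have hRA : AdmissibleTuple (fun j => 1 / s j) (fun j i => R j i / ENNReal.ofReal (s j)) R' :=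
    fun i => admissible_div hs (hRloc i) (hR i)
  obtain ⟨C, hC⟩ := exists_cubeMax_bound.{u} hθ hRA hPA hd
  refine ⟨c.toNNReal * C, ?_⟩
  intro W _ μ _ f hf
  set f' : Fin n → (Fin d → ℝ) × (∀ i, W i) → ℂ := fun j => (hf j).mk (f j) with hf'
  have hf'm : ∀ j, Measurable (f' j) := fun j => (hf j).measurable_mk
  have hff' : ∀ j, f j =ᵐ[(volume : Measure (Fin d → ℝ)).prod (Measure.pi μ)] f' j :=
    fun j => (hf j).ae_eq_mk
  let g : Fin n → (Fin d → ℝ) × (∀ i, W i) → ℝ≥0∞ := fun j z => ‖f' j z‖ₑ ^ s j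
  have hg : ∀ j, Measurable (g j) := fun j => (hf'm j).enorm.pow_const _
  -- For almost every `w` the sections of `f` and of its measurable version agree a.e. in `y`, and
  -- then their maximal functions agree at every `x`, since they only see integrals.
  have hmax : ∀ᵐ z ∂(volume : Measure (Fin d → ℝ)).prod (Measure.pi μ),
      vvMultiMaximal χ s f z.1 z.2 = cubeMax χ (fun j => 1 / s j) (fun j y => g j (y, z.2)) z.1 := by
    have h1 : ∀ᵐ z ∂(Measure.pi μ).prod (volume : Measure (Fin d → ℝ)),
        ∀ j, f j z.swap = f' j z.swap :=
      ae_all_iff.2 fun j => Measure.measurePreserving_swap.quasiMeasurePreserving.ae (hff' j)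
    have h2 := Measure.ae_ae_of_ae_prod h1
    have h3 : ∀ᵐ z ∂(volume : Measure (Fin d → ℝ)).prod (Measure.pi μ),
        ∀ᵐ y ∂(volume : Measure (Fin d → ℝ)), ∀ j, f j (y, z.2) = f' j (y, z.2) :=
      Measure.quasiMeasurePreserving_snd.ae h2
    filter_upwards [h3] with z hz
    rw [vvMultiMaximal, multiMaximal_congr_ae χ s (g := fun j y => f' j (y, z.2))
      (fun j => hz.mono fun y hy => hy j), multiMaximal_eq]
  refine ⟨(measurable_cubeMax hχ hθ hg).aemeasurable.congr (hmax.mono fun z hz => hz.symm), ?_⟩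
  rw [vvMixedNorm_congr_ae μ P' R'
    (G := fun x w => cubeMax χ (fun j => 1 / s j) (fun j y => g j (y, w)) x) hmax]
  have hin : ∀ j, pairNorm μ (fun i => P j i / ENNReal.ofReal (s j))
      (fun i => R j i / ENNReal.ofReal (s j)) (g j) ^ (1 / s j) =
      vvMixedNorm (P j) (R j) μ (fun x w => ‖f j (x, w)‖ₑ) := by
    intro j
    have hP0 : ∀ i, P j i ≠ 0 := fun i => (zero_lt_one.trans ((hP i).one_lt j)).ne'
    have hR0 : ∀ i, R j i ≠ 0 := fun i => (zero_lt_one.trans ((hR i).one_lt j)).ne'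
    rw [pairNorm_rpow μ hP0 hR0 (hs j) (fun z => ‖f' j z‖ₑ), ← ENNReal.rpow_mul,
      mul_one_div_cancel (hs j).ne', ENNReal.rpow_one]
    refine vvMixedNorm_congr_ae μ (P j) (R j) ?_
    filter_upwards [hff' j] with z hz
    rw [hz]
  refine (pairNorm_mono μ P' R' (v := fun z => c * cubeMax sharpWeight (fun j => 1 / s j)
    (fun j y => g j (y, z.2)) z.1) fun z => hχle _
      (fun j => (hg j).comp measurable_prodMk_right) z.1).trans ?_
  rw [pairNorm_const_mul μ P' R' hc, ENNReal.coe_mul, ENNReal.coe_toNNReal hc, mul_assoc]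
  simp_rw [← hin]
  exact mul_le_mul_right (hC W μ g hg) _

end Bound

end VVMaximal

theorem theorem11 {d n m : ℕ} (hd : 1 ≤ d) (s : Fin n → ℝ) (hs : ∀ j, 0 < s j)
    (P : Fin n → Fin d → ℝ≥0∞) (P' : Fin d → ℝ≥0∞)
    (R : Fin n → Fin m → ℝ≥0∞) (R' : Fin m → ℝ≥0∞)
    (hPloc : ∀ i, IsLocalTuple (fun j => 1 / s j) (fun j => P j i))
    (hRloc : ∀ i, IsLocalTuple (fun j => 1 / s j) (fun j => R j i))
    (hP : ∀ i, IsHolderTuple (fun j => P j i) (P' i))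
    (hR : ∀ i, IsHolderTuple (fun j => R j i) (R' i)) :
    (∃ C : ℝ≥0, ∀ (W : Fin m → Type u) [∀ i, MeasurableSpace (W i)]
      (μ : ∀ i, Measure (W i)) [∀ i, SigmaFinite (μ i)],
      MaximalBoundedOn sharpWeight s P P' R R' C W μ) ∧
    (∃ M₀ : ℝ, ∀ M : ℝ, M₀ ≤ M →
      ∃ C : ℝ≥0, ∀ (W : Fin m → Type u) [∀ i, MeasurableSpace (W i)]
        (μ : ∀ i, Measure (W i)) [∀ i, SigmaFinite (μ i)],
        MaximalBoundedOn (bumpWeight M) s P P' R R' C W μ) := by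
  have hθ : ∀ j, 0 < 1 / s j := fun j => one_div_pos.2 (hs j)
  refine ⟨?_, ?_⟩
  · exact VVMaximal.exists_maximalBoundedOn hd hs hPloc hRloc hP hR
      VVMaximal.isCubeWeight_sharpWeight ENNReal.one_ne_top fun g _ x => (one_mul _).ge
  · have h0 : ∀ j, 0 ≤ (d : ℝ) + 1 + d * (∑ i, 1 / s i) / (1 / s j) := fun j => by
      have := hθ j
      have : 0 ≤ ∑ i, 1 / s i := Finset.sum_nonneg fun i _ => (hθ i).le
      positivity
    -- The terms are nonnegative, so their sum dominates each of them and also gives `0 ≤ M`.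
    refine ⟨∑ j, ((d : ℝ) + 1 + d * (∑ i, 1 / s i) / (1 / s j)), fun M hM => ?_⟩
    have hM0 : 0 ≤ M := (Finset.sum_nonneg fun j _ => h0 j).trans hM
    refine VVMaximal.exists_maximalBoundedOn hd hs hPloc hRloc hP hR
      (VVMaximal.isCubeWeight_bumpWeight hM0) (ENNReal.prod_ne_top fun j _ =>
        ENNReal.rpow_ne_top_of_nonneg (hθ j).le (ENNReal.mul_ne_top
          (ENNReal.pow_ne_top ENNReal.ofNat_ne_top) ENNReal.ofNat_ne_top))
      fun g hg x => VVMaximal.cubeMax_bump_le hθ (fun j => ?_) hM0 hg x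
    exact (Finset.single_le_sum (fun j _ => h0 j) (Finset.mem_univ j)).trans hM
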